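/- Let $n\ge 1$ and let $W(\tilde C_{n+1})$ be the Coxeter group with generators $\sigma_0,\sigma_1,\dots,\sigma_n,t_{n+1}$ and Coxeter diagram the path $\sigma_0-\sigma_1-\cdots-\sigma_n-t_{n+1}$ in which the first edge $\sigma_0-\sigma_1$ and the last edge $\sigma_n-t_{n+1}$ have label $4$ and all other edges have label $3$. Let $W(B_{n+1})$ be the Coxeter group with generators $\sigma_0,\dots,\sigma_n$ given by the same diagram without $t_{n+1}$. An element is fully commutative if one can pass from any reduced word for it to any other one by applying commutation relations $st=ts$ only; $W^c$ denotes the set of fully commutative elements of $W$. The affine length $L(w)$ is the number of occurrences of $t_{n+1}$ in a reduced word for $w$. Write $[i,j]=\sigma_i\sigma_{i+1}\cdots\sigma_j$ for $0\le i\le j\le n$, $[-i,j]=\sigma_i\sigma_{i-1}\cdots\sigma_1\sigma_0\sigma_1\cdots\sigma_j$ for $1\le i\le j\le n$, and let $[n+1,n]$ and $[0,-1]$ be the empty word. The inverse of a word is the reversed word. A word is said to be of Stembridge form if it is $[l_1,g_1][l_2,g_2]\cdots[l_r,g_r]$ with $r\ge 0$, $n\ge g_1>\dots>g_r\ge 0$,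 $|l_j|\le g_j$ for all $j$, and either $l_1>\dots>l_s>l_{s+1}=\dots=l_r=0$ for some $0\le s\le r$, or $r\geq 1$ and $l_1>\dots>l_{r-1}>-l_r>0$. **(a)** Let $w\in W^c(\tilde C_{n+1})$ with $L(w)\ge 2$. Then $w$ can be written in a unique way as a reduced word of one and only one of the following two forms, with integers $p,k\ge 0$. *First type:* $[i,n]\,t_{n+1}\,([-n,n]\,t_{n+1})^k\,([f,n])^{-1}$ with $-n\le i\le n+1$ and $-n\le f\le n+1$. *Second type:* $[i_1,n]\,t_{n+1}\,[i_2,n]\,t_{n+1}\cdots[i_p,n]\,t_{n+1}\,([0,n]\,t_{n+1})^k\,w_r$, where $-n\le i_j\le n+1$ for all $j$, where $w_r$ is a word of Stembridge form, and where * if $k>0$: $w_r=[0,r_1][0,r_2]\cdots[0,r_u]$ with $u\ge 0$ and $n\ge r_1>\dots>r_u\ge 0$; * if $p>0$: $n+1\ge i_1>\dots>i_{p-1}>|i_p|>0$; * if $p>0$ and $i_p<0$: $k=0$, $w_r=1$ and $i_p\ne -n$; * if $p>0$, $k=0$ and $i_p>0$: $w_r=1$, or $|l_1|<i_p$ in the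 Stembridge form of $w_r$. **(b)** Let $w\in W^c(\tilde C_{n+1})$ with $L(w)=1$. Then $w$ has a reduced word of the form $[i,n]\,t_{n+1}\,v$ where $-n\le i\le n+1$ and * if $i>0$: $v$ is of Stembridge form and, for every $1\le j\le r$, either $|l_j|=n-j+1$ or $|l_j|<i$; * if $i<0$: $v=([h,n])^{-1}$ with $-n\le h\le n+1$; * if $i=0$: either $v=([h,n])^{-1}$ with $-n\le h\le n+1$, or $v=([z,n])^{-1}[0,r_1][0,r_2]\cdots[0,r_m]$ with $m\geq 0$, $0\le z\le n+1$ and $-1\le r_m<\dots<r_1<z$. **(c)** Conversely, every word of one of the forms in (a) and (b) is reduced and represents a fully commutative element of $W(\tilde C_{n+1})$. Its affine length is $k+1$ for the first type, $p+k$ for the second type, and $1$ for the form in (b). For the second type, $p\le n+1$, and $w_r$ is a reduced word of an element of $W^c(B_{n+1})$. -/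

import Mathlib

/-- The type `B` Coxeter matrix with generators `σ_0, …, σ_n` (indexed by `0, …, n`), where the bond
of label `4` joins `σ_0` and `σ_1`. -/
def typeB (n : ℕ) : CoxeterMatrix (Fin (n + 1)) :=
  (CoxeterMatrix.B (n + 1)).reindex Fin.revPerm

/-- The affine type `C` Coxeter matrix on `n + 2` generators, for `1 ≤ n`. The indices `0, …, n` stand
for `σ_0, …, σ_n` and the last index `n + 1` stands for `t_{n+1}`. The diagram is a path, with label
`4` on its first and on its last bond and label `3` on the others. -/
def affineC (n : ℕ) : CoxeterMatrix (Fin (n + 2)) where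
  M := Matrix.of fun i j =>
    if i = j then 1
    else if (i : ℕ) + 1 = j ∨ (j : ℕ) + 1 = i then
      (if min (i : ℕ) j = 0 ∨ max (i : ℕ) j = n + 1 then 4 else 3)
    else 2
  isSymm := by
    ext i j
    simp only [Matrix.transpose_apply, Matrix.of_apply, eq_comm (a := j) (b := i),
      or_comm (a := (j : ℕ) + 1 = i), min_comm (j : ℕ) i, max_comm (j : ℕ) i]
  diagonal := by simp
  off_diagonal := by
    intro i j h
    simp only [Matrix.of_apply, if_neg h]
    split_ifs <;> simp

/-- Removing the last generator from the affine type `C` diagram leaves the type `B` diagram. -/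
theorem affineC_castSucc {n : ℕ} (hn : 1 ≤ n) (i j : Fin (n + 1)) :
    affineC n i.castSucc j.castSucc = typeB n i j := by
  have hi := i.isLt
  have hj := j.isLt
  simp only [affineC, typeB, CoxeterMatrix.B, CoxeterMatrix.reindex_apply, Matrix.of_apply,
    Fin.ext_iff, Fin.val_castSucc, Fin.revPerm_symm, Fin.revPerm_apply, Fin.val_rev]
  split_ifs <;> omega

/-- One application of a commutation relation to a word. -/
inductive CommStep {B : Type*} (M : CoxeterMatrix B) : List B → List B → Prop
  | swap (u v : List B) (s t : B) (h : M s t = 2) :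
      CommStep M (u ++ s :: t :: v) (u ++ t :: s :: v)

/-- An element is fully commutative if one can pass from any reduced word for it to any other one by
applying commutation relations only. -/
def IsFullyCommutative {B W : Type*} [Group W] {M : CoxeterMatrix B} (cs : CoxeterSystem M W)
    (w : W) : Prop :=
  ∀ ω ω' : List B, cs.IsReduced ω → cs.IsReduced ω' → cs.wordProd ω = w → cs.wordProd ω' = w →
    Relation.ReflTransGen (CommStep M) ω ω'

/-- The Coxeter system of affine type `C` with generators `σ_0, …, σ_n, t_{n+1}`. -/
abbrev csC (n : ℕ) : CoxeterSystem (affineC n) (affineC n).Group :=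
  (affineC n).toCoxeterSystem

/-- The Coxeter system of type `B` with generators `σ_0, …, σ_n`. -/
abbrev csB (n : ℕ) : CoxeterSystem (typeB n) (typeB n).Group :=
  (typeB n).toCoxeterSystem

/-- The affine length: the number of occurrences of `t_{n+1}` in a reduced word. -/
noncomputable def affineLength (n : ℕ) (w : (affineC n).Group) : ℕ :=
  ((csC n).exists_isReduced w).choose.count (Fin.last (n + 1))

/-- For a fully commutative element, any reduced word computes the affine length. -/
theorem affineLength_eq_count {n : ℕ} {w : (affineC n).Group} (hw : IsFullyCommutative (csC n) w)
    {ω : List (Fin (n + 2))} (hω : (csC n).IsReduced ω) (h : (csC n).wordProd ω = w) :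
    affineLength n w = ω.count (Fin.last (n + 1)) := by
  obtain ⟨h1, h2⟩ := ((csC n).exists_isReduced w).choose_spec
  have key := hw _ _ h1 hω h2.symm h
  unfold affineLength
  clear hω h
  induction key with
  | refl => rfl
  | tail _ hs ih =>
    rw [ih]
    cases hs with
    | swap u v s t _ =>
      simp only [List.count_append, List.count_cons]
      omega

/-- The list of the indices of the word `[i, j]`: it is `i, i + 1, …, j` if `0 ≤ i` (empty if
`i = j + 1`), and `-i, …, 1, 0, 1, …, j` if `i < 0`. -/
def bracketIndices (i j : ℤ) : List ℕ :=
  if 0 ≤ i then List.range' i.toNat (j + 1 - i).toNat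
  else (List.range' 1 (-i).toNat).reverse ++ 0 :: List.range' 1 j.toNat

/-- The word `[i, j]` in `σ_0, …, σ_n`, where `-j ≤ i ≤ j + 1` and `-1 ≤ j ≤ n`. -/
def bracket (n : ℕ) (i j : ℤ) : List (Fin (n + 1)) :=
  (bracketIndices i j).map (Fin.ofNat (n + 1))

/-- A word in `σ_0, …, σ_n` seen as a word in `σ_0, …, σ_n, t_{n+1}`. -/
def toC {n : ℕ} (ω : List (Fin (n + 1))) : List (Fin (n + 2)) :=
  ω.map Fin.castSucc

/-- The word `[i, n] t_{n+1}`. -/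
def block (n : ℕ) (i : ℤ) : List (Fin (n + 2)) :=
  toC (bracket n i n) ++ [Fin.last (n + 1)]

/-- The word `[l_1, g_1] [l_2, g_2] ⋯ [l_r, g_r]` given by the list of pairs `(l_j, g_j)`. -/
def bracketWord (n : ℕ) (b : List (ℤ × ℤ)) : List (Fin (n + 1)) :=
  b.flatMap fun x => bracket n x.1 x.2

/-- The conditions on `(l_1, g_1), …, (l_r, g_r)` in Stembridge's normal form for the fully commutative
elements of type `B`: `n ≥ g_1 > ⋯ > g_r ≥ 0`, `|l_j| ≤ g_j`, and
either `l_1 > ⋯ > l_s > l_{s+1} = ⋯ = l_r = 0` or `l_1 > ⋯ > l_{r-1} > -l_r > 0`. -/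
structure IsStembridge (n : ℕ) (b : List (ℤ × ℤ)) : Prop where
  bounds : ∀ x ∈ b, 0 ≤ x.2 ∧ x.2 ≤ n ∧ |x.1| ≤ x.2
  right_decreasing : (b.map Prod.snd).Pairwise (· > ·)
  left_condition :
    (∃ a c, b = a ++ c ∧ (a.map Prod.fst).Pairwise (· > ·) ∧ (∀ x ∈ a, 0 < x.1) ∧
      ∀ x ∈ c, x.1 = 0) ∨
    (∃ a x, b = a ++ [x] ∧ (a.map Prod.fst).Pairwise (· > ·) ∧ (∀ y ∈ a, -x.1 < y.1) ∧ x.1 < 0)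

/-- The parameters of a normal form: `i, k, f` for the first type, and for the second type
`i_1, …, i_p`, then `k`, and the pairs `(l_j, g_j)` of Stembridge's form of `w_r`. -/
inductive NormalForm
  | first (i : ℤ) (k : ℕ) (f : ℤ)
  | second (is : List ℤ) (k : ℕ) (b : List (ℤ × ℤ))

/-- The word of a normal form: `[i, n] t_{n+1} ([-n, n] t_{n+1})^k [f, n]⁻¹` for the first type, and
`[i_1, n] t_{n+1} ⋯ [i_p, n] t_{n+1} ([0, n] t_{n+1})^k w_r` for the second type. -/
def NormalForm.word (n : ℕ) : NormalForm → List (Fin (n + 2))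
  | .first i k f =>
      block n i ++ (List.replicate k (block n (-(n : ℤ)))).flatten ++ (toC (bracket n f n)).reverse
  | .second is k b =>
      is.flatMap (block n) ++ (List.replicate k (block n 0)).flatten ++ toC (bracketWord n b)

/-- The conditions on the parameters `i, f` of a normal form of the first type. -/
structure IsFirstType (n : ℕ) (i f : ℤ) : Prop where
  left_bounds : -(n : ℤ) ≤ i ∧ i ≤ n + 1
  right_bounds : -(n : ℤ) ≤ f ∧ f ≤ n + 1

/-- The conditions on the parameters of a normal form of the second type. In the last three fields,
`is = js ++ [ip]` says that `p > 0`, that `ip` is `i_p` and that `js` is `i_1, …, i_{p-1}`. -/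
structure IsSecondType (n : ℕ) (is : List ℤ) (k : ℕ) (b : List (ℤ × ℤ)) : Prop where
  stembridge : IsStembridge n b
  left_bounds : ∀ i ∈ is, -(n : ℤ) ≤ i ∧ i ≤ n + 1
  of_k_pos : 0 < k → ∀ x ∈ b, x.1 = 0
  decreasing : ∀ js ip, is = js ++ [ip] → (js ++ [|ip|]).Pairwise (· > ·) ∧ 0 < |ip|
  of_neg : ∀ js ip, is = js ++ [ip] → ip < 0 → k = 0 ∧ b = [] ∧ ip ≠ -(n : ℤ)
  of_pos : ∀ js ip, is = js ++ [ip] → k = 0 → 0 < ip → ∀ x ∈ b.head?, |x.1| < ip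

/-- The parameters of a normal form are admissible. -/
def NormalForm.IsValid (n : ℕ) : NormalForm → Prop
  | .first i _ f => IsFirstType n i f
  | .second is k b => IsSecondType n is k b

/-- The conditions on `i` and on the word `v` in the form `[i, n] t_{n+1} v` of the elements of affine
length `1`. The index `j` starts at `0` here. -/
inductive IsLengthOneForm (n : ℕ) : ℤ → List (Fin (n + 1)) → Prop
  | pos (i : ℤ) (b : List (ℤ × ℤ)) (hi : 0 < i ∧ i ≤ n + 1) (hb : IsStembridge n b)
      (h : ∀ (j : ℕ) (hj : j < b.length), |b[j].1| = (n : ℤ) - j ∨ |b[j].1| < i) :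
      IsLengthOneForm n i (bracketWord n b)
  | neg (i h : ℤ) (hi : -(n : ℤ) ≤ i ∧ i < 0) (hh : -(n : ℤ) ≤ h ∧ h ≤ n + 1) :
      IsLengthOneForm n i (bracket n h n).reverse
  | zero (h : ℤ) (hh : -(n : ℤ) ≤ h ∧ h ≤ n + 1) :
      IsLengthOneForm n 0 (bracket n h n).reverse
  | zero' (z : ℤ) (rs : List ℤ) (hz : 0 ≤ z ∧ z ≤ n + 1) (hrs : rs.Pairwise (· > ·))
      (hr : ∀ r ∈ rs, -1 ≤ r ∧ r < z) :
      IsLengthOneForm n 0 ((bracket n z n).reverse ++ rs.flatMap (bracket n 0))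

/-! Fully commutative elements are studied as commutation classes of words. By Stembridge's
criterion (`isReduced_and_comm_of_avoid`, `avoid_of_isFullyCommutative`), a word is reduced and
represents a fully commutative element exactly when no word of its commutation class has a factor
`ss`, `sts` with label 3, or `stst` with label 4. The criterion rests on the exchange property,
obtained from an action of the group on pairs (element, sign), and on a few non-relations between
generators, which are visible in a quotient by signed permutations.

Put N = n + 1, so that t_{n+1} is the letter N. Reading [l, g] as the absolute values of the
consecutive integers l, …, g turns both kinds of brackets into one kind of path, and reversal into
(l, g) ↦ (-g, -l). A word without forbidden factor is equivalent to a product of paths whose right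
ends decrease strictly, except that N may repeat (`exists_isShape`): a new letter on the left opens
a path, extends the first path, commutes past it, or creates a forbidden factor. The list of paths
is unique (`eq_of_comm_pathWord`): the first right end is the largest letter, and the first left end
is detected by `eq_nil_of_comm_chain`.

It remains to decide which canonical lists avoid the forbidden factors. Consecutive left ends must
satisfy `NormalStep`, a local version of Stembridge's condition, unless the first of the two paths
ends with N and the second starts with the letter N - 1 (`normal_or_exceptional`). If the first of
the two follows another path ending with N, this exception forces it to be the zigzag [-n, n]
t_{n+1} (`normal_of_prev`), and a zigzag can only be continued by zigzags and an initial part of one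
(`pathWord_eq_zigzag`). So with at least two letters N, the second left end decides the type: it is
-n for the first type, and otherwise the list is normal and gives the second type. With one letter N
no earlier path limits the exception, whence the extra families of affine length one.

For the converse, words are built from right to left; `Avoid.cons` allows a new letter under the
condition `Addable`, which is stable under commutations. -/

namespace CoxeterSystem

variable {B W : Type*} [Group W] {M : CoxeterMatrix B} (cs : CoxeterSystem M W)

/-! ### The exchange property from the signed action on group elements -/

theorem _root_.Function.End.mul_apply {α : Type*} (f g : Function.End α) (x : α) :
    (f * g) x = f (g x) := rfl

open Classical in
/-- The indicator of an equality, with values modulo two. -/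
noncomputable def eqIndicator {α : Type*} (a b : α) : ZMod 2 := if a = b then 1 else 0

theorem eqIndicator_self {α : Type*} (a : α) : eqIndicator a a = 1 := if_pos rfl

theorem eqIndicator_of_ne {α : Type*} {a b : α} (h : a ≠ b) : eqIndicator a b = 0 := if_neg h

theorem eqIndicator_congr {α : Type*} {a b c d : α} (h : a = b ↔ c = d) :
    eqIndicator a b = eqIndicator c d := by
  by_cases hab : a = b
  · rw [eqIndicator, eqIndicator, if_pos hab, if_pos (h.1 hab)]
  · rw [eqIndicator_of_ne hab, eqIndicator_of_ne (fun hcd => hab (h.2 hcd))]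

/-- The action of a simple reflection on the pairs (group element, sign), which records whether the
group element is the reflection itself. -/
noncomputable def signedConj (i : B) : Function.End (W × ZMod 2) := fun x =>
  (cs.simple i * x.1 * cs.simple i, x.2 + eqIndicator x.1 (cs.simple i))

theorem signedConj_apply (i : B) (x : W × ZMod 2) : cs.signedConj i x =
    (cs.simple i * x.1 * cs.simple i, x.2 + eqIndicator x.1 (cs.simple i)) := rfl

/-- This locates the sign changes of an alternating word: a pair starting at `t` meets the simple
reflection at an even step exactly when `t` is the palindrome given on the right. -/
theorem conj_eq_simple_iff (i j : B) (p : ℕ) (t : W) :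
    ((cs.simple i * cs.simple j) ^ p * t * (cs.simple j * cs.simple i) ^ p = cs.simple j) ↔
      t = (cs.simple j * cs.simple i) ^ (2 * p) * cs.simple j := by
  have hinv : ∀ p : ℕ, ((cs.simple i * cs.simple j) ^ p)⁻¹ = (cs.simple j * cs.simple i) ^ p := by
    intro p
    rw [← inv_pow, mul_inv_rev, cs.inv_simple, cs.inv_simple]
  have hswap : ∀ p : ℕ, cs.simple j * (cs.simple i * cs.simple j) ^ p =
      (cs.simple j * cs.simple i) ^ p * cs.simple j := by
    intro p
    induction p with
    | zero => simp
    | succ p ih => rw [pow_succ, ← mul_assoc, ih, pow_succ]; simp only [mul_assoc]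
  rw [← hinv p, mul_inv_eq_iff_eq_mul, ← eq_inv_mul_iff_mul_eq, hinv p, hswap, two_mul, pow_add,
    mul_assoc]

/-- Each simple factor contributes one indicator. The even indices come from `conj_eq_simple_iff`,
the odd ones from the same lemma with `i`, `j` exchanged, applied to the conjugate of `t` by
`cs.simple j`. -/
theorem signedConj_pow (i j : B) (p : ℕ) (t : W) (e : ZMod 2) :
    ((cs.signedConj i * cs.signedConj j) ^ p : Function.End (W × ZMod 2)) (t, e) =
    ((cs.simple i * cs.simple j) ^ p * t * (cs.simple j * cs.simple i) ^ p,
      e + ∑ k ∈ Finset.range (2 * p),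
        eqIndicator t ((cs.simple j * cs.simple i) ^ k * cs.simple j)) := by
  induction p with
  | zero => simp [Function.End.one_def]
  | succ p ih =>
    rw [pow_succ', Function.End.mul_apply, ih, Function.End.mul_apply,
      signedConj_apply, signedConj_apply]
    have h1 := cs.conj_eq_simple_iff i j p t
    have h2 : (cs.simple j * ((cs.simple i * cs.simple j) ^ p * t * (cs.simple j * cs.simple i) ^ p)
        * cs.simple j = cs.simple i) ↔
        t = (cs.simple j * cs.simple i) ^ (2 * p + 1) * cs.simple j := by
      have hj : ∀ a b : W, cs.simple j * a * cs.simple j = b ↔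
          a = cs.simple j * b * cs.simple j := by
        intro a b
        constructor <;> rintro rfl <;> simp [mul_assoc]
      have h3 := cs.conj_eq_simple_iff j i p (cs.simple j * t * cs.simple j)
      have h4 : (cs.simple j * cs.simple i) ^ p * (cs.simple j * t * cs.simple j) *
          (cs.simple i * cs.simple j) ^ p = cs.simple j * ((cs.simple i * cs.simple j) ^ p * t *
          (cs.simple j * cs.simple i) ^ p) * cs.simple j := by
        have e1 : ∀ p : ℕ, (cs.simple j * cs.simple i) ^ p * cs.simple j =
            cs.simple j * (cs.simple i * cs.simple j) ^ p := by
          intro p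
          induction p with
          | zero => simp
          | succ p ih => rw [pow_succ', mul_assoc, ih, pow_succ']; simp only [mul_assoc]
        rw [← mul_assoc, ← mul_assoc, e1]
        simp only [mul_assoc]
        rw [← e1]
      rw [h4, hj t] at h3
      rw [h3, pow_succ']
      simp only [mul_assoc]
      have e2 : ∀ p : ℕ, cs.simple i * ((cs.simple j * cs.simple i) ^ p * cs.simple j) =
          (cs.simple i * cs.simple j) ^ p * (cs.simple i * cs.simple j) := by
        intro p
        rw [← pow_succ]
        induction p with
        | zero => simp
        | succ p ih => rw [pow_succ' (cs.simple i * cs.simple j), ← ih, pow_succ']; simp only [mul_assoc]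
      rw [e2]
    simp only [eqIndicator_congr h1, eqIndicator_congr h2, Prod.mk.injEq]
    refine ⟨?_, ?_⟩
    · rw [pow_succ' (cs.simple i * cs.simple j), pow_succ (cs.simple j * cs.simple i)]
      simp only [mul_assoc]
    · rw [show 2 * (p + 1) = 2 * p + 1 + 1 by ring, Finset.sum_range_succ, Finset.sum_range_succ]
      simp only [add_assoc]

/-- At the exponent `M i j` the summands of `signedConj_pow` repeat with period `M i j`, so the two
halves of the sum cancel modulo two. -/
theorem signedConj_isLiftable : M.IsLiftable cs.signedConj := by
  intro i j
  funext ⟨t, e⟩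
  rw [signedConj_pow]
  have h : (cs.simple j * cs.simple i) ^ M i j = 1 := by simp
  have h' : (cs.simple i * cs.simple j) ^ M i j = 1 := by simp
  rw [two_mul, Finset.sum_range_add]
  simp only [pow_add, h, h', one_mul, mul_one, CharTwo.add_self_eq_zero, add_zero]
  rfl

/-- The action of the group extending `signedConj`. -/
noncomputable def signedAction (w : W) (x : W × ZMod 2) : W × ZMod 2 :=
  cs.lift ⟨_, cs.signedConj_isLiftable⟩ w x

theorem signedAction_one (x : W × ZMod 2) : cs.signedAction 1 x = x := by
  rw [signedAction, map_one]
  rfl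

theorem signedAction_mul (v w : W) (x : W × ZMod 2) :
    cs.signedAction (v * w) x = cs.signedAction v (cs.signedAction w x) := by
  rw [signedAction, map_mul]
  rfl

theorem signedAction_simple (i : B) (x : W × ZMod 2) :
    cs.signedAction (cs.simple i) x = cs.signedConj i x := by
  rw [signedAction, lift_apply_simple]

theorem signedAction_fst (ω : List B) (x : W × ZMod 2) :
    (cs.signedAction (cs.wordProd ω) x).1 = cs.wordProd ω * x.1 * (cs.wordProd ω)⁻¹ := by
  induction ω with
  | nil => simp [signedAction_one]
  | cons i ω ih =>
    rw [wordProd_cons, signedAction_mul, signedAction_simple, signedConj_apply, ih, mul_inv_rev,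
      inv_simple]
    simp only [mul_assoc]

/-- A reflection whose sign is changed by a word is obtained by deleting a letter of it. -/
theorem exists_deletion_of_signedAction (ω : List B) (t : W)
    (h : (cs.signedAction (cs.wordProd ω) (t, 0)).2 ≠ 0) :
    ∃ x i y, ω = x ++ i :: y ∧ cs.wordProd ω * t = cs.wordProd (x ++ y) := by
  induction ω with
  | nil => simp [signedAction_one] at h
  | cons i ω ih =>
    by_cases h0 : (cs.signedAction (cs.wordProd ω) (t, 0)).2 = 0
    · rw [wordProd_cons, signedAction_mul, signedAction_simple, signedConj_apply, h0,
        signedAction_fst] at h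
      have h1 : cs.wordProd ω * t * (cs.wordProd ω)⁻¹ = cs.simple i := by
        by_contra hne
        simp [eqIndicator_of_ne hne] at h
      refine ⟨[], i, ω, rfl, ?_⟩
      rw [mul_inv_eq_iff_eq_mul] at h1
      rw [wordProd_cons, mul_assoc, h1, ← mul_assoc]
      simp
    · obtain ⟨x, j, y, rfl, hxy⟩ := ih h0
      refine ⟨i :: x, j, y, rfl, ?_⟩
      rw [wordProd_cons, mul_assoc, hxy, List.cons_append, ← wordProd_cons]

/-- Take a reduced word `τ` for the shorter product. The sign of `τ` at the reflection `i` is zero,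
since otherwise a deletion in `τ` would make the longer element too short. The last factor `i`
itself flips the sign, so the sign of the full product is one and a letter of `ω` can be deleted. -/
theorem exchange_right (ω : List B) (i : B) (h : cs.IsRightDescent (cs.wordProd ω) i) :
    ∃ x j y, ω = x ++ j :: y ∧ cs.wordProd ω * cs.simple i = cs.wordProd (x ++ y) := by
  apply exists_deletion_of_signedAction
  obtain ⟨τ, hτ, hτw⟩ := cs.exists_isReduced (cs.wordProd ω * cs.simple i)
  have hw : cs.wordProd ω = cs.wordProd τ * cs.simple i := by
    rw [← hτw]; simp
  have h0 : (cs.signedAction (cs.wordProd τ) (cs.simple i, 0)).2 = 0 := by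
    by_contra hne
    obtain ⟨x, j, y, rfl, hxy⟩ := cs.exists_deletion_of_signedAction τ _ hne
    have h1 := cs.length_wordProd_le (x ++ y)
    rw [← hxy, ← hw] at h1
    have h2 : cs.length (cs.wordProd ω * cs.simple i) < cs.length (cs.wordProd ω) := h
    rw [hτw, hτ.eq] at h2
    simp at h1 h2
    omega
  have key : ∀ e : ZMod 2, (cs.signedAction (cs.wordProd τ) (cs.simple i, e)).2 =
      (cs.signedAction (cs.wordProd τ) (cs.simple i, 0)).2 + e := by
    intro e
    clear h0 hw hτw hτ
    induction τ with
    | nil => simp [signedAction_one]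
    | cons j τ ih =>
      simp only [wordProd_cons, signedAction_mul, signedAction_simple, signedConj_apply, ih,
        signedAction_fst]
      ring
  rw [hw, signedAction_mul, signedAction_simple]
  have : cs.signedConj i (cs.simple i, 0) = (cs.simple i, 1) := by
    simp [signedConj_apply, eqIndicator_self]
  rw [this, key, h0]
  decide

/-- The exchange property. -/
theorem exchange_left (ω : List B) (i : B) (h : cs.IsLeftDescent (cs.wordProd ω) i) :
    ∃ x j y, ω = x ++ j :: y ∧ cs.simple i * cs.wordProd ω = cs.wordProd (x ++ y) := by
  rw [← isRightDescent_inv_iff, ← wordProd_reverse] at h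
  obtain ⟨x, j, y, hω, hxy⟩ := cs.exchange_right _ _ h
  refine ⟨y.reverse, j, x.reverse, ?_, ?_⟩
  · rw [← List.reverse_reverse ω, hω]; simp
  · rw [← List.reverse_append, wordProd_reverse, ← hxy]
    simp

end CoxeterSystem

/-! ### Commutation classes of words and forbidden factors -/

/-- Two words are equivalent if one can pass from one to the other by commutation relations. -/
def Comm {B : Type*} (M : CoxeterMatrix B) : List B → List B → Prop :=
  Relation.ReflTransGen (CommStep M)

/-- The word starts with a forbidden factor whose first letter is `s`, where `w` is the word after the
first letter. -/
def HeadBad {B : Type*} (M : CoxeterMatrix B) (s : B) (w : List B) : Prop :=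
  (∃ y, w = s :: y) ∨ (∃ t y, M s t = 3 ∧ w = t :: s :: y) ∨
    ∃ t y, M s t = 4 ∧ w = t :: s :: t :: y

/-- The word has a factor of the form `ss`, or `sts` with `M s t = 3`, or `stst` with `M s t = 4`. -/
def Bad {B : Type*} (M : CoxeterMatrix B) : List B → Prop
  | [] => False
  | s :: w => HeadBad M s w ∨ Bad M w

/-- No word in the commutation class has a forbidden factor. -/
def Avoid {B : Type*} (M : CoxeterMatrix B) (w : List B) : Prop :=
  ∀ w', Comm M w w' → ¬ Bad M w'

section Words

variable {B : Type*} {M : CoxeterMatrix B}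

theorem CommStep.symm {w w' : List B} (h : CommStep M w w') : CommStep M w' w := by
  cases h with
  | swap u v s t h => exact .swap u v t s (by rw [M.symmetric]; exact h)

theorem CommStep.append_left {w w' : List B} (h : CommStep M w w') (x : List B) :
    CommStep M (x ++ w) (x ++ w') := by
  cases h with
  | swap u v s t h =>
    rw [← List.append_assoc, ← List.append_assoc]
    exact .swap _ v s t h

theorem CommStep.append_right {w w' : List B} (h : CommStep M w w') (x : List B) :
    CommStep M (w ++ x) (w' ++ x) := by
  cases h with
  | swap u v s t h =>
    simp only [List.append_assoc, List.cons_append]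
    exact .swap u _ s t h

theorem Comm.refl (w : List B) : Comm M w w := Relation.ReflTransGen.refl

theorem Comm.trans {a b c : List B} (h : Comm M a b) (h' : Comm M b c) : Comm M a c :=
  Relation.ReflTransGen.trans h h'

theorem Comm.symm {a b : List B} (h : Comm M a b) : Comm M b a := by
  induction h with
  | refl => exact .refl _
  | tail _ hs ih => exact Relation.ReflTransGen.head hs.symm ih

theorem Comm.append_left {w w' : List B} (h : Comm M w w') (x : List B) :
    Comm M (x ++ w) (x ++ w') :=
  Relation.ReflTransGen.lift (x ++ ·) (fun _ _ h => CommStep.append_left h x) _ _ h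

theorem Comm.append_right {w w' : List B} (h : Comm M w w') (x : List B) :
    Comm M (w ++ x) (w' ++ x) :=
  Relation.ReflTransGen.lift (· ++ x) (fun _ _ h => CommStep.append_right h x) _ _ h

theorem Comm.cons {w w' : List B} (h : Comm M w w') (s : B) : Comm M (s :: w) (s :: w') :=
  h.append_left [s]

theorem CommStep.perm {w w' : List B} (h : CommStep M w w') : w.Perm w' := by
  cases h with
  | swap u v s t h => exact (List.Perm.swap t s v).append_left u

theorem Comm.perm {w w' : List B} (h : Comm M w w') : w.Perm w' := by
  induction h with
  | refl => exact .refl _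
  | tail _ hs ih => exact ih.trans hs.perm

/-- A letter can be moved to the left through letters with which it commutes. -/
theorem Comm.move {x : List B} {s : B} (h : ∀ a ∈ x, M a s = 2) (y : List B) :
    Comm M (x ++ s :: y) (s :: (x ++ y)) := by
  induction x with
  | nil => exact .refl _
  | cons a x ih =>
    have h1 := (ih fun b hb => h b (List.mem_cons_of_mem _ hb)).cons a
    exact h1.trans (Relation.ReflTransGen.single (.swap [] _ a s (h a List.mem_cons_self)))

theorem bad_append_left {x w : List B} (h : Bad M w) : Bad M (x ++ w) := by
  induction x with
  | nil => exact h
  | cons a x ih => exact Or.inr ih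

theorem HeadBad.append_right {s : B} {w : List B} (h : HeadBad M s w) (y : List B) :
    HeadBad M s (w ++ y) := by
  rcases h with ⟨z, rfl⟩ | ⟨t, z, ht, rfl⟩ | ⟨t, z, ht, rfl⟩
  · exact .inl ⟨z ++ y, rfl⟩
  · exact .inr (.inl ⟨t, z ++ y, ht, rfl⟩)
  · exact .inr (.inr ⟨t, z ++ y, ht, rfl⟩)

theorem bad_append_right {w : List B} (h : Bad M w) (y : List B) : Bad M (w ++ y) := by
  induction w with
  | nil => exact h.elim
  | cons a x ih => exact h.imp (·.append_right y) ih

theorem bad_iff {w : List B} : Bad M w ↔ ∃ x s y, w = x ++ s :: y ∧ HeadBad M s y := by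
  constructor
  · intro h
    induction w with
    | nil => exact h.elim
    | cons a w ih =>
      rcases h with h | h
      · exact ⟨[], a, w, rfl, h⟩
      · obtain ⟨x, s, y, rfl, hy⟩ := ih h
        exact ⟨a :: x, s, y, rfl, hy⟩
  · rintro ⟨x, s, y, rfl, hy⟩
    exact bad_append_left (.inl hy)

theorem Avoid.of_comm {w w' : List B} (h : Avoid M w) (hw : Comm M w w') : Avoid M w' :=
  fun v hv => h v (hw.trans hv)

theorem Avoid.of_append_right {x w : List B} (h : Avoid M (x ++ w)) : Avoid M w :=
  fun v hv hb => h (x ++ v) (hv.append_left x) (bad_append_left hb)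

theorem Avoid.of_append_left {w x : List B} (h : Avoid M (w ++ x)) : Avoid M w :=
  fun v hv hb => h (v ++ x) (hv.append_right x) (bad_append_right hb x)

theorem Avoid.of_cons {s : B} {w : List B} (h : Avoid M (s :: w)) : Avoid M w :=
  Avoid.of_append_right (x := [s]) h

/-- Letters of a pairwise non-commuting set never pass each other, so the subword that they form is
an invariant of the commutation class. -/
theorem CommStep.filter {p : B → Bool} (hp : ∀ a b, p a → p b → M a b ≠ 2) {w w' : List B}
    (h : CommStep M w w') : w.filter p = w'.filter p := by
  cases h with
  | swap u v s t h =>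
    simp only [List.filter_append, List.filter_cons]
    have := hp s t
    split_ifs <;> simp_all

theorem Comm.filter {p : B → Bool} (hp : ∀ a b, p a → p b → M a b ≠ 2) {w w' : List B}
    (h : Comm M w w') : w.filter p = w'.filter p := by
  induction h with
  | refl => rfl
  | tail _ hs ih => exact ih.trans (hs.filter hp)

end Words

/-! ### Stembridge's criterion for reduced words of fully commutative elements -/

namespace CoxeterSystem

variable {B W : Type*} [Group W] {M : CoxeterMatrix B} (cs : CoxeterSystem M W)

theorem simple_comm_of_eq_two {s t : B} (h : M s t = 2) :
    cs.simple s * cs.simple t = cs.simple t * cs.simple s := by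
  have h1 := cs.simple_mul_simple_pow s t
  rw [h, pow_two] at h1
  have h2 := eq_inv_of_mul_eq_one_left h1
  rwa [mul_inv_rev, cs.inv_simple, cs.inv_simple] at h2

theorem simple_braid_of_eq_three {s t : B} (h : M s t = 3) :
    cs.simple s * (cs.simple t * cs.simple s) = cs.simple t * (cs.simple s * cs.simple t) := by
  have h1 := cs.simple_mul_simple_pow s t
  rw [h] at h1
  have h2 : cs.simple s * (cs.simple t * cs.simple s) * (cs.simple t * (cs.simple s * cs.simple t))
      = 1 := by
    rw [← h1, pow_three]
    simp only [mul_assoc]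
  rw [eq_inv_of_mul_eq_one_left h2]
  simp only [mul_inv_rev, inv_simple, mul_assoc]

theorem simple_braid_of_eq_four {s t : B} (h : M s t = 4) :
    cs.simple s * (cs.simple t * (cs.simple s * cs.simple t)) =
      cs.simple t * (cs.simple s * (cs.simple t * cs.simple s)) := by
  have h1 := cs.simple_mul_simple_pow s t
  rw [h] at h1
  have h2 : cs.simple s * (cs.simple t * (cs.simple s * cs.simple t)) *
      (cs.simple s * (cs.simple t * (cs.simple s * cs.simple t))) = 1 := by
    rw [← h1, pow_succ, pow_three]
    simp only [mul_assoc]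
  rw [eq_inv_of_mul_eq_one_left h2]
  simp only [mul_inv_rev, inv_simple, mul_assoc]

theorem wordProd_eq_of_commStep {w w' : List B} (h : CommStep M w w') :
    cs.wordProd w = cs.wordProd w' := by
  cases h with
  | swap u v s t h =>
    simp only [wordProd_append, wordProd_cons, ← mul_assoc]
    rw [mul_assoc _ (cs.simple s), cs.simple_comm_of_eq_two h]
    simp only [mul_assoc]

theorem wordProd_eq_of_comm {w w' : List B} (h : Comm M w w') :
    cs.wordProd w = cs.wordProd w' := by
  induction h with
  | refl => rfl
  | tail _ hs ih => exact ih.trans (cs.wordProd_eq_of_commStep hs)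

theorem IsReduced.of_comm {cs : CoxeterSystem M W} {w w' : List B} (hw : cs.IsReduced w)
    (h : Comm M w w') : cs.IsReduced w' := by
  rw [IsReduced, ← cs.wordProd_eq_of_comm h, hw.eq, h.perm.length_eq]

theorem IsReduced.of_append_right {cs : CoxeterSystem M W} {x y : List B}
    (h : cs.IsReduced (x ++ y)) : cs.IsReduced y := by
  simpa using h.drop x.length

theorem IsReduced.of_append_left {cs : CoxeterSystem M W} {x y : List B}
    (h : cs.IsReduced (x ++ y)) : cs.IsReduced x := by
  simpa using h.take x.length

/-- If `w` has the left descent `t` and a reduced word `A ++ x`, and if no deletion in `A` has the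
effect of the multiplication by `t`, then `w` has a reduced word starting with `t A`. -/
theorem exists_reduced_cons {A x : List B} {t : B} (h : cs.IsReduced (A ++ x))
    (ht : cs.IsLeftDescent (cs.wordProd (A ++ x)) t)
    (hA : ∀ a b j, A = a ++ j :: b → cs.simple t * cs.wordProd A ≠ cs.wordProd (a ++ b)) :
    ∃ y, cs.IsReduced (t :: A ++ y) ∧ cs.wordProd (t :: A ++ y) = cs.wordProd (A ++ x) := by
  obtain ⟨u, j, v, huv, hw⟩ := cs.exchange_left _ _ ht
  rcases List.append_eq_append_iff.1 huv with ⟨a, rfl, hx⟩ | ⟨a, hA', hx⟩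
  · have hp : cs.wordProd (t :: A ++ (a ++ v)) = cs.wordProd (A ++ x) := by
      rw [List.cons_append, ← List.append_assoc, wordProd_cons, ← hw]
      simp
    refine ⟨a ++ v, ?_, hp⟩
    rw [IsReduced, hp, h.eq, hx]
    simp only [List.length_append, List.length_cons]
    omega
  · rcases a with _ | ⟨k, a⟩
    · simp only [List.append_nil] at hA'
      simp only [List.nil_append] at hx
      subst hA' hx
      have hp : cs.wordProd (t :: A ++ v) = cs.wordProd (A ++ j :: v) := by
        rw [List.cons_append, wordProd_cons, ← hw]
        simp
      refine ⟨v, ?_, hp⟩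
      rw [IsReduced, hp, h.eq]
      simp only [List.length_append, List.length_cons]
      omega
    -- The deleted letter lies in `A`. Cancelling the common right factor leaves a relation of the
    -- kind excluded by `hA`.
    · simp only [List.cons_append, List.cons.injEq] at hx
      obtain ⟨rfl, rfl⟩ := hx
      exfalso
      refine hA u a j hA' ?_
      rw [wordProd_append, ← mul_assoc, ← List.append_assoc, wordProd_append cs (u ++ a)] at hw
      exact mul_right_cancel hw

theorem isLeftDescent_of_cons {s : B} {x : List B} (h : cs.IsReduced (s :: x)) :
    cs.IsLeftDescent (cs.wordProd (s :: x)) s := by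
  rw [IsLeftDescent, h.eq, wordProd_cons, simple_mul_simple_cancel_left]
  exact (cs.length_wordProd_le x).trans_lt (by simp)

/-- The generators satisfy no relation of length at most two except those given by the matrix, and the
labels are at most four. -/
structure IsSmallFaithful : Prop where
  le_four : ∀ s t, M s t = 1 ∨ M s t = 2 ∨ M s t = 3 ∨ M s t = 4
  simple_ne : ∀ s t, s ≠ t → cs.simple s ≠ cs.simple t
  not_comm : ∀ s t, M s t = 4 → cs.simple s * cs.simple t ≠ cs.simple t * cs.simple s

variable {cs}

/-- In this lemma and the next two, an element with left descents `s` and `t` gets longer and longer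
alternating prefixes by exchange: deleting a letter inside the prefix would impose a relation
contradicting `IsSmallFaithful`. -/
theorem exists_reduced_two (hcs : cs.IsSmallFaithful) {s t : B} (hst : s ≠ t) {x : List B}
    (h : cs.IsReduced (t :: x)) (hs : cs.IsLeftDescent (cs.wordProd (t :: x)) s) :
    ∃ y, cs.IsReduced (s :: t :: y) ∧ cs.wordProd (s :: t :: y) = cs.wordProd (t :: x) := by
  refine cs.exists_reduced_cons (A := [t]) h hs fun a b j hj he => ?_
  obtain ⟨rfl, rfl, rfl⟩ : a = [] ∧ t = j ∧ b = [] := by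
    rcases a with _ | ⟨_, _ | _⟩ <;> simp_all
  simp only [wordProd_singleton, List.append_nil, wordProd_nil] at he
  exact hcs.simple_ne s t hst (by rw [← cs.inv_simple t]; exact eq_inv_of_mul_eq_one_left he)

theorem exists_reduced_three (hcs : cs.IsSmallFaithful) {s t : B} (hst : s ≠ t) (h2 : M s t ≠ 2)
    {x : List B}
    (h : cs.IsReduced (s :: x)) (ht : cs.IsLeftDescent (cs.wordProd (s :: x)) t) :
    ∃ y, cs.IsReduced (s :: t :: s :: y) ∧
      cs.wordProd (s :: t :: s :: y) = cs.wordProd (s :: x) := by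
  obtain ⟨y, hy, hy'⟩ := exists_reduced_two hcs hst.symm h ht
  have hs : cs.IsLeftDescent (cs.wordProd (t :: s :: y)) s := by
    rw [hy']; exact cs.isLeftDescent_of_cons h
  rw [← hy']
  have hne := hcs.simple_ne s t hst
  refine cs.exists_reduced_cons (A := [t, s]) hy hs fun a b j hj he => ?_
  have hab : a ++ b = [s] ∨ a ++ b = [t] := by
    rcases a with _ | ⟨_, _ | ⟨_, _ | _⟩⟩ <;> simp_all
  rcases hab with hab | hab <;> rw [hab] at he <;>
    simp only [wordProd_cons, wordProd_nil, mul_one] at he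
  · have := mul_left_cancel (he.trans (mul_one _).symm)
    exact hne (by rw [← cs.inv_simple s]; exact (eq_inv_of_mul_eq_one_left this).symm)
  · have hc : cs.simple s * cs.simple t = cs.simple t * cs.simple s := by
      nth_rewrite 2 [← he]
      simp [mul_assoc]
    rcases hcs.le_four s t with h' | h' | h' | h'
    · have := (M.off_diagonal s t hst) h'
      exact this
    · exact h2 h'
    · have h3 := cs.simple_braid_of_eq_three h'
      rw [he] at h3
      have h4 := mul_left_cancel ((mul_one _).trans h3)
      exact hne (by rw [← cs.inv_simple t]; exact eq_inv_of_mul_eq_one_left h4.symm)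
    · exact hcs.not_comm s t h' hc

theorem exists_reduced_four (hcs : cs.IsSmallFaithful) {s t : B} (hst : s ≠ t) (h4 : M s t = 4)
    {x : List B}
    (h : cs.IsReduced (t :: x)) (hs : cs.IsLeftDescent (cs.wordProd (t :: x)) s) :
    ∃ y, cs.IsReduced (s :: t :: s :: t :: y) ∧
      cs.wordProd (s :: t :: s :: t :: y) = cs.wordProd (t :: x) := by
  obtain ⟨y, hy, hy'⟩ := exists_reduced_three hcs hst.symm (by rw [M.symmetric]; omega) h hs
  rw [← hy'] at hs ⊢
  have hne := hcs.simple_ne s t hst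
  refine cs.exists_reduced_cons (A := [t, s, t]) hy hs fun a b j hj he => ?_
  have hab : a ++ b = [s, t] ∨ a ++ b = [t, t] ∨ a ++ b = [t, s] := by
    rcases a with _ | ⟨_, _ | ⟨_, _ | ⟨_, _ | _⟩⟩⟩ <;>
      simp only [List.nil_append, List.cons_append, List.cons.injEq, reduceCtorEq, and_false] at hj <;>
      simp [← hj]
  rcases hab with hab | hab | hab <;> rw [hab] at he <;>
    simp only [wordProd_cons, wordProd_nil, mul_one, simple_mul_simple_self] at he
  · have h5 := mul_left_cancel he
    rw [← mul_assoc] at h5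
    have h6 := mul_right_cancel (h5.trans (one_mul _).symm)
    exact hne (by rw [← cs.inv_simple s]; exact (eq_inv_of_mul_eq_one_left h6).symm)
  · rw [← mul_assoc] at he
    have h6 := eq_inv_of_mul_eq_one_left he
    rw [mul_inv_rev, inv_simple, inv_simple] at h6
    exact hcs.not_comm s t h4 h6
  · rw [cs.simple_braid_of_eq_four h4] at he
    have h5 := mul_left_cancel (mul_left_cancel (he.trans (by rw [mul_one]) :
      _ = cs.simple t * (cs.simple s * 1)))
    exact hne (by rw [← cs.inv_simple s]; exact (eq_inv_of_mul_eq_one_left h5).symm)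

/-- Two different first letters force a common alternating prefix of length `M s t`. For label 2
this is a commutation; for labels 3 and 4 it is a forbidden factor. -/
theorem exists_reduced_braid (hcs : cs.IsSmallFaithful) {s t : B} (hst : s ≠ t) {x y : List B}
    (hx : cs.IsReduced (s :: x)) (hy : cs.IsReduced (t :: y))
    (hxy : cs.wordProd (s :: x) = cs.wordProd (t :: y)) :
    ∃ z, cs.IsReduced (s :: z) ∧ cs.wordProd (s :: z) = cs.wordProd (s :: x) ∧
      ((M s t = 2 ∧ ∃ v, z = t :: v) ∨ HeadBad M s z) := by
  have hs : cs.IsLeftDescent (cs.wordProd (t :: y)) s := by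
    rw [← hxy]; exact cs.isLeftDescent_of_cons hx
  have ht : cs.IsLeftDescent (cs.wordProd (s :: x)) t := by
    rw [hxy]; exact cs.isLeftDescent_of_cons hy
  rcases hcs.le_four s t with h' | h' | h' | h'
  · exact absurd h' (M.off_diagonal s t hst)
  · obtain ⟨v, hv, hv'⟩ := exists_reduced_two hcs hst hy hs
    exact ⟨_, hv, hv'.trans hxy.symm, .inl ⟨h', v, rfl⟩⟩
  · obtain ⟨v, hv, hv'⟩ := exists_reduced_three hcs hst (by omega) hx ht
    exact ⟨_, hv, hv', .inr (.inr (.inl ⟨t, v, h', rfl⟩))⟩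
  · obtain ⟨v, hv, hv'⟩ := exists_reduced_four hcs hst h' hy hs
    exact ⟨_, hv, hv'.trans hxy.symm, .inr (.inr (.inr ⟨t, v, h', rfl⟩))⟩

/-- A word whose commutation class has no forbidden factor is reduced, and any other reduced word for
the same element is in its commutation class. -/
theorem isReduced_and_comm_of_avoid (hcs : cs.IsSmallFaithful) {ω : List B} (h : Avoid M ω) :
    cs.IsReduced ω ∧
      ∀ τ, cs.IsReduced τ → cs.wordProd τ = cs.wordProd ω → Comm M ω τ := by
  induction hn : ω.length generalizing ω with
  | zero =>
    obtain rfl := List.length_eq_zero_iff.1 hn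
    refine ⟨by simp [IsReduced], fun τ hτ h1 => ?_⟩
    rw [IsReduced, h1] at hτ
    simp only [wordProd_nil, length_one] at hτ
    obtain rfl := List.length_eq_zero_iff.1 hτ.symm
    exact .refl _
  | succ n ih =>
    obtain ⟨s, ω, rfl⟩ : ∃ s ω', ω = s :: ω' := List.exists_cons_of_length_eq_add_one hn
    obtain ⟨hr, hc⟩ := ih h.of_cons (by simpa using hn)
    have hred : cs.IsReduced (s :: ω) := by
      -- If adding `s` shortened the element, `ω` would have a reduced word starting with `s`; by
      -- induction it lies in the class of `ω`, and the class of `s :: ω` would contain a factor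
      -- `ss`.
      rcases cs.length_simple_mul (cs.wordProd ω) s with h1 | h1
      · rw [IsReduced, wordProd_cons, h1, hr.eq]; rfl
      · obtain ⟨τ, hτ, hτw⟩ := cs.exists_isReduced (cs.simple s * cs.wordProd ω)
        have hp : cs.wordProd (s :: τ) = cs.wordProd ω := by
          rw [wordProd_cons, ← hτw, simple_mul_simple_cancel_left]
        have hred : cs.IsReduced (s :: τ) := by
          rw [IsReduced, hp, ← h1, hτw, hτ.eq]; rfl
        exact absurd (Or.inl (Or.inl ⟨τ, rfl⟩)) (h _ ((hc _ hred hp).cons s))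
    refine ⟨hred, fun τ hτ h1 => ?_⟩
    have hlen : τ.length = n + 1 := by rw [← hτ.eq, h1, hred.eq, hn]
    obtain ⟨t, τ, rfl⟩ : ∃ t τ', τ = t :: τ' := List.exists_cons_of_length_eq_add_one hlen
    have hcons : ∀ z, cs.IsReduced (s :: z) → cs.wordProd (s :: z) = cs.wordProd (s :: ω) →
        Comm M (s :: ω) (s :: z) := by
      intro z hz hz'
      refine (hc z (IsReduced.of_append_right (x := [s]) hz) ?_).cons s
      rw [wordProd_cons, wordProd_cons] at hz'
      exact mul_left_cancel hz'
    by_cases hst : s = t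
    · subst hst
      exact hcons _ hτ h1
    · obtain ⟨z, hz, hz', hv | hv⟩ := exists_reduced_braid hcs hst hred hτ h1.symm
      · obtain ⟨h2, v, rfl⟩ := hv
        have e1 := hcons _ hz hz'
        have e2 : Comm M (s :: t :: v) (t :: s :: v) :=
          Relation.ReflTransGen.single (.swap [] v s t h2)
        have e3 := h.of_comm (e1.trans e2)
        -- Now both words start with `t`, and the induction hypothesis applies to the tail `s :: v`,
        -- which still avoids.
        refine (e1.trans e2).trans (Comm.cons ?_ t)
        refine (ih e3.of_cons ?_).2 τ (IsReduced.of_append_right (x := [t]) hτ) ?_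
        · have := (e1.trans e2).perm.length_eq
          simp only [List.length_cons] at this hn ⊢
          omega
        · have e4 := cs.wordProd_eq_of_comm (e1.trans e2)
          rw [← h1, wordProd_cons, wordProd_cons] at e4
          exact mul_left_cancel e4
      · exact absurd (Or.inl hv) (h _ (hcons _ hz hz'))

theorem isFullyCommutative_of_avoid (hcs : cs.IsSmallFaithful) {ω : List B} (h : Avoid M ω) :
    IsFullyCommutative cs (cs.wordProd ω) := fun τ τ' hτ hτ' h1 h2 =>
  ((isReduced_and_comm_of_avoid hcs h).2 τ hτ h1).symm.trans
    ((isReduced_and_comm_of_avoid hcs h).2 τ' hτ' h2)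

open Classical in
-- A factor `ss` contradicts reducedness. Applying the braid relation to one of the other factors
-- changes which of `s`, `t` comes first there, hence changes the subword in these two letters,
-- which commutations preserve.
theorem avoid_of_isFullyCommutative {ω : List B} (hω : cs.IsReduced ω)
    (h : IsFullyCommutative cs (cs.wordProd ω)) : Avoid M ω := by
  intro τ hτ hb
  obtain ⟨x, s, y, rfl, hy⟩ := bad_iff.1 hb
  have hred := hω.of_comm hτ
  have hp := cs.wordProd_eq_of_comm hτ
  have key : ∀ t v v', s ≠ t → M s t ≠ 2 →
      cs.wordProd (s :: y) = cs.wordProd v → (s :: y).length = v.length →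
      (s :: y) = s :: v' → v.head? = some t → False := by
    intro t v v' hst hM h1 h2 _ h4
    have e : cs.wordProd (x ++ s :: y) = cs.wordProd (x ++ v) := by
      rw [wordProd_append, wordProd_append, h1]
    have hred' : cs.IsReduced (x ++ v) := by
      rw [IsReduced, ← e, hred.eq]
      simp only [List.length_append, h2]
    have hc : Comm M (x ++ s :: y) (x ++ v) := h _ _ hred hred' hp.symm (e.symm.trans hp.symm)
    have hf := hc.filter (p := fun a => a = s ∨ a = t) (by
      intro a b ha hb
      simp only [decide_eq_true_eq] at ha hb
      rcases ha with rfl | rfl <;> rcases hb with rfl | rfl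
      · simp
      · exact hM
      · rw [M.symmetric]; exact hM
      · simp)
    obtain ⟨v, rfl⟩ : ∃ v', v = t :: v' := by
      rcases v with _ | ⟨a, v⟩
      · simp at h4
      · simp only [List.head?_cons, Option.some.injEq] at h4
        exact ⟨v, by rw [h4]⟩
    simp [List.filter_append] at hf
    exact hst hf.1
  rcases hy with ⟨z, rfl⟩ | ⟨t, z, ht, rfl⟩ | ⟨t, z, ht, rfl⟩
  · have h1 : cs.IsReduced ([s, s] ++ z) := hred.of_append_right
    have h2 := h1.of_append_left
    rw [IsReduced] at h2
    simp [wordProd_cons] at h2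
  · have hst : s ≠ t := by rintro rfl; simp at ht
    refine key t (t :: s :: t :: z) _ hst (by omega) ?_ rfl rfl rfl
    have h3 := congrArg (· * cs.wordProd z) (cs.simple_braid_of_eq_three ht)
    simpa only [wordProd_cons, mul_assoc] using h3
  · have hst : s ≠ t := by rintro rfl; simp at ht
    refine key t (t :: s :: t :: s :: z) _ hst (by omega) ?_ rfl rfl rfl
    have h4 := congrArg (· * cs.wordProd z) (cs.simple_braid_of_eq_four ht)
    simpa only [wordProd_cons, mul_assoc] using h4

end CoxeterSystem

/-! ### Signed permutations and small faithfulness of the affine group -/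

/-- The sign change of an entry of a sequence. -/
def signChange (a : ℕ) : Function.End (ℕ → ℤ) := fun x k => if k = a then -x k else x k

/-- The exchange of two entries of a sequence. -/
def entrySwap (a b : ℕ) : Function.End (ℕ → ℤ) := fun x k =>
  if k = a then x b else if k = b then x a else x k

theorem signChange_apply (a : ℕ) (x : ℕ → ℤ) (k : ℕ) :
    signChange a x k = if k = a then -x k else x k := rfl

theorem entrySwap_apply (a b : ℕ) (x : ℕ → ℤ) (k : ℕ) :
    entrySwap a b x k = if k = a then x b else if k = b then x a else x k := rfl

theorem Function.End.one_apply {α : Type*} (x : α) : (1 : Function.End α) x = x := rfl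

theorem signChange_mul_self (a : ℕ) : signChange a * signChange a = 1 := by
  funext x k
  simp only [Function.End.mul_apply, Function.End.one_apply, signChange_apply]
  split_ifs <;> simp

theorem entrySwap_mul_self (a b : ℕ) : entrySwap a b * entrySwap a b = 1 := by
  funext x k
  simp only [Function.End.mul_apply, Function.End.one_apply, entrySwap_apply]
  split_ifs <;> simp_all

theorem entrySwap_comm (a b : ℕ) : entrySwap a b = entrySwap b a := by
  funext x k
  simp only [entrySwap_apply]
  split_ifs <;> simp_all

theorem signChange_commute (a b : ℕ) : signChange a * signChange b = signChange b * signChange a := by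
  funext x k
  simp only [Function.End.mul_apply, signChange_apply]
  split_ifs <;> rfl

theorem signChange_commute_entrySwap {a b c : ℕ} (hb : a ≠ b) (hc : a ≠ c) :
    signChange a * entrySwap b c = entrySwap b c * signChange a := by
  funext x k
  simp only [Function.End.mul_apply, signChange_apply, entrySwap_apply]
  split_ifs <;> simp_all

theorem entrySwap_commute {a b c d : ℕ} (hac : a ≠ c) (had : a ≠ d) (hbc : b ≠ c) (hbd : b ≠ d) :
    entrySwap a b * entrySwap c d = entrySwap c d * entrySwap a b := by
  funext x k
  simp only [Function.End.mul_apply, entrySwap_apply]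
  split_ifs <;> simp_all

theorem signChange_mul_entrySwap (a b : ℕ) :
    signChange a * entrySwap a b = entrySwap a b * signChange b := by
  funext x k
  simp only [Function.End.mul_apply, signChange_apply, entrySwap_apply]
  split_ifs <;> simp_all

theorem entrySwap_braid {a b c : ℕ} (hab : a ≠ b) (hbc : b ≠ c) (hac : a ≠ c) :
    entrySwap a b * entrySwap b c = entrySwap b c * entrySwap a c := by
  funext x k
  simp only [Function.End.mul_apply, entrySwap_apply]
  by_cases h1 : k = a <;> by_cases h2 : k = b <;> by_cases h3 : k = c <;>
    simp_all [Ne.symm hab, Ne.symm hbc, Ne.symm hac]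

theorem pow_two_of_commute {G : Type*} [Monoid G] {x y : G} (hx : x * x = 1) (hy : y * y = 1)
    (h : x * y = y * x) : (x * y) ^ 2 = 1 := by
  rw [pow_two]
  nth_rewrite 2 [h]
  rw [mul_assoc, ← mul_assoc y, hy, one_mul, hx]

theorem signChange_mul_entrySwap_pow (a b : ℕ) : (signChange a * entrySwap a b) ^ 4 = 1 := by
  have h : (signChange a * entrySwap a b) ^ 2 = signChange a * signChange b := by
    rw [pow_two]
    nth_rewrite 2 [signChange_mul_entrySwap]
    rw [mul_assoc, ← mul_assoc (entrySwap a b), entrySwap_mul_self, one_mul]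
  rw [show 4 = 2 * 2 by norm_num, pow_mul, h]
  exact pow_two_of_commute (signChange_mul_self a) (signChange_mul_self b) (signChange_commute a b)

theorem entrySwap_mul_signChange_pow (a b : ℕ) : (entrySwap a b * signChange a) ^ 4 = 1 := by
  rw [entrySwap_comm, ← signChange_mul_entrySwap, signChange_mul_entrySwap_pow]

theorem entrySwap_mul_entrySwap_pow {a b c : ℕ} (hab : a ≠ b) (hbc : b ≠ c) (hac : a ≠ c) :
    (entrySwap a b * entrySwap b c) ^ 3 = 1 := by
  have h1 := entrySwap_braid hab hbc hac
  have h2 := entrySwap_braid hbc hac.symm hab.symm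
  rw [entrySwap_comm c a, entrySwap_comm b a] at h2
  have h3 : entrySwap a b * entrySwap b c * (entrySwap a b * entrySwap b c *
      (entrySwap a b * entrySwap b c)) = entrySwap a b * entrySwap b c *
      (entrySwap b c * entrySwap a c * (entrySwap a c * entrySwap a b)) := by
    rw [← h2, ← h1]
  rw [pow_three, h3, mul_assoc, ← mul_assoc (entrySwap b c), ← mul_assoc (entrySwap b c),
    entrySwap_mul_self, one_mul, ← mul_assoc (entrySwap a c), entrySwap_mul_self, one_mul,
    entrySwap_mul_self]

/-- The action of the generators of the affine type `C` group on sequences: `σ_0` and `t_{n+1}` change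
the sign of the entries `0` and `n`, and `σ_i` exchanges the entries `i - 1` and `i`. -/
def signedPerm (n i : ℕ) : Function.End (ℕ → ℤ) :=
  if i = 0 then signChange 0 else if i = n + 1 then signChange n else entrySwap (i - 1) i

theorem affineC_apply (n : ℕ) (i j : Fin (n + 2)) : affineC n i j =
    if i = j then 1
    else if (i : ℕ) + 1 = j ∨ (j : ℕ) + 1 = i then
      (if min (i : ℕ) j = 0 ∨ max (i : ℕ) j = n + 1 then 4 else 3)
    else 2 := rfl

theorem signedPerm_mul_self (n i : ℕ) : signedPerm n i * signedPerm n i = 1 := by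
  rw [signedPerm]
  split_ifs
  exacts [signChange_mul_self _, signChange_mul_self _, entrySwap_mul_self _ _]

/-- Both end generators act by sign changes, so translations are lost. The quotient still separates
the generators and shows that neighbours with label 4 do not commute, which is all that
`IsSmallFaithful` asks for. -/
theorem signedPerm_isLiftable {n : ℕ} (hn : 1 ≤ n) :
    (affineC n).IsLiftable (fun i => signedPerm n i) := by
  intro i j
  have hi := i.isLt
  have hj := j.isLt
  rw [affineC_apply]
  split_ifs with h1 h2 h3
  · rw [h1, pow_one, signedPerm_mul_self]
  · rcases h2 with h2 | h2 <;> rcases h3 with h3 | h3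
    · obtain ⟨hi0, hj1⟩ : (i : ℕ) = 0 ∧ (j : ℕ) = 1 := by omega
      simp only [signedPerm, hi0, hj1, if_true, if_neg (show 1 ≠ n + 1 by omega), one_ne_zero,
        if_false]
      exact signChange_mul_entrySwap_pow 0 1
    · obtain ⟨hi0, hj1⟩ : (i : ℕ) = n ∧ (j : ℕ) = n + 1 := by omega
      simp only [signedPerm, hi0, hj1, if_true, if_neg (show n + 1 ≠ 0 by omega),
        if_neg (show n ≠ 0 by omega), if_neg (show n ≠ n + 1 by omega)]
      rw [entrySwap_comm]
      exact entrySwap_mul_signChange_pow _ _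
    · obtain ⟨hi0, hj1⟩ : (j : ℕ) = 0 ∧ (i : ℕ) = 1 := by omega
      simp only [signedPerm, hi0, hj1, if_true, if_neg (show 1 ≠ n + 1 by omega), one_ne_zero,
        if_false]
      exact entrySwap_mul_signChange_pow 0 1
    · obtain ⟨hi0, hj1⟩ : (j : ℕ) = n ∧ (i : ℕ) = n + 1 := by omega
      simp only [signedPerm, hi0, hj1, if_true, if_neg (show n + 1 ≠ 0 by omega),
        if_neg (show n ≠ 0 by omega), if_neg (show n ≠ n + 1 by omega)]
      rw [entrySwap_comm]
      exact signChange_mul_entrySwap_pow _ _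
  · obtain ⟨hi0, hj0, hin, hjn⟩ : (i : ℕ) ≠ 0 ∧ (j : ℕ) ≠ 0 ∧ (i : ℕ) ≠ n + 1 ∧ (j : ℕ) ≠ n + 1 := by
      omega
    simp only [signedPerm, hi0, hj0, hin, hjn, if_false]
    rcases h2 with h2 | h2
    · rw [show (j : ℕ) - 1 = i by omega]
      exact entrySwap_mul_entrySwap_pow (by omega) (by omega) (by omega)
    · rw [show (i : ℕ) - 1 = j by omega, entrySwap_comm j i, entrySwap_comm (j - 1) j]
      exact entrySwap_mul_entrySwap_pow (by omega) (by omega) (by omega)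
  · have hij : (i : ℕ) ≠ j := fun h => h1 (Fin.ext h)
    refine pow_two_of_commute (signedPerm_mul_self n i) (signedPerm_mul_self n j) ?_
    simp only [signedPerm]
    split_ifs
    all_goals first
      | exact signChange_commute _ _
      | exact signChange_commute_entrySwap (by omega) (by omega)
      | exact (signChange_commute_entrySwap (by omega) (by omega)).symm
      | exact entrySwap_commute (by omega) (by omega) (by omega) (by omega)

theorem signedPerm_ne_of_lt {n i j : ℕ} (hij : i < j) (hj : j ≤ n + 1) :
    (1 ≤ n) → signedPerm n i ≠ signedPerm n j := by
  intro hn h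
  -- The test sequence has distinct positive entries, so every sign change and every exchange is
  -- visible on it; the entry that distinguishes the two generators is `n` or `j`.
  have h2 : ∀ k : ℕ, _ := fun k => congrFun (congrFun h fun k => (k : ℤ) + 1) k
  by_cases hjn : j = n + 1
  · have h3 := h2 n
    simp only [signedPerm, hjn, if_neg (show n + 1 ≠ 0 by omega), if_neg (show i ≠ n + 1 by omega),
      if_true] at h3
    split_ifs at h3 <;> simp only [signChange_apply, entrySwap_apply] at h3 <;>
      split_ifs at h3 <;> omega
  · have h3 := h2 j
    simp only [signedPerm, hjn, if_neg (show j ≠ 0 by omega), if_neg (show i ≠ n + 1 by omega),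
      if_false] at h3
    split_ifs at h3 <;> simp only [signChange_apply, entrySwap_apply] at h3 <;>
      split_ifs at h3 <;> omega

theorem not_commute_signedPerm {n i j : ℕ} (hij : i + 1 = j) (h : i = 0 ∨ j = n + 1) (hn : 1 ≤ n) :
    signedPerm n i * signedPerm n j ≠ signedPerm n j * signedPerm n i := by
  intro h1
  rcases h with rfl | rfl
  · obtain rfl : j = 1 := by omega
    have h2 := congrFun (congrFun h1 fun k => (k : ℤ) + 1) 0
    simp [signedPerm, Function.End.mul_apply, signChange_apply, entrySwap_apply,
      show n ≠ 0 by omega] at h2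
  · obtain rfl : i = n := by omega
    have h2 := congrFun (congrFun h1 fun k => (k : ℤ) + 1) i
    simp [signedPerm, Function.End.mul_apply, signChange_apply, entrySwap_apply,
      show i ≠ 0 by omega] at h2
    omega

theorem csC_isSmallFaithful {n : ℕ} (hn : 1 ≤ n) : (csC n).IsSmallFaithful where
  le_four s t := by
    rw [affineC_apply]
    split_ifs <;> simp
  simple_ne s t hst h := by
    have h1 := congrArg ((csC n).lift ⟨_, signedPerm_isLiftable hn⟩) h
    rw [CoxeterSystem.lift_apply_simple, CoxeterSystem.lift_apply_simple] at h1
    rcases Nat.lt_or_gt_of_ne (fun h => hst (Fin.ext h)) with h2 | h2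
    · exact signedPerm_ne_of_lt h2 (by omega) hn h1
    · exact signedPerm_ne_of_lt h2 (by omega) hn h1.symm
  not_comm s t h4 h := by
    have h1 := congrArg ((csC n).lift ⟨_, signedPerm_isLiftable hn⟩) h
    rw [map_mul, map_mul, CoxeterSystem.lift_apply_simple, CoxeterSystem.lift_apply_simple] at h1
    rw [affineC_apply] at h4
    obtain ⟨h3, h5⟩ : ((s : ℕ) + 1 = t ∨ (t : ℕ) + 1 = s) ∧
        (min (s : ℕ) t = 0 ∨ max (s : ℕ) t = n + 1) := by
      split_ifs at h4
      · omega
      · exact ⟨‹_›, ‹_›⟩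
      all_goals omega
    rcases h3 with h3 | h3
    · exact not_commute_signedPerm h3 (by omega) hn h1
    · exact not_commute_signedPerm h3 (by omega) hn h1.symm

/-! ### The type B subdiagram -/

theorem simple_castSucc_isLiftable {n : ℕ} (hn : 1 ≤ n) :
    (typeB n).IsLiftable (fun i => (csC n).simple i.castSucc) := fun i j => by
  rw [← affineC_castSucc hn]
  exact (csC n).simple_mul_simple_pow _ _

/-- The inclusion of the type `B` group in the affine type `C` group. -/
noncomputable def inclB {n : ℕ} (hn : 1 ≤ n) : (typeB n).Group →* (affineC n).Group :=
  (csB n).lift ⟨_, simple_castSucc_isLiftable hn⟩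

theorem inclB_wordProd {n : ℕ} (hn : 1 ≤ n) (ω : List (Fin (n + 1))) :
    inclB hn ((csB n).wordProd ω) = (csC n).wordProd (toC ω) := by
  induction ω with
  | nil => simp [toC]
  | cons i ω ih =>
    rw [CoxeterSystem.wordProd_cons, map_mul, ih, inclB, CoxeterSystem.lift_apply_simple, toC, toC,
      List.map_cons, CoxeterSystem.wordProd_cons]

theorem length_inclB_le {n : ℕ} (hn : 1 ≤ n) (w : (typeB n).Group) :
    (csC n).length (inclB hn w) ≤ (csB n).length w := by
  obtain ⟨ω, hω, rfl⟩ := (csB n).exists_isReduced w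
  rw [inclB_wordProd, hω.eq]
  simpa [toC] using (csC n).length_wordProd_le (toC ω)

/-- The homomorphism does not increase lengths, so a shorter word in type B would shorten the image.
Injectivity of the inclusion is not needed. -/
theorem isReduced_of_toC {n : ℕ} (hn : 1 ≤ n) {ω : List (Fin (n + 1))}
    (h : (csC n).IsReduced (toC ω)) : (csB n).IsReduced ω := by
  have h1 := length_inclB_le hn ((csB n).wordProd ω)
  rw [inclB_wordProd, h.eq, toC, List.length_map] at h1
  exact le_antisymm ((csB n).length_wordProd_le ω) h1

section Transfer

variable {A B : Type*} {M : CoxeterMatrix A} {M' : CoxeterMatrix B} {f : A → B}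

theorem CommStep.map (hM : ∀ a b, M' (f a) (f b) = M a b) {w w' : List A} (h : CommStep M w w') :
    CommStep M' (w.map f) (w'.map f) := by
  cases h with
  | swap u v s t h =>
    simp only [List.map_append, List.map_cons]
    exact .swap _ _ _ _ (by rw [hM, h])

theorem Comm.map (hM : ∀ a b, M' (f a) (f b) = M a b) {w w' : List A} (h : Comm M w w') :
    Comm M' (w.map f) (w'.map f) :=
  Relation.ReflTransGen.lift (List.map f) (fun _ _ h => h.map hM) _ _ h

theorem Comm.exists_map (hM : ∀ a b, M' (f a) (f b) = M a b) {w : List A} {v : List B}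
    (h : Comm M' (w.map f) v) : ∃ w', v = w'.map f ∧ Comm M w w' := by
  induction h with
  | refl => exact ⟨w, rfl, .refl _⟩
  | tail _ hs ih =>
    obtain ⟨w', rfl, hw'⟩ := ih
    generalize hz : w'.map f = z at hs
    cases hs with
    | swap u v s t h =>
      obtain ⟨u', v', rfl, rfl, hv⟩ := List.map_eq_append_iff.1 hz
      obtain ⟨s', v', rfl, rfl, hv⟩ := List.map_eq_cons_iff.1 hv
      obtain ⟨t', v', rfl, rfl, rfl⟩ := List.map_eq_cons_iff.1 (List.cons.inj hv).2
      exact ⟨u' ++ t' :: s' :: v', by simp, hw'.tail (.swap _ _ _ _ (by rw [← hM, h]))⟩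

theorem comm_map_iff (hf : f.Injective) (hM : ∀ a b, M' (f a) (f b) = M a b) {w w' : List A} :
    Comm M' (w.map f) (w'.map f) ↔ Comm M w w' := by
  refine ⟨fun h => ?_, fun h => h.map hM⟩
  obtain ⟨v, hv, hv'⟩ := h.exists_map hM
  rwa [List.map_injective_iff.2 hf hv]

theorem headBad_map_iff (hf : f.Injective) (hM : ∀ a b, M' (f a) (f b) = M a b) {s : A}
    {w : List A} : HeadBad M' (f s) (w.map f) ↔ HeadBad M s w := by
  rcases w with _ | ⟨a, _ | ⟨b, _ | ⟨c, w⟩⟩⟩ <;> simp only [HeadBad, List.map_cons, List.map_nil] <;>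
    simp [hM, hf.eq_iff]

theorem bad_map_iff (hf : f.Injective) (hM : ∀ a b, M' (f a) (f b) = M a b) {w : List A} :
    Bad M' (w.map f) ↔ Bad M w := by
  induction w with
  | nil => rfl
  | cons a w ih => rw [List.map_cons, Bad, Bad, ih, headBad_map_iff hf hM]

theorem avoid_map_iff (hf : f.Injective) (hM : ∀ a b, M' (f a) (f b) = M a b) {w : List A} :
    Avoid M' (w.map f) ↔ Avoid M w := by
  refine ⟨fun h v hv hb => h _ (hv.map hM) ((bad_map_iff hf hM).2 hb), fun h v hv hb => ?_⟩
  obtain ⟨w', rfl, hw'⟩ := hv.exists_map hM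
  exact h _ hw' ((bad_map_iff hf hM).1 hb)

end Transfer

/-- Reduced words of the type B element have reduced images of the same length, and every word in
the commutation class of an image is again an image, so commutations can be pulled back. -/
theorem isFullyCommutative_of_toC {n : ℕ} (hn : 1 ≤ n) {ω : List (Fin (n + 1))}
    (h : (csC n).IsReduced (toC ω))
    (hf : IsFullyCommutative (csC n) ((csC n).wordProd (toC ω))) :
    IsFullyCommutative (csB n) ((csB n).wordProd ω) := by
  have hred := isReduced_of_toC hn h
  have key : ∀ τ, (csB n).IsReduced τ → (csB n).wordProd τ = (csB n).wordProd ω →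
      (csC n).IsReduced (toC τ) ∧ (csC n).wordProd (toC τ) = (csC n).wordProd (toC ω) := by
    intro τ hτ h1
    have h2 : (csC n).wordProd (toC τ) = (csC n).wordProd (toC ω) := by
      rw [← inclB_wordProd hn, ← inclB_wordProd hn, h1]
    refine ⟨?_, h2⟩
    rw [CoxeterSystem.IsReduced, h2, h.eq]
    simp only [toC, List.length_map]
    rw [← hτ.eq, h1, hred.eq]
  intro τ τ' hτ hτ' h1 h2
  obtain ⟨h3, h4⟩ := key τ hτ h1
  obtain ⟨h5, h6⟩ := key τ' hτ' h2
  exact (comm_map_iff (Fin.castSucc_injective _) (affineC_castSucc hn)).1 (hf _ _ h3 h5 h4 h6)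

/-! ### Cancellation in commutation classes -/

section Cancellation

variable {B : Type*} {M : CoxeterMatrix B}

/-- The letter `s` occurs in the word, and its first occurrence can be moved to the front. -/
def Front (M : CoxeterMatrix B) (s : B) : List B → Prop
  | [] => False
  | c :: w => c = s ∨ M c s = 2 ∧ Front M s w

theorem Front.step {s : B} {w w' : List B} (h : Front M s w) (hw : CommStep M w w') :
    Front M s w' := by
  cases hw with
  | swap u v p q hpq =>
    induction u with
    | nil =>
      simp only [List.nil_append, Front] at h ⊢
      rcases h with rfl | ⟨h1, rfl | ⟨h2, h3⟩⟩
      · exact .inr ⟨by rw [M.symmetric]; exact hpq, .inl rfl⟩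
      · exact .inl rfl
      · exact .inr ⟨h2, .inr ⟨h1, h3⟩⟩
    | cons a u ih => exact h.imp id fun h => ⟨h.1, ih h.2⟩

theorem Front.comm {s : B} {w w' : List B} (h : Front M s w) (hw : Comm M w w') :
    Front M s w' := by
  induction hw with
  | refl => exact h
  | tail _ hs ih => exact ih.step hs

theorem Front.exists_split {s : B} {w : List B} (h : Front M s w) :
    ∃ x y, w = x ++ s :: y ∧ s ∉ x ∧ ∀ a ∈ x, M a s = 2 := by
  induction w with
  | nil => exact h.elim
  | cons c w ih =>
    rcases h with rfl | ⟨h1, h2⟩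
    · exact ⟨[], w, rfl, by simp, by simp⟩
    · obtain ⟨x, y, rfl, hx, hx'⟩ := ih h2
      refine ⟨c :: x, y, rfl, ?_, ?_⟩
      · rintro (_ | ⟨_, h⟩)
        · simp at h1
        · exact hx h
      · rintro a (_ | ⟨_, h⟩)
        · exact h1
        · exact hx' a h

open Classical in
theorem CommStep.erase (s : B) {w w' : List B} (h : CommStep M w w') :
    Comm M (w.erase s) (w'.erase s) := by
  cases h with
  | swap u v p q hpq =>
    induction u with
    | nil =>
      simp only [List.nil_append, List.erase_cons]
      have hne : p ≠ q := by rintro rfl; simp at hpq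
      by_cases hp : p = s
      · subst hp
        simp [Ne.symm hne, Comm.refl]
      · by_cases hq : q = s
        · subst hq
          simp [hne, Comm.refl]
        · simp only [beq_iff_eq, hp, hq, if_false]
          exact Relation.ReflTransGen.single (.swap [] _ p q hpq)
    | cons a u ih =>
      simp only [List.cons_append, List.erase_cons]
      split_ifs
      · exact Relation.ReflTransGen.single (.swap u v p q hpq)
      · exact ih.cons a

open Classical in
theorem Comm.erase (s : B) {w w' : List B} (h : Comm M w w') :
    Comm M (w.erase s) (w'.erase s) := by
  induction h with
  | refl => exact .refl _
  | tail _ hs ih => exact ih.trans (hs.erase s)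

/-- Being movable to the front is stable under commutations, and so is erasing the first occurrence
of a letter up to equivalence. Together they follow the letter `s` through the class. -/
theorem Comm.exists_of_cons {s : B} {w w' : List B} (h : Comm M (s :: w) w') :
    ∃ x y, w' = x ++ s :: y ∧ s ∉ x ∧ (∀ a ∈ x, M a s = 2) ∧ Comm M w (x ++ y) := by
  classical
  have h0 : Front M s (s :: w) := Or.inl rfl
  obtain ⟨x, y, rfl, hx, hx'⟩ := (h0.comm h).exists_split
  refine ⟨x, y, rfl, hx, hx', ?_⟩
  have h1 := h.erase s
  rwa [List.erase_cons_head, List.erase_append_right _ hx, List.erase_cons_head] at h1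

theorem Comm.of_cons {s : B} {w w' : List B} (h : Comm M (s :: w) (s :: w')) : Comm M w w' := by
  classical
  have h1 := h.erase s
  rwa [List.erase_cons_head, List.erase_cons_head] at h1

theorem Comm.of_append {x w w' : List B} (h : Comm M (x ++ w) (x ++ w')) : Comm M w w' := by
  induction x with
  | nil => exact h
  | cons s x ih => exact ih h.of_cons

/-- If consecutive letters of `y ++ C` do not commute and are distinct, and if the last letter of `C`
is not in `y`, then `C R` and `y C R'` are equivalent only if `y` is empty. -/
theorem eq_nil_of_comm_chain {g : B} {C y R R' : List B}
    (hchain : (y ++ (C ++ [g])).IsChain fun a b => a ≠ b ∧ M a b ≠ 2) (hg : g ∉ y)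
    (h : Comm M (C ++ [g] ++ R) (y ++ (C ++ [g]) ++ R')) : y = [] := by
  induction hm : C.length + y.length using Nat.strong_induction_on generalizing C y R R' with
  | _ m ih =>
  rcases y with _ | ⟨x, y⟩
  · rfl
  exfalso
  -- The first letter `x` of the prefix must be movable to the front of `C g R`. The cases are its
  -- position there: in `R`, at the very front, or inside `C g`.
  obtain ⟨u, v, huv, hxu, hu, hcomm⟩ := Comm.exists_of_cons (s := x) (w' := C ++ [g] ++ R) h.symm
  have hgx : g ≠ x := fun h => hg (by simp [h])
  have hgy : g ∉ y := fun h => hg (by simp [h])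
  rcases List.append_eq_append_iff.1 huv with ⟨a, rfl, hR⟩ | ⟨a, hC, hv⟩
  · -- the letter `x` comes from `R`
    have h1 : y = [] := by
      refine ih _ ?_ (C := C) (y := y) (R := a ++ v) (R' := R') hchain.tail hgy ?_ rfl
      · simp only [List.length_cons] at hm; omega
      · rw [← List.append_assoc]; exact hcomm.symm
    subst h1
    have h2 : ∃ c C', C ++ [g] = c :: C' := by
      rcases C with _ | ⟨c, C⟩
      · exact ⟨g, [], rfl⟩
      · exact ⟨c, _, rfl⟩
    obtain ⟨c, C', hc⟩ := h2
    rw [hc] at hchain hu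
    have h3 := (List.isChain_cons_cons.1 hchain).1
    exact h3.2 (by rw [M.symmetric]; exact hu c (by simp))
  · rcases u with _ | ⟨c, u⟩
    · rcases C with _ | ⟨c, C⟩
      · rcases a with _ | ⟨c, a⟩
        · simp at hC
        · simp only [List.nil_append, List.cons_append, List.cons.injEq] at hC hv
          exact hgx (hC.1.trans hv.1.symm)
      · rcases a with _ | ⟨c', a⟩
        · simp at hC
        · simp only [List.nil_append, List.cons_append, List.cons.injEq] at hC hv
          obtain ⟨rfl, rfl⟩ := hC
          obtain ⟨rfl, rfl⟩ := hv
          -- After cancelling `x`, the prefix before the shortened `C` is `y` followed by `x`. The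
          -- prefix keeps its length while `C` loses a letter, so the induction measure drops.
          have h1 : y ++ [x] = [] := by
            refine ih _ ?_ (C := C) (y := y ++ [x]) (R := R) (R' := R') ?_ ?_ ?_ rfl
            · simp only [List.length_cons, List.length_append, List.length_nil] at hm ⊢
              omega
            · simpa using hchain.tail
            · simp [hgy, hgx]
            · simpa using hcomm.symm
          simp at h1
    · rcases a with _ | ⟨c', a⟩
      · rw [List.append_nil] at hC
        rw [List.nil_append] at hv
        have h1 : y = [] := by
          refine ih _ ?_ (C := C) (y := y) (R := v) (R' := R') hchain.tail hgy ?_ rfl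
          · simp only [List.length_cons] at hm; omega
          · have h2 := hcomm.symm
            rw [← hC] at h2
            exact h2
        subst h1
        rw [hC] at hchain
        exact ((List.isChain_cons_cons.1 hchain).1).2 (by
          rw [M.symmetric]; exact hu c (by simp))
      · simp only [List.cons_append, List.cons.injEq] at hv
        rw [hC, ← hv.1] at hchain
        -- The letter `l` just before `x` in the chain commutes with `x`, since `x` can be moved
        -- past it, but neighbours in the chain do not commute.
        obtain ⟨u', l, hl⟩ : ∃ u' l, c :: u = u' ++ [l] :=
          ⟨_, _, (List.dropLast_append_getLast (List.cons_ne_nil c u)).symm⟩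
        rw [hl] at hchain hu
        have h2 : l ≠ x ∧ M l x ≠ 2 :=
          List.isChain_iff_forall_rel_of_append_cons_cons.1 hchain
            (show _ = (x :: y ++ u') ++ l :: x :: a by simp)
        exact h2.2 (hu l (by simp))

end Cancellation

/-! ### A commutation-stable criterion for adding a letter -/

section Criterion

variable {B : Type*} {M : CoxeterMatrix B}

open Classical in
/-- At least `k` letters with the property `p` occur before the first occurrence of `s`, if there is
one. -/
def PrecededBy (p : B → Prop) (s : B) : ℕ → List B → Prop
  | 0, _ => True
  | _ + 1, [] => True
  | k + 1, c :: w => c ≠ s ∧ if p c then PrecededBy p s k w else PrecededBy p s (k + 1) w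

theorem precededBy_cons_of_pos {p : B → Prop} {s c : B} {k : ℕ} {w : List B} (hc : p c)
    (hs : c ≠ s) (h : PrecededBy p s k w) : PrecededBy p s (k + 1) (c :: w) := by
  rw [PrecededBy, if_pos hc]; exact ⟨hs, h⟩

theorem PrecededBy.mono {p : B → Prop} {s : B} {k l : ℕ} {w : List B} (h : PrecededBy p s l w)
    (hkl : k ≤ l) : PrecededBy p s k w := by
  induction w generalizing k l with
  | nil => rcases k with _ | k <;> trivial
  | cons c w ih =>
    rcases k with _ | k
    · trivial
    obtain ⟨l, rfl⟩ : ∃ l', l = l' + 1 := ⟨l - 1, by omega⟩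
    rw [PrecededBy] at h ⊢
    refine ⟨h.1, ?_⟩
    have h2 := h.2
    split_ifs at h2 ⊢
    · exact ih h2 (by omega)
    · exact ih h2 hkl

theorem precededBy_append {p : B → Prop} {s : B} {k : ℕ} {u w : List B} (hu : s ∉ u)
    (h : PrecededBy p s k w) : PrecededBy p s k (u ++ w) := by
  induction u with
  | nil => exact h
  | cons c u ih =>
    rw [List.mem_cons, not_or] at hu
    rcases k with _ | k
    · trivial
    rw [List.cons_append, PrecededBy]
    refine ⟨Ne.symm hu.1, ?_⟩
    split_ifs
    · exact (ih hu.2).mono (by omega)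
    · exact ih hu.2

theorem precededBy_of_notMem {p : B → Prop} {s : B} {k : ℕ} {w : List B} (hw : s ∉ w) :
    PrecededBy p s k w := by
  rw [← List.append_nil w]
  refine precededBy_append hw ?_
  rcases k with _ | k <;> trivial

/-- A letter with the property in a prefix without `s` counts. -/
theorem precededBy_succ_of_mem {p : B → Prop} {s c : B} {k : ℕ} {u w : List B} (hu : s ∉ u)
    (hc : c ∈ u) (hp : p c) (h : PrecededBy p s k w) : PrecededBy p s (k + 1) (u ++ w) := by
  obtain ⟨a, b, rfl⟩ := List.append_of_mem hc
  simp only [List.mem_append, List.mem_cons, not_or] at hu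
  rw [List.append_assoc]
  exact precededBy_append hu.1 (precededBy_cons_of_pos hp (Ne.symm hu.2.1)
    (precededBy_append hu.2.2 h))

theorem PrecededBy.of_append {p : B → Prop} {s : B} {k : ℕ} {u w : List B}
    (h : PrecededBy p s k (u ++ w)) : PrecededBy p s k u := by
  induction u generalizing k with
  | nil => rcases k with _ | k <;> trivial
  | cons c u ih =>
    rcases k with _ | k
    · trivial
    rw [List.cons_append, PrecededBy] at h
    rw [PrecededBy]
    refine ⟨h.1, ?_⟩
    have h2 := h.2
    split_ifs at h2 ⊢
    · exact ih h2
    · exact ih h2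

/-- The counted letters do not commute with `s`, so none of them can cross an occurrence of `s`. -/
theorem PrecededBy.step {p : B → Prop} {s : B} (hp : ∀ a, p a → M s a ≠ 2) {k : ℕ}
    {w w' : List B} (h : PrecededBy p s k w) (hw : CommStep M w w') : PrecededBy p s k w' := by
  cases hw with
  | swap u v a b hab =>
    induction u generalizing k with
    | nil =>
      have hne : a ≠ b := by rintro rfl; simp at hab
      have hba : M b a = 2 := by rw [M.symmetric]; exact hab
      rcases k with _ | _ | k
      · trivial
      all_goals
        simp only [List.nil_append, PrecededBy] at h ⊢
        by_cases ha : p a <;> by_cases hb : p b <;> simp only [ha, hb, if_true, if_false] at h ⊢ <;>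
        grind
    | cons c u ih =>
      rcases k with _ | k
      · trivial
      rw [List.cons_append, PrecededBy] at h ⊢
      refine ⟨h.1, ?_⟩
      have h2 := h.2
      split_ifs at h2 ⊢
      · exact ih h2
      · exact ih h2

/-- At least two letters that do not commute with `t` occur between the first two occurrences of `t`,
if there are two. -/
def GapTwo (M : CoxeterMatrix B) (t : B) : List B → Prop
  | [] => True
  | c :: w => (c = t ∧ PrecededBy (fun a => 3 ≤ M t a) t 2 w) ∨ (c ≠ t ∧ GapTwo M t w)

theorem GapTwo.of_append {t : B} {u w : List B} (h : GapTwo M t (u ++ w)) : GapTwo M t u := by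
  induction u with
  | nil => trivial
  | cons c u ih => exact h.imp (fun h => ⟨h.1, h.2.of_append⟩) fun h => ⟨h.1, ih h.2⟩

theorem gapTwo_append {t : B} {u w : List B} (hu : t ∉ u) (h : GapTwo M t w) :
    GapTwo M t (u ++ w) := by
  induction u with
  | nil => exact h
  | cons c u ih =>
    rw [List.mem_cons, not_or] at hu
    exact .inr ⟨Ne.symm hu.1, ih hu.2⟩

theorem GapTwo.step {t : B} {w w' : List B} (h : GapTwo M t w) (hw : CommStep M w w') :
    GapTwo M t w' := by
  have hp : ∀ a, 3 ≤ M t a → M t a ≠ 2 := fun a h => by omega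
  cases hw with
  | swap u v a b hab =>
    induction u with
    | nil =>
      have hne : a ≠ b := by rintro rfl; simp at hab
      have hba : M b a = 2 := by rw [M.symmetric]; exact hab
      simp only [List.nil_append, GapTwo] at h ⊢
      rcases h with ⟨rfl, h⟩ | ⟨h1, ⟨rfl, h⟩ | ⟨h2, h⟩⟩
      · refine .inr ⟨hne.symm, .inl ⟨rfl, ?_⟩⟩
        simp only [PrecededBy, hab] at h
        simpa using h.2
      · refine .inl ⟨rfl, ?_⟩
        simp only [PrecededBy, hba]
        simpa [hne] using h
      · exact .inr ⟨h2, .inr ⟨h1, h⟩⟩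
    | cons c u ih =>
      exact h.imp (fun h => ⟨h.1, h.2.step hp (.swap u v a b hab)⟩) fun h => ⟨h.1, ih h.2⟩

/-- A sufficient condition for adding the letter `s` in front of a word without forbidden factor. -/
def Addable (M : CoxeterMatrix B) (s : B) (w : List B) : Prop :=
  PrecededBy (fun a => 3 ≤ M s a) s 2 w ∨
    ∃ t, M s t = 4 ∧ PrecededBy (fun a => a = t) s 1 w ∧ GapTwo M t w

/-- Reaching the end of the word counts as success in both conditions, so they pass to prefixes.
Hence a word may be lengthened on the right before the condition is checked. -/
theorem Addable.of_append {s : B} {u w : List B} (h : Addable M s (u ++ w)) : Addable M s u :=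
  h.imp PrecededBy.of_append fun ⟨t, h1, h2, h3⟩ => ⟨t, h1, h2.of_append, h3.of_append⟩

theorem Addable.comm {s : B} {w w' : List B} (h : Addable M s w) (hw : Comm M w w') :
    Addable M s w' := by
  induction hw with
  | refl => exact h
  | tail _ hs ih =>
    refine ih.imp (fun h => h.step (fun a h => by omega) hs) ?_
    rintro ⟨t, h1, h2, h3⟩
    refine ⟨t, h1, h2.step (fun a h => ?_) hs, h3.step hs⟩
    subst h
    omega

theorem Addable.of_commuting_prefix {s : B} {x w : List B} (h : Addable M s (x ++ w)) (hs : s ∉ x)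
    (hx : ∀ a ∈ x, M a s = 2) : Addable M s w := by
  induction x with
  | nil => exact h
  | cons c x ih =>
    refine ih ?_ (fun h => hs (by simp [h])) fun a ha => hx a (by simp [ha])
    have hc : M s c = 2 := by rw [M.symmetric]; exact hx c (by simp)
    refine h.imp (fun h => ?_) ?_
    · simp only [List.cons_append, PrecededBy, hc] at h
      simpa using h.2
    · rintro ⟨t, h1, h2, h3⟩
      have hct : c ≠ t := by rintro rfl; omega
      refine ⟨t, h1, ?_, ?_⟩
      · simp only [List.cons_append, PrecededBy, hct] at h2
        simpa using h2.2
      · rcases h3 with h3 | h3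
        · exact absurd h3.1 hct
        · exact h3.2

/-- A forbidden factor starting with `s` has at most one letter before the next `s`, against the
first alternative. In the second alternative that letter must be the label-4 neighbour `t`, and
`stst` then has only one letter between its two `t`. -/
theorem Addable.not_headBad {s : B} {w : List B} (h : Addable M s w) : ¬ HeadBad M s w := by
  rintro (⟨y, rfl⟩ | ⟨t, y, ht, rfl⟩ | ⟨t, y, ht, rfl⟩)
  · rcases h with h | ⟨t, -, h, -⟩ <;> exact h.1 rfl
  · rcases h with h | ⟨r, hr, h, -⟩
    · simp [PrecededBy, ht] at h
    · have : t ≠ r := by rintro rfl; omega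
      simp [PrecededBy, this] at h
  · rcases h with h | ⟨r, hr, h, h'⟩
    · simp [PrecededBy, ht] at h
    · by_cases htr : t = r
      · subst htr
        rcases h' with ⟨-, h'⟩ | h'
        · have : M t s = 4 := by rw [M.symmetric]; exact ht
          simp [PrecededBy, this] at h'
        · exact h'.1 rfl
      · simp [PrecededBy, htr] at h

/-- Removing a letter which commutes with everything on its left from a word with a forbidden factor
leaves a forbidden factor, or the forbidden factor starts with this letter. -/
theorem Bad.remove {s : B} {x y : List B} (h : Bad M (x ++ s :: y)) (hs : s ∉ x)
    (hx : ∀ a ∈ x, M a s = 2) : Bad M (x ++ y) ∨ HeadBad M s y := by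
  induction x with
  | nil => exact h.symm
  | cons a x ih =>
    have hs' : s ∉ x := fun h => hs (by simp [h])
    have hx' : ∀ a ∈ x, M a s = 2 := fun a ha => hx a (by simp [ha])
    rw [List.cons_append, Bad] at h
    rcases h with h | h
    · refine .inl (.inl ?_)
      have has : a ≠ s := fun h => hs (by simp [h])
      have hMa : M a s = 2 := hx a (by simp)
      rcases h with ⟨z, hz⟩ | ⟨t, z, ht, hz⟩ | ⟨t, z, ht, hz⟩
      · rcases x with _ | ⟨b, x⟩ <;>
          simp only [List.nil_append, List.cons_append, List.cons.injEq] at hz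
        · exact absurd hz.1.symm has
        · exact .inl ⟨x ++ y, by simp [hz.1]⟩
      · rcases x with _ | ⟨b, _ | ⟨c, x⟩⟩ <;>
          simp only [List.nil_append, List.cons_append, List.cons.injEq] at hz
        · rw [← hz.1] at ht; omega
        · exact absurd hz.2.1.symm has
        · exact .inr (.inl ⟨t, x ++ y, ht, by simp [hz.1, hz.2.1]⟩)
      · rcases x with _ | ⟨b, _ | ⟨c, _ | ⟨d, x⟩⟩⟩ <;>
          simp only [List.nil_append, List.cons_append, List.cons.injEq] at hz
        · rw [← hz.1] at ht; omega
        · exact absurd hz.2.1.symm has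
        · exact absurd (hz.2.2.1.trans hz.1.symm) (fun h => hs' (by simp [h]))
        · exact .inr (.inr ⟨t, x ++ y, ht, by simp [hz.1, hz.2.1, hz.2.2.1]⟩)
    · exact (ih h hs' hx').imp_left .inr

/-- In any equivalent word, the new letter commutes with everything to its left. Thus a forbidden
factor either survives the removal of that letter, or starts with it, which `Addable` excludes. -/
theorem Avoid.cons {s : B} {w : List B} (h : Avoid M w) (hs : Addable M s w) :
    Avoid M (s :: w) := by
  intro w' hw' hb
  obtain ⟨x, y, rfl, hsx, hx, hc⟩ := hw'.exists_of_cons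
  rcases hb.remove hsx hx with h1 | h1
  · exact h _ hc h1
  · exact ((hs.comm hc).of_commuting_prefix hsx hx).not_headBad h1

theorem avoid_nil : Avoid M [] := by
  intro w hw hb
  rw [List.nil_perm.1 hw.perm] at hb
  exact hb

end Criterion

/-! ### Forbidden factors hidden by commutations -/

section Patterns

variable {B : Type*} {M : CoxeterMatrix B}

theorem not_avoid_of_three {s t : B} {x x' y : List B} (hst : M s t = 3)
    (hx : ∀ a ∈ x, M a s = 2) (hx' : ∀ a ∈ x', M a s = 2) :
    ¬ Avoid M (s :: (x ++ t :: (x' ++ s :: y))) := by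
  intro h
  have h1 : Comm M (s :: (x ++ t :: (x' ++ s :: y))) (x ++ s :: t :: s :: (x' ++ y)) := by
    refine (Comm.move hx _).symm.trans (Comm.append_left ?_ x)
    exact ((Comm.move hx' y).cons t).cons s
  exact h _ h1 (bad_append_left (.inl (.inr (.inl ⟨t, _, hst, rfl⟩))))

theorem not_avoid_of_four {s t : B} {x x' y : List B} (hst : M s t = 4)
    (hx : ∀ a ∈ x, M a s = 2) (hx' : ∀ a ∈ x', M a t = 2) :
    ¬ Avoid M (s :: (x ++ t :: s :: (x' ++ t :: y))) := by
  intro h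
  have h1 : Comm M (s :: (x ++ t :: s :: (x' ++ t :: y))) (x ++ s :: t :: s :: t :: (x' ++ y)) := by
    refine (Comm.move hx _).symm.trans (Comm.append_left ?_ x)
    exact (((Comm.move hx' y).cons s).cons t).cons s
  exact h _ h1 (bad_append_left (.inl (.inr (.inr ⟨t, _, hst, rfl⟩))))

theorem not_avoid_of_two {s : B} {x y : List B} (hx : ∀ a ∈ x, M a s = 2) :
    ¬ Avoid M (s :: (x ++ s :: y)) := fun h =>
  h _ ((Comm.move hx y).cons s) (.inl (.inl ⟨_, rfl⟩))

end Patterns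

/-! ### Letters as natural numbers, and brackets as paths of integers -/

/-- The affine type `C` Coxeter matrix extended to all natural numbers. -/
def natC (N : ℕ) : CoxeterMatrix ℕ where
  M := Matrix.of fun a b =>
    if a = b then 1
    else if a + 1 = b ∨ b + 1 = a then (if min a b = 0 ∨ max a b = N then 4 else 3)
    else 2
  isSymm := by
    ext i j
    simp only [Matrix.transpose_apply, Matrix.of_apply, eq_comm (a := j) (b := i),
      or_comm (a := j + 1 = i), min_comm j i, max_comm j i]
  diagonal := by simp
  off_diagonal := by
    intro i j h
    simp only [Matrix.of_apply, if_neg h]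
    split_ifs <;> simp

theorem natC_apply (N a b : ℕ) : natC N a b =
    if a = b then 1
    else if a + 1 = b ∨ b + 1 = a then (if min a b = 0 ∨ max a b = N then 4 else 3)
    else 2 := rfl

theorem natC_eq_two {N a b : ℕ} (h : a + 1 < b ∨ b + 1 < a) : natC N a b = 2 := by
  rw [natC_apply, if_neg (by omega), if_neg (by omega)]

theorem natC_eq_three {N a b : ℕ} (h : a + 1 = b ∨ b + 1 = a) (ha : 1 ≤ a) (hb : 1 ≤ b)
    (haN : a < N) (hbN : b < N) : natC N a b = 3 := by
  rw [natC_apply, if_neg (by omega), if_pos h, if_neg (by omega)]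

theorem natC_eq_four {N a b : ℕ} (h : a + 1 = b ∨ b + 1 = a) (hN : min a b = 0 ∨ max a b = N) :
    natC N a b = 4 := by
  rw [natC_apply, if_neg (by omega), if_pos h, if_pos hN]

theorem three_le_natC {N a b : ℕ} (h : a + 1 = b ∨ b + 1 = a) : 3 ≤ natC N a b := by
  rw [natC_apply, if_neg (by omega), if_pos h]
  split_ifs <;> omega

theorem natC_ne_two {N a b : ℕ} (h : a + 1 = b ∨ b + 1 = a) : a ≠ b ∧ natC N a b ≠ 2 :=
  ⟨by omega, by have := three_le_natC (N := N) h; omega⟩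

/-- The absolute values of the integers from `l` to `m`. -/
def path (l m : ℤ) : List ℕ := (List.range (m + 1 - l).toNat).map fun i : ℕ => (l + i).natAbs

theorem path_eq_nil {l m : ℤ} (h : m < l) : path l m = [] := by
  rw [path, show (m + 1 - l).toNat = 0 by omega]
  rfl

theorem path_cons {l m : ℤ} (h : l ≤ m) : path l m = l.natAbs :: path (l + 1) m := by
  rw [path, show (m + 1 - l).toNat = (m + 1 - (l + 1)).toNat + 1 by omega, List.range_succ_eq_map,
    path]
  simp only [List.map_cons, List.map_map, List.cons.injEq]
  refine ⟨by simp, List.map_congr_left fun i _ => ?_⟩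
  simp only [Function.comp_apply]
  congr 1
  push_cast
  ring

theorem path_split {l m : ℤ} (k : ℤ) (hl : l ≤ k + 1) (hm : k ≤ m) :
    path l m = path l k ++ path (k + 1) m := by
  obtain ⟨d, hd⟩ : ∃ d : ℕ, k + 1 - l = d := ⟨(k + 1 - l).toNat, by omega⟩
  induction d generalizing l with
  | zero =>
    obtain rfl : l = k + 1 := by omega
    rw [path_eq_nil (show k < k + 1 by omega)]
    rfl
  | succ d ih =>
    rw [path_cons (show l ≤ m by omega), path_cons (show l ≤ k by omega),
      ih (l := l + 1) (by omega) (by omega)]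
    rfl

theorem path_self (l : ℤ) : path l l = [l.natAbs] := by
  rw [path_cons le_rfl, path_eq_nil (by omega)]

theorem path_concat {l m : ℤ} (h : l ≤ m) : path l m = path l (m - 1) ++ [m.natAbs] := by
  rw [path_split (m - 1) (by omega) (by omega), show m - 1 + 1 = m by ring, path_self]

theorem path_split_one {l m : ℤ} (k : ℤ) {a : ℕ} (hl : l ≤ k) (hm : k ≤ m) (ha : k.natAbs = a) :
    path l m = path l (k - 1) ++ a :: path (k + 1) m := by
  rw [path_split (k - 1) (by omega) (by omega), sub_add_cancel, path_cons hm, ha]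

theorem path_split_two {l m : ℤ} (k : ℤ) {a b : ℕ} (hl : l ≤ k) (hm : k + 1 ≤ m)
    (ha : k.natAbs = a) (hb : (k + 1).natAbs = b) :
    path l m = path l (k - 1) ++ a :: b :: path (k + 2) m := by
  rw [path_split_one k hl (by omega) ha, path_cons hm, hb, add_assoc]
  rfl

theorem mem_path {l m : ℤ} {a : ℕ} : a ∈ path l m ↔ ∃ j, l ≤ j ∧ j ≤ m ∧ a = j.natAbs := by
  simp only [path, List.mem_map, List.mem_range]
  constructor
  · rintro ⟨i, hi, rfl⟩
    exact ⟨l + i, by omega, by omega, rfl⟩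
  · rintro ⟨j, h1, h2, rfl⟩
    exact ⟨(j - l).toNat, by omega, by congr 1; omega⟩

theorem path_reverse (l m : ℤ) : (path l m).reverse = path (-m) (-l) := by
  obtain ⟨d, hd⟩ : ∃ d : ℕ, (m + 1 - l).toNat = d := ⟨_, rfl⟩
  induction d generalizing l with
  | zero => rw [path_eq_nil (by omega), path_eq_nil (by omega)]; rfl
  | succ d ih =>
    rw [path_cons (by omega), List.reverse_cons, ih (l + 1) (by omega),
      path_concat (show -m ≤ -l by omega), Int.natAbs_neg]
    congr 2
    ring

theorem isChain_path (N : ℕ) (l m : ℤ) :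
    (path l m).IsChain fun a b => a ≠ b ∧ natC N a b ≠ 2 := by
  obtain ⟨d, hd⟩ : ∃ d : ℕ, (m + 1 - l).toNat = d := ⟨_, rfl⟩
  induction d generalizing l with
  | zero => rw [path_eq_nil (by omega)]; exact .nil
  | succ d ih =>
    rw [path_cons (by omega)]
    rcases lt_or_ge m (l + 1) with h | h
    · rw [path_eq_nil h]; exact .singleton _
    · have h1 := ih (l + 1) (by omega)
      rw [path_cons h] at h1 ⊢
      exact List.isChain_cons_cons.2 ⟨natC_ne_two (by omega), h1⟩

/-- The hypothesis matters: if both ends are negative, `bracketIndices` still inserts the letter 0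
and the path does not. -/
theorem bracketIndices_eq_path {i j : ℤ} (h : 0 ≤ i ∨ 0 ≤ j) : bracketIndices i j = path i j := by
  have hpos : ∀ (k : ℕ) (j : ℤ), List.range' k (j + 1 - k).toNat = path k j := by
    intro k j
    obtain ⟨d, hd⟩ : ∃ d : ℕ, (j + 1 - k).toNat = d := ⟨_, rfl⟩
    induction d generalizing k with
    | zero => rw [hd, path_eq_nil (by omega)]; rfl
    | succ d ih =>
      rw [hd, path_cons (by omega), List.range'_succ, ← Nat.cast_succ, ← ih (k + 1) (by omega)]
      congr 2
      omega
  rw [bracketIndices]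
  split_ifs with hi
  · obtain ⟨k, rfl⟩ := Int.eq_ofNat_of_zero_le hi
    exact hpos k j
  · have hj : 0 ≤ j := by omega
    rw [path_split (-1) (by omega) (by omega)]
    congr 1
    · have h1 := hpos 1 (-i)
      rw [show (-i + 1 - (1 : ℕ)).toNat = (-i).toNat by omega] at h1
      rw [h1, path_reverse]
      simp
    · rw [path_cons (by omega)]
      have h1 := hpos 1 j
      rw [show (j + 1 - (1 : ℕ)).toNat = j.toNat by omega] at h1
      rw [h1]
      rfl

/-! ### Canonical lists: existence and uniqueness -/

/-- The word `[l_1, g_1] [l_2, g_2] ⋯` in natural numbers. -/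
def pathWord (c : List (ℤ × ℤ)) : List ℕ := c.flatMap fun x => path x.1 x.2

theorem pathWord_cons (x : ℤ × ℤ) (c : List (ℤ × ℤ)) :
    pathWord (x :: c) = path x.1 x.2 ++ pathWord c := rfl

theorem pathWord_append (c c' : List (ℤ × ℤ)) :
    pathWord (c ++ c') = pathWord c ++ pathWord c' := by
  simp [pathWord]

/-- The canonical lists of pairs, where `N` is the last letter: the right ends decrease strictly,
except that the letter `N` can be repeated. -/
structure IsShape (N : ℕ) (c : List (ℤ × ℤ)) : Prop where
  bounds : ∀ x ∈ c, 0 ≤ x.2 ∧ x.2 ≤ N ∧ -x.2 ≤ x.1 ∧ x.1 ≤ x.2 ∧ (x.2 = N → -(N : ℤ) < x.1)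
  pairwise : c.Pairwise fun x y => y.2 < x.2 ∨ (x.2 = (N : ℤ) ∧ y.2 = (N : ℤ))

theorem IsShape.tail {N : ℕ} {x : ℤ × ℤ} {c : List (ℤ × ℤ)} (h : IsShape N (x :: c)) :
    IsShape N c :=
  ⟨fun y hy => h.bounds y (List.mem_cons_of_mem _ hy), (List.pairwise_cons.1 h.pairwise).2⟩

theorem IsShape.of_append {N : ℕ} {c c' : List (ℤ × ℤ)} (h : IsShape N (c ++ c')) :
    IsShape N c' :=
  ⟨fun y hy => h.bounds y (List.mem_append_right _ hy), (List.pairwise_append.1 h.pairwise).2.1⟩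

theorem isShape_cons {N : ℕ} {x : ℤ × ℤ} {c : List (ℤ × ℤ)} : IsShape N (x :: c) ↔
    (0 ≤ x.2 ∧ x.2 ≤ N ∧ -x.2 ≤ x.1 ∧ x.1 ≤ x.2 ∧ (x.2 = N → -(N : ℤ) < x.1)) ∧
      (∀ y ∈ c, y.2 < x.2 ∨ (x.2 = N ∧ y.2 = N)) ∧ IsShape N c := by
  constructor
  · intro h
    exact ⟨h.bounds x List.mem_cons_self, (List.pairwise_cons.1 h.pairwise).1, h.tail⟩
  · rintro ⟨h1, h2, h3⟩
    exact ⟨List.forall_mem_cons.2 ⟨h1, h3.bounds⟩, List.pairwise_cons.2 ⟨h2, h3.pairwise⟩⟩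

theorem exists_of_mem_pathWord {c : List (ℤ × ℤ)} {a : ℕ} (h : a ∈ pathWord c) :
    ∃ x ∈ c, a ∈ path x.1 x.2 := List.mem_flatMap.1 h

theorem IsShape.le_of_mem {N : ℕ} {c : List (ℤ × ℤ)} (h : IsShape N c) {a : ℕ}
    (ha : a ∈ pathWord c) : ∃ x ∈ c, (a : ℤ) ≤ x.2 := by
  obtain ⟨x, hx, hax⟩ := exists_of_mem_pathWord ha
  obtain ⟨j, h1, h2, rfl⟩ := mem_path.1 hax
  have := h.bounds x hx
  exact ⟨x, hx, by omega⟩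

/-- Adding a letter in front of the word of a canonical list. -/
theorem exists_isShape_cons {N : ℕ} (hN : 1 ≤ N) {s : ℕ} (hs : s ≤ N) {c : List (ℤ × ℤ)}
    (hc : IsShape N c) (h : Avoid (natC N) (s :: pathWord c)) :
    ∃ c', IsShape N c' ∧ Comm (natC N) (s :: pathWord c) (pathWord c') ∧
      ∀ x ∈ c', x.2 = s ∨ ∃ y ∈ c, x.2 = y.2 := by
  have hnew : ∀ c, pathWord (((s : ℤ), (s : ℤ)) :: c) = s :: pathWord c := by
    intro c
    rw [pathWord_cons]
    simp [path_self]
  induction c with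
  | nil =>
    refine ⟨[((s : ℤ), (s : ℤ))], ?_, ?_, by simp⟩
    · rw [isShape_cons]
      exact ⟨by simp only; omega, fun y hy => absurd hy (by simp), hc⟩
    · rw [hnew]; exact .refl _
  | cons x c ih =>
    obtain ⟨l, g⟩ := x
    obtain ⟨⟨hg0, hgN, hlg, hlg', hgl⟩, hlt, hc'⟩ := isShape_cons.1 hc
    simp only at hg0 hgN hlg hlg' hgl hlt
    -- The letter opens a new path when it exceeds the first right end, and always when it is N, so
    -- that a path ending with N contains N only once.
    by_cases hsg : g < s ∨ s = N
    · refine ⟨(s, s) :: (l, g) :: c, isShape_cons.2 ⟨by simp only; omega, ?_, hc⟩, ?_, ?_⟩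
      · rintro y (_ | ⟨_, hy⟩)
        · simp only; omega
        · have := hlt y hy
          simp only; omega
      · rw [hnew]; exact .refl _
      · rintro y (_ | ⟨_, hy⟩)
        · exact .inl rfl
        · exact .inr ⟨y, hy, rfl⟩
    obtain ⟨hsg, hsN⟩ : (s : ℤ) ≤ g ∧ s < N := by omega
    by_cases hext : (s : ℤ) + 1 = l ∨ (l ≤ 0 ∧ (s : ℤ) = 1 - l)
    · refine ⟨(l - 1, g) :: c, isShape_cons.2 ⟨by simp only; omega, hlt, hc'⟩, ?_, ?_⟩
      · rw [pathWord_cons, pathWord_cons, path_cons (show l - 1 ≤ g by omega),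
          show (l - 1).natAbs = s by omega, sub_add_cancel]
        exact .refl _
      · rintro y (_ | ⟨_, hy⟩)
        · exact .inr ⟨_, List.mem_cons_self, rfl⟩
        · exact .inr ⟨y, List.mem_cons_of_mem _ hy, rfl⟩
    by_cases hcomm : (s : ℤ) + 1 < l
    · have hx : ∀ a ∈ path l g, natC N a s = 2 := by
        intro a ha
        obtain ⟨j, h1, h2, rfl⟩ := mem_path.1 ha
        exact natC_eq_two (by omega)
      have h1 : Comm (natC N) (s :: pathWord ((l, g) :: c)) (path l g ++ s :: pathWord c) :=
        (Comm.move hx _).symm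
      obtain ⟨c', h2, h3, h4⟩ := ih hc' (h.of_comm h1).of_append_right
      refine ⟨(l, g) :: c', isShape_cons.2 ⟨⟨hg0, hgN, hlg, hlg', hgl⟩, ?_, h2⟩,
        h1.trans (h3.append_left _), ?_⟩
      · intro y hy
        rcases h4 y hy with h5 | ⟨z, hz, h5⟩
        · rw [h5]; simp only; omega
        · rw [h5]; exact hlt z hz
      · rintro y (_ | ⟨_, hy⟩)
        · exact .inr ⟨_, List.mem_cons_self, rfl⟩
        · rcases h4 y hy with h5 | ⟨z, hz, h5⟩
          · exact .inl h5
          · exact .inr ⟨z, List.mem_cons_of_mem _ hz, h5⟩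
    -- The letter now meets the first path without extending it or commuting with it. Its position
    -- relative to `l` yields `s s`, `s (s-1) s`, `0 1 0 1` or `s (s+1) s`, up to commutations.
    exfalso
    rw [pathWord_cons] at h
    simp only at h
    have h' : Avoid (natC N) (s :: path l g) := Avoid.of_append_left (x := pathWord c) h
    clear h ih hnew
    by_cases hsl : s = l.natAbs
    · rw [path_cons hlg', ← hsl] at h'
      exact not_avoid_of_two (x := []) (by simp) h'
    by_cases hs2 : -l + 1 < s ∧ l < s
    · rw [path_split_two (s - 1) (a := s - 1) (b := s) (by omega) (by omega) (by omega)
        (by omega)] at h'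
      refine not_avoid_of_three (x' := []) (natC_eq_three ?_ ?_ ?_ ?_ ?_) ?_ (by simp) h' <;>
        try omega
      intro a ha
      obtain ⟨j, h1, h2, rfl⟩ := mem_path.1 ha
      exact natC_eq_two (by omega)
    obtain ⟨hl, hsl'⟩ : l < 0 ∧ (s : ℤ) < -l := by omega
    rcases Nat.eq_zero_or_pos s with rfl | hs0
    · rw [path_split_two (-1) (a := 1) (b := 0) (by omega) (by omega) (by omega) (by omega),
        path_cons (l := -1 + 2) (by omega)] at h'
      refine not_avoid_of_four (x' := []) (natC_eq_four ?_ ?_) ?_ (by simp) h' <;> try omega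
      intro a ha
      obtain ⟨j, h1, h2, rfl⟩ := mem_path.1 ha
      exact natC_eq_two (by omega)
    · rw [path_split_two (-s - 1) (a := s + 1) (b := s) (by omega) (by omega) (by omega)
        (by omega)] at h'
      refine not_avoid_of_three (x' := []) (natC_eq_three ?_ ?_ ?_ ?_ ?_) ?_ (by simp) h' <;>
        try omega
      intro a ha
      obtain ⟨j, h1, h2, rfl⟩ := mem_path.1 ha
      exact natC_eq_two (by omega)

/-- Every word without forbidden factor is equivalent to the word of a canonical list. -/
theorem exists_isShape {N : ℕ} (hN : 1 ≤ N) {w : List ℕ} (hw : ∀ a ∈ w, a ≤ N)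
    (h : Avoid (natC N) w) :
    ∃ c, IsShape N c ∧ Comm (natC N) w (pathWord c) := by
  induction w with
  | nil => exact ⟨[], ⟨by simp, by simp⟩, .refl _⟩
  | cons s w ih =>
    obtain ⟨c, hc, hcw⟩ := ih (fun a ha => hw a (by simp [ha])) h.of_cons
    obtain ⟨c', hc', hcw', -⟩ := exists_isShape_cons hN (hw s (by simp)) hc (h.of_comm (hcw.cons s))
    exact ⟨c', hc', (hcw.cons s).trans hcw'⟩

theorem le_of_comm_pathWord {N : ℕ} {l g l' g' : ℤ} {c c' : List (ℤ × ℤ)}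
    (hc : IsShape N ((l, g) :: c)) (hc' : IsShape N ((l', g') :: c'))
    (h : Comm (natC N) (pathWord ((l, g) :: c)) (pathWord ((l', g') :: c'))) : g' ≤ g := by
  have h1 : g'.natAbs ∈ pathWord ((l', g') :: c') := by
    rw [pathWord_cons]
    exact List.mem_append_left _ (mem_path.2 ⟨g', (hc'.bounds _ List.mem_cons_self).2.2.2.1, le_rfl, rfl⟩)
  obtain ⟨x, hx, hgx⟩ := hc.le_of_mem (h.perm.mem_iff.2 h1)
  have h2 := (isShape_cons.1 hc).2.1
  rcases hx with _ | ⟨_, hx⟩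
  · simp only at hgx; omega
  · have := h2 x hx
    simp only at this
    omega

/-- The longer first path has the shorter one as a suffix, so `eq_nil_of_comm_chain` applies to the
difference as long as the right end `g` does not occur in it. It occurs only if `l' = -g`, and then
counting `g` separates the words. -/
theorem lt_false_of_comm_pathWord {N : ℕ} {l g l' : ℤ} {c c' : List (ℤ × ℤ)}
    (hc : IsShape N ((l, g) :: c)) (hc' : IsShape N ((l', g) :: c'))
    (h : Comm (natC N) (pathWord ((l, g) :: c)) (pathWord ((l', g) :: c'))) (hl : l' < l) :
    False := by
  obtain ⟨⟨hg0, hgN, hlg, hlg', hgl⟩, hlt, -⟩ := isShape_cons.1 hc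
  obtain ⟨⟨-, -, hlg2, hlg2', hgl2⟩, hlt2, -⟩ := isShape_cons.1 hc'
  simp only at hg0 hgN hlg hlg' hgl hlt hlg2 hlg2' hgl2 hlt2
  rw [pathWord_cons, pathWord_cons] at h
  simp only at h
  by_cases hmem : l' = -g
  · -- the letter `g` occurs twice in the second word only
    have h1 := h.perm.count_eq g.natAbs
    have h2 : g.natAbs ∉ pathWord c := by
      intro hm
      obtain ⟨x, hx, hx'⟩ := hc.tail.le_of_mem hm
      have := hlt x hx
      omega
    rw [List.count_append, List.count_append, List.count_eq_zero_of_not_mem h2,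
      path_concat hlg', List.count_append,
      List.count_eq_zero_of_not_mem (a := g.natAbs) (l := path l (g - 1)) (by
        rw [mem_path]; rintro ⟨j, h1, h2, h3⟩; omega),
      path_concat hlg2', path_cons (show l' ≤ g - 1 by omega), hmem, Int.natAbs_neg] at h1
    simp at h1
    omega
  · have hy : path l' (l - 1) = [] := by
      refine eq_nil_of_comm_chain (M := natC N) (g := g.natAbs) (C := path l (g - 1))
        (R := pathWord c) (R' := pathWord c') ?_ ?_ ?_
      · rw [← path_concat hlg']
        have := path_split (l := l') (m := g) (l - 1) (by omega) (by omega)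
        rw [sub_add_cancel] at this
        rw [← this]
        exact isChain_path N _ _
      · rw [mem_path]; rintro ⟨j, h1, h2, h3⟩; omega
      · rw [← path_concat hlg']
        have := path_split (l := l') (m := g) (l - 1) (by omega) (by omega)
        rw [sub_add_cancel] at this
        rw [← this]
        exact h
    rw [path_cons (by omega)] at hy
    simp at hy

/-- The canonical list is determined by the commutation class of its word. -/
theorem eq_of_comm_pathWord {N : ℕ} {c c' : List (ℤ × ℤ)} (hc : IsShape N c) (hc' : IsShape N c')
    (h : Comm (natC N) (pathWord c) (pathWord c')) : c = c' := by
  have hne : ∀ (x : ℤ × ℤ) (c : List (ℤ × ℤ)), IsShape N (x :: c) → pathWord (x :: c) ≠ [] := by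
    intro x c hx
    rw [pathWord_cons, path_cons (hx.bounds x List.mem_cons_self).2.2.2.1]
    simp
  induction c generalizing c' with
  | nil =>
    rcases c' with _ | ⟨x, c'⟩
    · rfl
    · exact absurd (List.nil_perm.1 h.perm) (hne x c' hc')
  | cons x c ih =>
    rcases c' with _ | ⟨x', c'⟩
    · exact absurd (List.perm_nil.1 h.perm) (hne x c hc)
    obtain ⟨l, g⟩ := x
    obtain ⟨l', g'⟩ := x'
    obtain rfl : g = g' := le_antisymm (le_of_comm_pathWord hc' hc h.symm)
      (le_of_comm_pathWord hc hc' h)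
    obtain rfl : l = l' := by
      rcases lt_trichotomy l l' with h1 | h1 | h1
      · exact (lt_false_of_comm_pathWord hc' hc h.symm h1).elim
      · exact h1
      · exact (lt_false_of_comm_pathWord hc hc' h h1).elim
    rw [pathWord_cons, pathWord_cons] at h
    rw [ih hc.tail hc'.tail h.of_append]

/-! ### Restrictions on canonical lists without forbidden factor -/

section Necessary

variable {N : ℕ}

/-- The first path contains `a, a + 1`, and the letters from there to the next `a` commute with `a`,
so `a (a+1) a` appears. The letters `Y` leave room for paths in between. -/
theorem not_avoid_ascending {l g l' g' : ℤ} {a : ℕ} {Y Z : List ℕ} (ha : l'.natAbs = a) (ha1 : 1 ≤ a)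
    (haN : a + 1 < N) (hla : l ≤ a) (hag : (a : ℤ) < g) (hY : ∀ y ∈ Y, a + 2 ≤ y) (hl' : l' ≤ g') :
    ¬ Avoid (natC N) (path l g ++ (Y ++ (path l' g' ++ Z))) := by
  intro h
  rw [path_split_two a (a := a) (b := a + 1) hla (by omega) (by omega) (by omega), path_cons hl', ha,
    List.append_assoc] at h
  refine not_avoid_of_three (s := a) (t := a + 1) (x := []) (x' := path (a + 2) g ++ Y)
    (y := path (l' + 1) g' ++ Z)
    (natC_eq_three (by omega) ha1 (by omega) (by omega) haN) (by simp) ?_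
    (by simpa using h.of_append_right)
  intro b hb
  rcases List.mem_append.1 hb with hb | hb
  · obtain ⟨j, h1, h2, rfl⟩ := mem_path.1 hb
    exact natC_eq_two (by omega)
  · have := hY b hb
    exact natC_eq_two (by omega)

/-- A path with negative left end contains `1, 0, 1`, and the 0 opening the later path can be moved
next to it, giving `1 0 1 0`. -/
theorem not_avoid_zero_after_neg {l g g' : ℤ} {Y Z : List ℕ} (hl : l < 0) (hg : 1 ≤ g)
    (hY : ∀ y ∈ Y, 2 ≤ y) (hg' : 0 ≤ g') :
    ¬ Avoid (natC N) (path l g ++ (Y ++ (path 0 g' ++ Z))) := by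
  intro h
  rw [path_split_two (-1) (a := 1) (b := 0) (by omega) (by omega) (by omega) (by omega),
    path_cons (l := -1 + 2) (by omega), path_cons hg', List.append_assoc] at h
  refine not_avoid_of_four (s := 1) (t := 0) (x := []) (x' := path 2 g ++ Y)
    (y := path (0 + 1) g' ++ Z) (natC_eq_four (by omega) (by simp)) (by simp) ?_
    (by simpa using h.of_append_right)
  intro b hb
  rcases List.mem_append.1 hb with hb | hb
  · obtain ⟨j, h1, h2, rfl⟩ := mem_path.1 hb
    exact natC_eq_two (by omega)
  · have := hY b hb
    exact natC_eq_two (by omega)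

theorem not_avoid_last_last {l : ℤ} {Z : List ℕ} (hl : l ≤ N) :
    ¬ Avoid (natC N) (path l N ++ (path N N ++ Z)) := by
  intro h
  rw [path_concat hl, path_self, List.append_assoc] at h
  exact not_avoid_of_two (s := N) (x := []) (y := Z) (by simp) (by simpa using h.of_append_right)

theorem not_avoid_pred_last (hN : 2 ≤ N) {l : ℤ} {Z : List ℕ} (hl : l ≤ N - 1) :
    ¬ Avoid (natC N) (path l N ++ (path (N - 1) N ++ Z)) := by
  intro h
  rw [path_split_two (l := l) (N - 1) (a := N - 1) (b := N) hl (by omega) (by omega) (by omega),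
    path_eq_nil (show (N : ℤ) < N - 1 + 2 by omega),
    path_split_two (l := N - 1) (N - 1) (a := N - 1) (b := N) (by omega) (by omega) (by omega)
      (by omega), path_eq_nil (show (N : ℤ) - 1 - 1 < N - 1 by omega), List.append_assoc] at h
  exact not_avoid_of_four (s := N - 1) (t := N) (x := []) (x' := []) (y := path (N - 1 + 2) N ++ Z)
    (natC_eq_four (N := N) (by omega) (by omega)) (by simp) (by simp) (by simpa using h.of_append_right)

/-- The bound `-(N - 1) < l` leaves only one letter N - 1 in the second path when `l < N`, so the
word contains `N (N-1) N (N-1)` up to commutations. If `l = N`, there is a factor `N N`. -/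
theorem not_avoid_last_pred (hN : 2 ≤ N) {i l l' g' : ℤ} {Z : List ℕ} (hi : i ≤ N)
    (hl : -(N - 1 : ℤ) < l) (hlN : l ≤ N) (hl' : (l'.natAbs : ℤ) = N - 1) (hlg : l' ≤ g') :
    ¬ Avoid (natC N) (path i N ++ (path l N ++ (path l' g' ++ Z))) := by
  intro h
  rcases hlN.eq_or_lt with rfl | hlN
  · exact not_avoid_last_last hi h
  rw [path_concat hi, path_split_two (l := l) (N - 1) (a := N - 1) (b := N) (by omega) (by omega)
    (by omega) (by omega), path_eq_nil (show (N : ℤ) < N - 1 + 2 by omega), path_cons hlg,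
    show l'.natAbs = N - 1 by omega, List.append_assoc] at h
  refine not_avoid_of_four (s := N) (t := N - 1) (x := path l (N - 1 - 1)) (x' := [])
    (y := path (l' + 1) g' ++ Z) (natC_eq_four (N := N) (by omega) (by omega)) ?_ (by simp)
    (by simpa using h.of_append_right)
  intro b hb
  obtain ⟨j, h1, h2, rfl⟩ := mem_path.1 hb
  exact natC_eq_two (by omega)

/-- The relation between the consecutive left ends in Stembridge's form. -/
def NormalStep (x y : ℤ × ℤ) : Prop := 0 ≤ x.1 ∧ (y.1 = 0 ∨ (y.1.natAbs : ℤ) < x.1)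

/-- A non-normal step makes the letter `|l'|` close an ascending pattern with label 3. The argument
breaks down only next to the label-4 edge at N, which is the exceptional case. -/
theorem normal_or_exceptional (hN : 2 ≤ N) {l g l' g' : ℤ} {c : List (ℤ × ℤ)}
    (hc : IsShape N ((l, g) :: (l', g') :: c))
    (h : Avoid (natC N) (pathWord ((l, g) :: (l', g') :: c))) :
    NormalStep (l, g) (l', g') ∨
      (g = N ∧ (l'.natAbs : ℤ) = N - 1 ∧ (g' = N - 1 ∨ (g' = N ∧ l' = -(N - 1)))) := by
  obtain ⟨⟨hg0, hgN, hlg, hlg', hgl⟩, hlt, hc'⟩ := isShape_cons.1 hc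
  obtain ⟨⟨hg0', -, hlg2, hlg2', hgl2⟩, -, -⟩ := isShape_cons.1 hc'
  have hgg := hlt _ List.mem_cons_self
  simp only at hg0 hgN hlg hlg' hgl hlg2 hlg2' hgl2 hgg hg0'
  rw [pathWord_cons, pathWord_cons] at h
  simp only at h
  by_cases hnor : 0 ≤ l ∧ (l' = 0 ∨ (l'.natAbs : ℤ) < l)
  · exact .inl hnor
  refine .inr ?_
  by_cases h0 : l' = 0
  · subst h0
    exact (not_avoid_zero_after_neg (Y := []) (by omega) (by omega) (by simp) hg0' h).elim
  by_cases h1 : l'.natAbs + 1 < N ∧ (l'.natAbs : ℤ) < g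
  · exact (not_avoid_ascending (Y := []) rfl (by omega) h1.1 (by omega) (by omega) (by simp) hlg2'
      h).elim
  by_cases h2 : l' = N
  · obtain ⟨rfl, rfl, rfl⟩ : l' = N ∧ g' = N ∧ g = N := by omega
    exact (not_avoid_last_last hlg' h).elim
  have h3 : g = N := by omega
  subst h3
  by_cases h4 : g' = N ∧ l' = N - 1
  · obtain ⟨rfl, rfl⟩ := h4
    exact (not_avoid_pred_last hN (by omega) h).elim
  omega

/-- With another N before it, an exceptional step produces `N N` or `N (N-1) N (N-1)`, unless the
middle path is the zigzag, which has two letters N - 1 between the two letters N. -/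
theorem normal_of_prev (hN : 2 ≤ N) {i l g l' g' : ℤ} {c : List (ℤ × ℤ)} (hi : i ≤ N)
    (hc : IsShape N ((l, g) :: (l', g') :: c))
    (h : Avoid (natC N) (path i N ++ pathWord ((l, g) :: (l', g') :: c)))
    (hl : (l, g) ≠ (-((N : ℤ) - 1), (N : ℤ))) : NormalStep (l, g) (l', g') := by
  refine (normal_or_exceptional hN hc h.of_append_right).resolve_right ?_
  rintro ⟨rfl, h1, -⟩
  have h2 := hc.bounds _ List.mem_cons_self
  have h3 := hc.bounds (l', g') (by simp)
  simp only [ne_eq, Prod.mk.injEq, and_true] at hl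
  simp only at h2 h3
  have h4 : -((N : ℤ) - 1) < l := by
    have := h2.2.2.2.2 trivial
    omega
  exact not_avoid_last_pred hN hi h4 h2.2.2.2.1 h1 h3.2.2.2.1 h

theorem isChain_normal_of_lt (hN : 2 ≤ N) {c : List (ℤ × ℤ)} (hc : IsShape N c)
    (hlt : ∀ x ∈ c, x.2 < N) (h : Avoid (natC N) (pathWord c)) : c.IsChain NormalStep := by
  induction c with
  | nil => exact .nil
  | cons x c ih =>
    have ih' := ih hc.tail (fun y hy => hlt y (by simp [hy])) h.of_append_right
    rcases c with _ | ⟨y, c⟩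
    · exact .singleton _
    · refine List.isChain_cons_cons.2 ⟨(normal_or_exceptional hN hc h).resolve_right ?_, ih'⟩
      have := hlt x (by simp)
      omega

theorem forall_abs_lt_of_isChain {x : ℤ × ℤ} {c : List (ℤ × ℤ)} {i : ℤ} (hi : 0 < i)
    (h : (x :: c).IsChain NormalStep) (hx : (x.1.natAbs : ℤ) < i) :
    ∀ y ∈ x :: c, (y.1.natAbs : ℤ) < i := by
  induction c generalizing x with
  | nil => simpa using hx
  | cons y c ih =>
    obtain ⟨h1, h2⟩ := List.isChain_cons_cons.1 h
    have hy : (y.1.natAbs : ℤ) < i := by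
      rcases h1.2 with h3 | h3
      · simpa [h3] using hi
      · have := h1.1; omega
    exact List.forall_mem_cons.2 ⟨hx, ih h2 hy⟩

theorem forall_eq_zero_of_isChain {x : ℤ × ℤ} {c : List (ℤ × ℤ)}
    (h : (x :: c).IsChain NormalStep) (hx : x.1 = 0) : ∀ y ∈ x :: c, y.1 = 0 := by
  intro y hy
  have := forall_abs_lt_of_isChain one_pos h (by simp [hx]) y hy
  omega

theorem pathWord_eq_of_forall_eq_zero {c : List (ℤ × ℤ)} (h : ∀ x ∈ c, x.1 = 0) :
    pathWord c = (c.map Prod.snd).flatMap (path 0) := by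
  induction c with
  | nil => rfl
  | cons x c ih =>
    rw [pathWord_cons, ih fun y hy => h y (by simp [hy]), h x (by simp)]
    rfl

theorem pairwise_snd_of_lt {c : List (ℤ × ℤ)} (hc : IsShape N c) (hlt : ∀ x ∈ c, x.2 < N) :
    (c.map Prod.snd).Pairwise (· > ·) := by
  rw [List.pairwise_map]
  refine hc.pairwise.imp_of_mem fun hx _ h => ?_
  have := hlt _ hx
  simp only [gt_iff_lt]
  omega

theorem path_reverse_concat {f m : ℤ} (h : f ≤ m) :
    (path f m).reverse = m.natAbs :: (path f (m - 1)).reverse := by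
  rw [path_concat h]; simp

/-- The part without `N` of a word without forbidden factor, after `[l, N]` with `l ≤ 0`. -/
theorem pathWord_eq_of_nonpos (hN : 2 ≤ N) {l m : ℤ} {Y : List ℕ} {c : List (ℤ × ℤ)} (hl : l ≤ 0)
    (hm : 0 ≤ m) (hmN : m ≤ N) (hY : ∀ y ∈ Y, m ≤ (y : ℤ)) (hc : IsShape N c)
    (hlt : ∀ x ∈ c, x.2 < m) (h : Avoid (natC N) (path l N ++ (Y ++ pathWord c))) :
    (∃ f, (-m < f ∨ f = m) ∧ f ≤ m ∧ pathWord c = (path f (m - 1)).reverse) ∨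
      (l = 0 ∧ ∃ (z : ℤ) (rs : List ℤ), 0 ≤ z ∧ z ≤ m ∧ rs.Pairwise (· > ·) ∧
        (∀ r ∈ rs, 0 ≤ r ∧ r < z) ∧ pathWord c = (path z (m - 1)).reverse ++ rs.flatMap (path 0)) := by
  induction c generalizing m Y with
  | nil => exact .inl ⟨m, .inr rfl, le_rfl, by rw [path_eq_nil (by omega)]; rfl⟩
  | cons x c ih =>
    obtain ⟨l', g'⟩ := x
    have hchain := isChain_normal_of_lt hN hc (fun x hx => (hlt x hx).trans_le hmN)
      h.of_append_right.of_append_right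
    obtain ⟨⟨hg0, -, hlg, hlg', -⟩, hltc, hc'⟩ := isShape_cons.1 hc
    have hgm := hlt _ List.mem_cons_self
    simp only at hg0 hlg hlg' hgm
    by_cases h0 : l' = 0
    · subst h0
      rcases (show m = 1 ∨ 2 ≤ m by omega) with rfl | hm2
      · have hnil : c = [] := by
          rcases c with _ | ⟨y, c⟩
          · rfl
          · have h1 := hltc y (by simp)
            have h2 := hc'.bounds y (by simp)
            simp only at h1
            omega
        obtain rfl : g' = 0 := by omega
        subst hnil
        exact .inl ⟨0, by omega, by omega, rfl⟩
      · rcases hl.lt_or_eq with hl | hl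
        -- A path starting with 0 is possible only after `l = 0`: a negative `l` already supplies `1
        -- 0 1`.
        · exact (not_avoid_zero_after_neg hl (by omega)
            (fun y hy => by have := hY y hy; omega) hg0 h).elim
        · have hz := forall_eq_zero_of_isChain hchain rfl
          refine .inr ⟨hl, m, _, hm, le_rfl,
            pairwise_snd_of_lt hc fun x hx => (hlt x hx).trans_le hmN, ?_, ?_⟩
          · intro r hr
            obtain ⟨x, hx, rfl⟩ := List.mem_map.1 hr
            exact ⟨(hc.bounds x hx).1, hlt x hx⟩
          · rw [path_eq_nil (by omega), pathWord_eq_of_forall_eq_zero hz]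
            rfl
    by_cases ha : (l'.natAbs : ℤ) < m - 1
    · exact (not_avoid_ascending rfl (by omega) (by omega) (by omega) (by omega)
        (fun y hy => by have := hY y hy; omega) hlg' h).elim
    obtain rfl : g' = m - 1 := by omega
    rcases lt_or_gt_of_ne h0 with hl' | hl'
    · have hnil : c = [] := by
        rcases c with _ | ⟨y, c⟩
        · rfl
        · exact absurd (List.isChain_cons_cons.1 hchain).1.1 (by simp only; omega)
      subst hnil
      refine .inl ⟨l', by omega, by omega, ?_⟩
      rw [path_reverse, pathWord_cons]
      simp only [pathWord, List.flatMap_nil, List.append_nil]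
      rw [show l' = -(m - 1) by omega]
      simp
    · obtain rfl : l' = m - 1 := by omega
      have hw : pathWord ((m - 1, m - 1) :: c) = (m - 1).natAbs :: pathWord c := by
        rw [pathWord_cons, path_self]; rfl
      rw [hw]
      -- A path reduced to the letter m - 1 is absorbed in `Y`, and the descent continues with the
      -- bound m - 1.
      have ih' := ih (m := m - 1) (Y := Y ++ [(m - 1).natAbs]) (by omega) (by omega) ?_ hc' ?_
        (by rw [hw] at h; simpa using h)
      · rcases ih' with ⟨f, hf, hfm, hcf⟩ | ⟨hl0, z, rs, hz, hzm, hrs, hrs', hcz⟩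
        · refine .inl ⟨f, by omega, by omega, ?_⟩
          rw [path_reverse_concat hfm, hcf]
        · refine .inr ⟨hl0, z, rs, hz, by omega, hrs, hrs', ?_⟩
          rw [path_reverse_concat hzm, hcz]
          rfl
      · intro y hy
        rcases List.mem_append.1 hy with hy | hy
        · have := hY y hy; omega
        · rw [List.mem_singleton.1 hy]; omega
      · intro x hx
        have := hltc x hx
        simp only at this
        omega

/-- The part without `N` of a word without forbidden factor, after `[i, N]` with `i > 0`. -/
theorem abs_fst_eq_or_lt (hN : 2 ≤ N) {i m : ℤ} {Y : List ℕ} {b : List (ℤ × ℤ)} (hi : 0 < i)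
    (hmN : m ≤ N) (hY : ∀ y ∈ Y, m ≤ (y : ℤ)) (hc : IsShape N b)
    (hlt : ∀ x ∈ b, x.2 < m) (h : Avoid (natC N) (path i N ++ (Y ++ pathWord b))) :
    ∀ (j : ℕ) (hj : j < b.length), (b[j].1.natAbs : ℤ) = m - 1 - j ∨ (b[j].1.natAbs : ℤ) < i := by
  induction b generalizing m Y with
  | nil => simp
  | cons x b ih =>
    obtain ⟨l', g'⟩ := x
    have hchain := isChain_normal_of_lt hN hc (fun x hx => (hlt x hx).trans_le hmN)
      h.of_append_right.of_append_right
    obtain ⟨⟨hg0, -, hlg, hlg', -⟩, hltc, hc'⟩ := isShape_cons.1 hc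
    have hgm := hlt _ List.mem_cons_self
    simp only at hg0 hlg hlg' hgm
    by_cases hai : (l'.natAbs : ℤ) < i
    · exact fun j hj => .inr (forall_abs_lt_of_isChain hi hchain hai _ (List.getElem_mem hj))
    by_cases ha : (l'.natAbs : ℤ) < m - 1
    · exact (not_avoid_ascending rfl (by omega) (by omega) (by omega) (by omega)
        (fun y hy => by have := hY y hy; omega) hlg' h).elim
    obtain rfl : g' = m - 1 := by omega
    intro j hj
    rcases j with _ | j
    · simp only [List.getElem_cons_zero, Nat.cast_zero]; omega
    rcases lt_or_ge l' 0 with hl' | hl'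
    · rcases b with _ | ⟨y, b⟩
      · simp at hj
      · exact absurd (List.isChain_cons_cons.1 hchain).1.1 (by simp only; omega)
    · obtain rfl : l' = m - 1 := by omega
      have hw : pathWord ((m - 1, m - 1) :: b) = (m - 1).natAbs :: pathWord b := by
        rw [pathWord_cons, path_self]; rfl
      have ih' := ih (m := m - 1) (Y := Y ++ [(m - 1).natAbs]) (by omega) ?_ hc' ?_
        (by rw [hw] at h; simpa using h) j (by simpa using hj)
      · simp only [List.getElem_cons_succ]
        push_cast at ih' ⊢
        omega
      · intro y hy
        rcases List.mem_append.1 hy with hy | hy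
        · have := hY y hy; omega
        · rw [List.mem_singleton.1 hy]; omega
      · intro x hx
        have := hltc x hx
        simp only at this
        omega

/-- After the block `[-(N - 1), N]`, a word without forbidden factor goes on with the same block, and
it ends with an initial part of this block. -/
theorem pathWord_eq_zigzag (hN : 2 ≤ N) {c : List (ℤ × ℤ)}
    (hc : IsShape N ((-((N : ℤ) - 1), (N : ℤ)) :: c))
    (h : Avoid (natC N) (path (-((N : ℤ) - 1)) N ++ pathWord c)) :
    ∃ k f, -(N : ℤ) < f ∧ f ≤ N ∧ pathWord c =
      (List.replicate k (path (-((N : ℤ) - 1)) N)).flatten ++ (path f (N - 1)).reverse := by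
  induction c with
  | nil =>
    refine ⟨0, N, by omega, by omega, ?_⟩
    rw [path_eq_nil (show (N : ℤ) - 1 < N by omega)]
    rfl
  | cons x c ih =>
    obtain ⟨l', g'⟩ := x
    obtain ⟨-, hltc, hc'⟩ := isShape_cons.1 hc
    by_cases hg : g' = N
    · obtain ⟨h1, -⟩ | ⟨-, h1, h2⟩ := normal_or_exceptional hN hc h
      · simp only at h1; omega
      · obtain ⟨rfl, rfl⟩ : g' = N ∧ l' = -((N : ℤ) - 1) := by omega
        obtain ⟨k, f, hf, hf', hk⟩ := ih hc' h.of_append_right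
        refine ⟨k + 1, f, hf, hf', ?_⟩
        rw [pathWord_cons, hk, List.replicate_succ, List.flatten_cons, List.append_assoc]
    · obtain ⟨hb, hlt, -⟩ := isShape_cons.1 hc'
      obtain ⟨f, hf, hf', hk⟩ | ⟨h1, -⟩ := pathWord_eq_of_nonpos hN (m := N) (Y := [])
        (by omega) (by omega) le_rfl (by simp) hc' (by
          intro y hy
          simp only at hb
          rcases hy with _ | ⟨_, hy⟩
          · simp only; omega
          · have := hlt y hy
            simp only at this; omega) h
      · exact ⟨0, f, by omega, hf', by simpa using hk⟩
      · omega

/-- A normal step from a left end below N cannot lead to the left end -(N - 1), so the hypothesis of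
`normal_of_prev` propagates as long as the right ends are N. Afterwards no exceptional step can
occur. -/
theorem isChain_normal_of_prev (hN : 2 ≤ N) {i : ℤ} {x : ℤ × ℤ} {c : List (ℤ × ℤ)} (hi : i ≤ N)
    (hc : IsShape N (x :: c)) (h : Avoid (natC N) (path i N ++ pathWord (x :: c)))
    (hxN : x.1 < N) (hx : x ≠ (-((N : ℤ) - 1), (N : ℤ))) :
    (x :: c).IsChain NormalStep ∧ ∀ y ∈ x :: c, y ≠ (-((N : ℤ) - 1), (N : ℤ)) := by
  induction c generalizing i x with
  | nil => exact ⟨.singleton _, by simpa using hx⟩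
  | cons y c ih =>
    have h1 : NormalStep x y := normal_of_prev hN hi hc h hx
    obtain ⟨hb, hlt, hc'⟩ := isShape_cons.1 hc
    by_cases hxg : x.2 = N
    · have hy : y.1 < N := by
        rcases h1.2 with h2 | h2
        · omega
        · omega
      have hy' : y ≠ (-((N : ℤ) - 1), (N : ℤ)) := by
        rintro rfl
        rcases h1.2 with h2 | h2
        · simp only at h2; omega
        · simp only at h2; omega
      have h2 := h.of_append_right
      rw [pathWord_cons, hxg] at h2
      obtain ⟨h3, h4⟩ := ih (hb.2.2.2.1.trans hb.2.1) hc' h2 hy hy'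
      exact ⟨List.isChain_cons_cons.2 ⟨h1, h3⟩, List.forall_mem_cons.2 ⟨hx, h4⟩⟩
    · have hltN : ∀ z ∈ y :: c, z.2 < N := by
        intro z hz
        have := hlt z hz
        omega
      have h3 := isChain_normal_of_lt hN hc' hltN h.of_append_right.of_append_right
      refine ⟨List.isChain_cons_cons.2 ⟨h1, h3⟩, List.forall_mem_cons.2 ⟨hx, ?_⟩⟩
      rintro z hz rfl
      exact absurd (hltN _ hz) (by simp)

end Necessary

/-! ### Absence of forbidden factors in the proposed words -/

section Sufficient

variable {N : ℕ}

theorem notMem_path {l m : ℤ} {a : ℕ} (h : ∀ j, l ≤ j → j ≤ m → j.natAbs ≠ a) : a ∉ path l m :=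
  fun ha => by
    obtain ⟨j, h1, h2, rfl⟩ := mem_path.1 ha
    exact h j h1 h2 rfl

theorem IsShape.notMem_pathWord {c : List (ℤ × ℤ)} (hc : IsShape N c) {a : ℕ}
    (h : ∀ x ∈ c, x.2 < a) : a ∉ pathWord c := fun ha => by
  obtain ⟨x, hx, hax⟩ := hc.le_of_mem ha
  have := h x hx
  omega

theorem precededBy_zero {B : Type*} {p : B → Prop} {s : B} {w : List B} : PrecededBy p s 0 w := by
  cases w <;> trivial

theorem precededBy_path_append {l m : ℤ} {s k : ℕ} {w : List ℕ} (j : ℤ) (hlj : l ≤ j) (hjm : j ≤ m)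
    (hj : j.natAbs + 1 = s ∨ s + 1 = j.natAbs) (hs : ∀ j, l ≤ j → j ≤ m → j.natAbs ≠ s)
    (h : PrecededBy (fun a => 3 ≤ natC N s a) s k w) :
    PrecededBy (fun a => 3 ≤ natC N s a) s (k + 1) (path l m ++ w) :=
  precededBy_succ_of_mem (notMem_path hs) (mem_path.2 ⟨j, hlj, hjm, rfl⟩)
    (three_le_natC (by omega)) h

theorem precededBy_eq_path_append {l m : ℤ} {s t : ℕ} {w : List ℕ} (j : ℤ) (hlj : l ≤ j)
    (hjm : j ≤ m) (hj : j.natAbs = t) (hs : ∀ j, l ≤ j → j ≤ m → j.natAbs ≠ s) :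
    PrecededBy (fun a => a = t) s 1 (path l m ++ w) :=
  precededBy_succ_of_mem (notMem_path hs) (mem_path.2 ⟨j, hlj, hjm, rfl⟩) hj precededBy_zero

theorem gapTwo_cons {B : Type*} {M : CoxeterMatrix B} {t : B} {w : List B}
    (h : PrecededBy (fun a => 3 ≤ M t a) t 2 w) : GapTwo M t (t :: w) := .inl ⟨rfl, h⟩

theorem addable_of_notMem {B : Type*} {M : CoxeterMatrix B} {s : B} {w : List B} (h : s ∉ w) :
    Addable M s w := .inl (precededBy_of_notMem h)

/-- Adding the letters of a path one by one. -/
theorem avoid_path_append {l m : ℤ} {w : List ℕ} (hw : Avoid (natC N) w)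
    (h : ∀ j, l ≤ j → j ≤ m → Addable (natC N) j.natAbs (path (j + 1) m ++ w)) :
    Avoid (natC N) (path l m ++ w) := by
  obtain ⟨d, hd⟩ : ∃ d : ℕ, (m + 1 - l).toNat = d := ⟨_, rfl⟩
  induction d generalizing l with
  | zero => rwa [path_eq_nil (by omega)]
  | succ d ih =>
    rw [path_cons (by omega)]
    exact (ih (fun j hj hj' => h j (by omega) hj') (by omega)).cons (h l le_rfl (by omega))

theorem precededBy_zero_one_one (hN : 2 ≤ N) {w : List ℕ} :
    PrecededBy (fun a => 3 ≤ natC N 0 a) 0 2 (path 1 N ++ (path (-((N : ℤ) - 1)) N ++ w)) := by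
  refine precededBy_path_append 1 (by omega) (by omega) (by omega) (by omega) ?_
  rw [path_split (-1) (by omega) (by omega), List.append_assoc]
  exact precededBy_path_append (-1) (by omega) (by omega) (by omega) (by omega) precededBy_zero

theorem precededBy_last (hN : 2 ≤ N) {w : List ℕ} :
    PrecededBy (fun a => 3 ≤ natC N N a) N 2 (path (-((N : ℤ) - 1)) N ++ w) := by
  rw [path_split 0 (by omega) (by omega), path_split (l := 0 + 1) (N - 1) (by omega) (by omega),
    List.append_assoc, List.append_assoc]
  refine precededBy_path_append (-((N : ℤ) - 1)) (by omega) (by omega) (by omega) (by omega) ?_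
  exact precededBy_path_append ((N : ℤ) - 1) (by omega) (by omega) (by omega) (by omega)
    precededBy_zero

/-- The letters near a turning point need a view beyond the current path: N, N - 1, 0 and the 1
preceding 0 are handled with later turns of the zigzag or with a label-4 edge. Two further periods
make all these letters present at once. -/
theorem addable_zigzag (hN : 2 ≤ N) {l : ℤ} (hl : -((N : ℤ) - 1) ≤ l) (hlN : l ≤ N) {w : List ℕ} :
    Addable (natC N) l.natAbs
      (path (l + 1) N ++ (path (-((N : ℤ) - 1)) N ++ (path (-((N : ℤ) - 1)) N ++ w))) := by
  rcases hlN.eq_or_lt with rfl | hlN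
  · left
    rw [path_eq_nil (by omega)]
    exact precededBy_last hN
  obtain h | h | h | h | h :
      l = N - 1 ∨ (1 ≤ l ∧ l < N - 1) ∨ l = 0 ∨ l = -1 ∨ l < -1 := by omega
  · subst h
    refine .inr ⟨N, natC_eq_four (by omega) (by omega), ?_, ?_⟩
    · exact precededBy_eq_path_append N (by omega) (by omega) (by omega) (by omega)
    · rw [sub_add_cancel, path_self]
      exact gapTwo_cons (precededBy_last hN)
  · left
    refine precededBy_path_append (l + 1) (by omega) (by omega) (by omega) (by omega) ?_
    rw [path_split (l := -((N : ℤ) - 1)) (-(l + 1)) (by omega) (by omega), List.append_assoc]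
    exact precededBy_path_append (-(l + 1)) (by omega) (by omega) (by omega) (by omega)
      precededBy_zero
  · subst h
    exact .inl (precededBy_zero_one_one hN)
  · subst h
    refine .inr ⟨0, natC_eq_four (by omega) (by omega), ?_, ?_⟩
    · rw [path_split 0 (by omega) (by omega), List.append_assoc]
      exact precededBy_eq_path_append 0 (by omega) (by omega) (by omega) (by omega)
    · rw [path_cons (by omega)]
      exact gapTwo_cons (precededBy_zero_one_one hN)
  · left
    rw [path_split (l := l + 1) 0 (by omega) (by omega), path_split (l := 0 + 1) (-l - 1) (by omega)
      (by omega), List.append_assoc, List.append_assoc]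
    refine precededBy_path_append (l + 1) (by omega) (by omega) (by omega) (by omega) ?_
    exact precededBy_path_append (-l - 1) (by omega) (by omega) (by omega) (by omega)
      precededBy_zero

theorem avoid_zigzag (hN : 2 ≤ N) {l : ℤ} (hl : -((N : ℤ) - 1) ≤ l) (k : ℕ) :
    Avoid (natC N) (path l N ++ (List.replicate k (path (-((N : ℤ) - 1)) N)).flatten) := by
  have key : ∀ l : ℤ, -((N : ℤ) - 1) ≤ l → ∀ k : ℕ,
      Avoid (natC N) (List.replicate k (path (-((N : ℤ) - 1)) N)).flatten →
      Avoid (natC N) (path l N ++ (List.replicate k (path (-((N : ℤ) - 1)) N)).flatten) := by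
    intro l hl k hk
    refine avoid_path_append hk fun j hj hjN => ?_
    have h := addable_zigzag hN (hl.trans hj) hjN
      (w := (List.replicate k (path (-((N : ℤ) - 1)) N)).flatten)
    -- Two extra periods are appended on the right so that `addable_zigzag` applies even for small
    -- `k`; `Addable` then passes to the prefix.
    refine Addable.of_append (w := path (-((N : ℤ) - 1)) N ++ path (-((N : ℤ) - 1)) N) ?_
    have h2 : ∀ Z : List ℕ, (List.replicate k Z).flatten ++ (Z ++ Z) =
        Z ++ (Z ++ (List.replicate k Z).flatten) := by
      intro Z
      have h3 : (List.replicate (k + 2) Z).flatten = (List.replicate k Z).flatten ++ (Z ++ Z) := by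
        rw [List.replicate_add, List.flatten_append]; simp [List.replicate_succ]
      rw [← h3, List.replicate_succ, List.replicate_succ]
      simp
    rwa [List.append_assoc, h2]
  refine key l hl k ?_
  clear hl
  induction k with
  | zero => exact avoid_nil
  | succ k ih =>
    rw [List.replicate_succ, List.flatten_cons]
    exact key _ le_rfl k ih

theorem avoid_path (hN : 2 ≤ N) {l g : ℤ} (hl : -((N : ℤ) - 1) ≤ l) (hg : g ≤ N) :
    Avoid (natC N) (path l g) := by
  have h := avoid_zigzag hN hl 0
  rcases lt_or_ge g (l - 1) with h1 | h1
  · rw [path_eq_nil (by omega)]; exact avoid_nil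
  · rw [path_split g (by omega) hg, List.append_assoc] at h
    exact h.of_append_left

/-- The words of the first type have no forbidden factor. -/
theorem avoid_first (hN : 2 ≤ N) {i f : ℤ} (hi : -((N : ℤ) - 1) ≤ i) (hf : -((N : ℤ) - 1) ≤ f)
    (hfN : f ≤ N) (k : ℕ) :
    Avoid (natC N) (path i N ++ ((List.replicate k (path (-((N : ℤ) - 1)) N)).flatten ++
      (path f (N - 1)).reverse)) := by
  -- The reversed path is the initial part of a further zigzag, so the word is a prefix of the
  -- zigzag word with one more period.
  have h := avoid_zigzag hN hi (k + 1)
  rw [List.replicate_succ', List.flatten_append, List.flatten_singleton,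
    path_split (l := -((N : ℤ) - 1)) (m := N) (-f) (by omega) (by omega)] at h
  rw [path_reverse]
  rw [← List.append_assoc, ← List.append_assoc] at h
  rw [← List.append_assoc]
  have h2 := h.of_append_left
  convert h2 using 4
  rw [← path_split (-f) (by omega) (by omega)]

/-- If the first left end is smaller than `j` in absolute value, the first path either stops before
`j`, and then `j` occurs nowhere, or reaches j - 1 before its first `j`. -/
theorem precededBy_pathWord {c : List (ℤ × ℤ)} (hc : IsShape N c) {j : ℕ}
    (hj : ∀ x ∈ c.head?, x.1.natAbs < j) (hjN : j < N) :
    PrecededBy (fun a => 3 ≤ natC N j a) j 1 (pathWord c) := by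
  rcases c with _ | ⟨⟨l, g⟩, c⟩
  · exact precededBy_of_notMem (by simp [pathWord])
  have hlj := hj (l, g) (by simp)
  obtain ⟨hb, hlt, -⟩ := isShape_cons.1 hc
  simp only at hlj hb hlt
  rcases lt_or_ge g j with hg | hg
  · refine precededBy_of_notMem (hc.notMem_pathWord (List.forall_mem_cons.2 ⟨hg, fun y hy => ?_⟩))
    have := hlt y hy
    omega
  · rw [pathWord_cons, path_split ((j : ℤ) - 1) (by simp only; omega) (by simp only; omega),
      List.append_assoc]
    exact precededBy_path_append ((j : ℤ) - 1) (by simp only; omega) (by omega) (by omega)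
      (by simp only; omega) precededBy_zero

theorem IsShape.forall_lt_of_cons {l g : ℤ} {c : List (ℤ × ℤ)} (hc : IsShape N ((l, g) :: c))
    (hg : g < N) : ∀ x ∈ c, x.2 < g := by
  obtain ⟨-, hlt, -⟩ := isShape_cons.1 hc
  intro x hx
  have := hlt x hx
  simp only at this
  omega

/-- The words of Stembridge's form, where the letter `N` can be repeated, have no forbidden factor. -/
theorem avoid_pathWord (hN : 2 ≤ N) {c : List (ℤ × ℤ)} (hc : IsShape N c)
    (hchain : c.IsChain NormalStep) : Avoid (natC N) (pathWord c) := by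
  induction c with
  | nil => exact avoid_nil
  | cons x c ih =>
    obtain ⟨l, g⟩ := x
    obtain ⟨⟨hg0, hgN, hlg, hlg', hgl⟩, hlt, hc'⟩ := isShape_cons.1 hc
    simp only at hg0 hgN hlg hlg' hgl hlt
    have hhead : ∀ y ∈ c.head?, NormalStep (l, g) y := (List.isChain_cons.1 hchain).1
    have hchain' : c.IsChain NormalStep := (List.isChain_cons.1 hchain).2
    have hneg : ∀ l g : ℤ, ∀ c, IsShape N ((l, g) :: c) → ((l, g) :: c).IsChain NormalStep → l < 0 →
        c = [] := by
      intro l g c hc hchain hl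
      rcases c with _ | ⟨y, c⟩
      · rfl
      · exact absurd (List.isChain_cons_cons.1 hchain).1.1 (by simp only; omega)
    rw [pathWord_cons]
    simp only
    rcases lt_or_ge l 0 with hl | hl
    · rw [hneg l g c hc hchain hl]
      simpa [pathWord] using avoid_path hN (l := l) (g := g) (by omega) hgN
    refine avoid_path_append (ih hc' hchain') fun j hlj hjg => ?_
    obtain ⟨j, rfl⟩ := Int.eq_ofNat_of_zero_le (hl.trans hlj)
    rw [Int.natAbs_natCast]
    have hpos : ∀ a : ℕ, 1 ≤ a → l ≤ a → ∀ y ∈ c.head?, y.1.natAbs < a := by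
      intro a ha hla y hy
      have h1 := (hhead y hy).2
      simp only at h1
      omega
    rcases hjg.eq_or_lt with rfl | hjg
    · rw [path_eq_nil (by omega), List.nil_append]
      rcases hgN.lt_or_eq with hgN | hgN
      · exact addable_of_notMem (hc'.notMem_pathWord (hc.forall_lt_of_cons hgN))
      obtain rfl : j = N := by omega
      rcases c with _ | ⟨⟨l2, g2⟩, c⟩
      · exact addable_of_notMem (by simp [pathWord])
      have hl2 := hpos j (by omega) hlj (l2, g2) (by simp)
      have hb2 := hc'.bounds (l2, g2) (by simp)
      simp only at hl2 hb2
      rcases hb2.2.1.lt_or_eq with hg2 | rfl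
      · exact addable_of_notMem (hc'.notMem_pathWord (List.forall_mem_cons.2
          ⟨hg2, fun y hy => (hc'.forall_lt_of_cons hg2 y hy).trans hg2⟩))
      rw [pathWord_cons]
      simp only
      -- Here both paths end with N. A zigzag has two letters N - 1 before its N. Otherwise there is
      -- one, and the gap after it contains N and then, before any further N - 1, a neighbour from
      -- the remaining paths.
      rcases (show l2 = -((j : ℤ) - 1) ∨ -((j : ℤ) - 1) < l2 by omega) with rfl | hl2'
      · exact .inl (precededBy_last hN)
      refine .inr ⟨j - 1, natC_eq_four (by omega) (by omega), ?_, ?_⟩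
      · rw [path_split (j - 1) (by omega) (by omega), List.append_assoc]
        exact precededBy_eq_path_append ((j : ℤ) - 1) (by omega) (by omega) (by omega) (by omega)
      · rw [path_split_two ((j : ℤ) - 1) (a := j - 1) (b := j) (by omega) (by omega) (by omega)
          (by omega), path_eq_nil (show (j : ℤ) < j - 1 + 2 by omega), List.append_assoc]
        refine gapTwo_append (notMem_path (by omega)) (gapTwo_cons ?_)
        refine precededBy_cons_of_pos (three_le_natC (by omega)) (by omega) ?_
        refine precededBy_pathWord hc'.tail (fun y hy => ?_) (by omega)
        have h3 := (List.isChain_cons.1 hchain').1 y hy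
        have h4 := h3.1
        have h5 := h3.2
        simp only at h4 h5
        omega
    rcases Nat.eq_zero_or_pos j with rfl | hj
    · refine .inr ⟨1, natC_eq_four (by omega) (by omega), ?_, ?_⟩
      · rw [path_split 1 (by omega) (by omega), List.append_assoc]
        exact precededBy_eq_path_append 1 (by omega) (by omega) (by omega) (by omega)
      · rw [path_cons (by omega)]
        refine gapTwo_cons ?_
        rcases (show g = 1 ∨ 2 ≤ g by omega) with rfl | hg
        · rw [path_eq_nil (by omega)]
          exact precededBy_of_notMem (hc'.notMem_pathWord (hc.forall_lt_of_cons (by omega)))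
        · refine precededBy_path_append 2 (by omega) (by omega) (by omega) (by omega) ?_
          exact precededBy_pathWord hc' (hpos 1 le_rfl (by omega)) (by omega)
    · left
      refine precededBy_path_append ((j : ℤ) + 1) (by omega) (by omega) (by omega) (by omega) ?_
      exact precededBy_pathWord hc' (hpos j hj hlj) (by omega)

/-- While the left ends are m - 1, m - 2, … the paths are single letters, descending to j + 1 before
`j` can occur. If the descent stops earlier, a negative left end passes through j + 1 first, or a
left end below `i ≤ j` in absolute value meets j - 1 first. -/
theorem precededBy_pathWord_of_eq_or_lt {i m : ℤ} {j : ℕ} (hi : 0 < i) (hij : i ≤ j)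
    (hjm : (j : ℤ) < m - 1) (hmN : m ≤ N) {b : List (ℤ × ℤ)} (hb : IsShape N b)
    (hlt : ∀ x ∈ b, x.2 < m) (hchain : b.IsChain NormalStep)
    (h : ∀ (k : ℕ) (hk : k < b.length),
      (b[k].1.natAbs : ℤ) = m - 1 - k ∨ (b[k].1.natAbs : ℤ) < i) :
    PrecededBy (fun a => 3 ≤ natC N j a) j 1 (pathWord b) := by
  induction b generalizing m with
  | nil => exact precededBy_of_notMem (by simp [pathWord])
  | cons x b ih =>
    obtain ⟨l, g⟩ := x
    have h0 := h 0 (by simp)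
    have hbd := hb.bounds (l, g) (by simp)
    have hgm := hlt (l, g) (by simp)
    simp only [List.getElem_cons_zero, Nat.cast_zero, sub_zero] at h0 hbd hgm
    by_cases hli : (l.natAbs : ℤ) < i
    · refine precededBy_pathWord hb ?_ (by omega)
      simp only [List.head?_cons, Option.mem_some_iff]
      rintro y rfl
      simp only
      omega
    obtain rfl : g = m - 1 := by omega
    rw [pathWord_cons]
    simp only
    rcases (show l = -(m - 1) ∨ l = m - 1 by omega) with rfl | rfl
    · rw [path_split (-((j : ℤ) + 1)) (by omega) (by omega), List.append_assoc]
      exact precededBy_path_append (-((j : ℤ) + 1)) (by omega) (by omega) (by omega) (by omega)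
        precededBy_zero
    · rcases (show (j : ℤ) = m - 2 ∨ (j : ℤ) < m - 1 - 1 by omega) with hj | hj
      · exact precededBy_path_append (m - 1) (by omega) (by omega) (by omega) (by omega)
          precededBy_zero
      · refine precededBy_append (notMem_path (by omega)) ?_
        refine ih hj (by omega) hb.tail (hb.forall_lt_of_cons (by omega))
          (List.isChain_cons.1 hchain).2 fun k hk => ?_
        have h1 := h (k + 1) (by simpa using hk)
        simp only [List.getElem_cons_succ, Nat.cast_add, Nat.cast_one] at h1
        omega

/-- The words of affine length one with `i > 0` have no forbidden factor. -/
theorem avoid_path_append_pathWord (hN : 2 ≤ N) {i : ℤ} (hi : 0 < i) {b : List (ℤ × ℤ)}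
    (hb : IsShape N b) (hlt : ∀ x ∈ b, x.2 < N) (hchain : b.IsChain NormalStep)
    (h : ∀ (k : ℕ) (hk : k < b.length),
      (b[k].1.natAbs : ℤ) = (N : ℤ) - 1 - k ∨ (b[k].1.natAbs : ℤ) < i) :
    Avoid (natC N) (path i N ++ pathWord b) := by
  refine avoid_path_append (avoid_pathWord hN hb hchain) fun j hij hjN => ?_
  obtain ⟨j, rfl⟩ := Int.eq_ofNat_of_zero_le (hi.le.trans hij)
  rw [Int.natAbs_natCast]
  obtain h1 | h1 | h1 : j = N ∨ j = N - 1 ∨ j < N - 1 := by omega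
  · subst h1
    rw [path_eq_nil (by omega)]
    exact addable_of_notMem (hb.notMem_pathWord hlt)
  · refine .inr ⟨N, natC_eq_four (by omega) (by omega), ?_, ?_⟩
    · exact precededBy_eq_path_append N (by omega) (by omega) (by omega) (by omega)
    · rw [show (j : ℤ) + 1 = N by omega, path_self]
      exact gapTwo_cons (precededBy_of_notMem (hb.notMem_pathWord hlt))
  · left
    refine precededBy_path_append ((j : ℤ) + 1) (by omega) (by omega) (by omega) (by omega) ?_
    exact precededBy_pathWord_of_eq_or_lt hi hij (m := N) (by omega) le_rfl hb hlt hchain h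

/-- The list `(m, m), (m - 1, m - 1), …, (z, z)`. -/
def diagonal (z m : ℤ) : List (ℤ × ℤ) :=
  (List.range (m + 1 - z).toNat).map fun k : ℕ => (m - k, m - k)

theorem mem_diagonal {z m : ℤ} {x : ℤ × ℤ} (h : x ∈ diagonal z m) :
    x.1 = x.2 ∧ z ≤ x.1 ∧ x.1 ≤ m := by
  simp only [diagonal, List.mem_map, List.mem_range] at h
  obtain ⟨k, hk, rfl⟩ := h
  exact ⟨rfl, by simp only; omega, by simp only; omega⟩

theorem pairwise_diagonal (z m : ℤ) : (diagonal z m).Pairwise fun x y => y.1 < x.1 := by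
  rw [diagonal, List.pairwise_map]
  refine List.pairwise_lt_range.imp fun h => ?_
  simp only
  omega

theorem pathWord_diagonal {z m : ℤ} : pathWord (diagonal z m) = (path z m).reverse := by
  obtain ⟨d, hd⟩ : ∃ d : ℕ, (m + 1 - z).toNat = d := ⟨_, rfl⟩
  induction d generalizing m with
  | zero => rw [path_eq_nil (by omega), diagonal, hd]; rfl
  | succ d ih =>
    rw [path_reverse_concat (by omega), ← ih (by omega), diagonal, hd, diagonal,
      show (m - 1 + 1 - z).toNat = d by omega, List.range_succ_eq_map, List.map_cons, pathWord_cons,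
      List.map_map, Nat.cast_zero, sub_zero, path_self]
    simp only [Function.comp_def, Nat.cast_succ, List.singleton_append]
    congr 4
    funext k
    simp only [Prod.mk.injEq]
    omega

theorem isShape_diagonal_append {z : ℤ} (hz : 0 ≤ z) {b : List (ℤ × ℤ)} (hb : IsShape N b)
    (hlt : ∀ x ∈ b, x.2 < z) : IsShape N (diagonal z ((N : ℤ) - 1) ++ b) := by
  refine ⟨?_, List.pairwise_append.2 ⟨?_, hb.pairwise, ?_⟩⟩
  · intro x hx
    rcases List.mem_append.1 hx with hx | hx
    · have := mem_diagonal hx; omega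
    · exact hb.bounds x hx
  · refine (pairwise_diagonal _ _).imp_of_mem fun hx hy h => ?_
    have := mem_diagonal hx
    have := mem_diagonal hy
    omega
  · intro x hx y hy
    have := mem_diagonal hx
    have := hlt y hy
    omega

theorem pathWord_map_zero (rs : List ℤ) :
    pathWord (rs.map fun r => ((0 : ℤ), r)) = rs.flatMap (path 0) := by
  simp [pathWord, List.flatMap_map]

/-- The words of affine length one with `i = 0` have no forbidden factor. -/
theorem avoid_path_zero (hN : 2 ≤ N) {z : ℤ} {rs : List ℤ} (hz : 0 ≤ z) (hzN : z ≤ N)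
    (hrs : rs.Pairwise (· > ·)) (hr : ∀ r ∈ rs, 0 ≤ r ∧ r < z) :
    Avoid (natC N) (path 0 N ++ ((path z ((N : ℤ) - 1)).reverse ++ rs.flatMap (path 0))) := by
  have hb0 : IsShape N (rs.map fun r => ((0 : ℤ), r)) := by
    refine ⟨?_, ?_⟩
    · intro x hx
      obtain ⟨r, hr', rfl⟩ := List.mem_map.1 hx
      have := hr r hr'
      simp only
      omega
    · rw [List.pairwise_map]
      exact hrs.imp fun h => .inl h
  have hlt0 : ∀ x ∈ rs.map (fun r => ((0 : ℤ), r)), x.2 < z := by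
    intro x hx
    obtain ⟨r, hr', rfl⟩ := List.mem_map.1 hx
    exact (hr r hr').2
  have hb := isShape_diagonal_append hz hb0 hlt0
  have hword : pathWord (diagonal z ((N : ℤ) - 1) ++ rs.map fun r => ((0 : ℤ), r)) =
      (path z ((N : ℤ) - 1)).reverse ++ rs.flatMap (path 0) := by
    rw [pathWord_append, pathWord_diagonal, pathWord_map_zero]
  -- Without the initial 0 this is the case `i = 1` of the words with positive left end: the
  -- diagonal part satisfies the equality and the paths from 0 satisfy `0 < 1`.
  have h1 : Avoid (natC N) (path 1 N ++ ((path z ((N : ℤ) - 1)).reverse ++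
      rs.flatMap (path 0))) := by
    rw [← hword]
    refine avoid_path_append_pathWord hN one_pos hb ?_ ?_ ?_
    · intro x hx
      rcases List.mem_append.1 hx with hx | hx
      · have := mem_diagonal hx; omega
      · have := hlt0 x hx; omega
    · refine List.isChain_append.2 ⟨?_, ?_, ?_⟩
      · refine ((pairwise_diagonal _ _).imp_of_mem (S := NormalStep) fun hx hy h => ?_).isChain
        have := mem_diagonal hx
        have := mem_diagonal hy
        exact ⟨by omega, by omega⟩
      · refine List.Pairwise.isChain ?_
        rw [List.pairwise_map]
        exact hrs.imp fun _ => ⟨le_rfl, .inl rfl⟩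
      · intro x hx y hy
        have := mem_diagonal (List.mem_of_mem_getLast? hx)
        obtain ⟨r, -, rfl⟩ := List.mem_map.1 (List.mem_of_mem_head? hy)
        exact ⟨by omega, .inl rfl⟩
    · intro k hk
      rw [List.getElem_append]
      split_ifs with hk'
      · left
        simp only [diagonal, List.getElem_map, List.getElem_range, List.length_map,
          List.length_range] at hk' ⊢
        omega
      · right
        simp
  rw [path_cons (by omega)]
  refine h1.cons ?_
  -- If `z ≤ 1`, the reversed path contains a second 1 before any 0. Otherwise use the edge 0 - 1 of
  -- label 4: after the first 1 comes 2, and then a 0 precedes any further 1.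
  rcases (show z ≤ 1 ∨ 2 ≤ z by omega) with hz1 | hz1
  · left
    refine precededBy_path_append 1 (by omega) (by omega) (by omega) (by omega) ?_
    rw [path_reverse, path_split (l := -((N : ℤ) - 1)) (-1) (by omega) (by omega), List.append_assoc]
    exact precededBy_path_append (-1) (by omega) (by omega) (by omega) (by omega) precededBy_zero
  · refine .inr ⟨1, natC_eq_four (by omega) (by omega), ?_, ?_⟩
    · change PrecededBy _ _ 1 (path (0 + 1) N ++ _)
      rw [path_split (l := 0 + 1) 1 (by omega) (by omega), List.append_assoc]
      exact precededBy_eq_path_append 1 (by omega) (by omega) (by omega) (by omega)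
    · rw [path_cons (l := 1) (by omega)]
      refine gapTwo_cons ?_
      refine precededBy_path_append 2 (by omega) (by omega) (by omega) (by omega) ?_
      rw [path_reverse]
      refine precededBy_append (notMem_path (by omega)) ?_
      rw [← pathWord_map_zero]
      refine precededBy_pathWord hb0 ?_ (by omega)
      intro x hx
      obtain ⟨r, -, rfl⟩ := List.mem_map.1 (List.mem_of_mem_head? hx)
      simp

end Sufficient

/-! ### Normal forms as canonical lists -/

section Forms

variable {n : ℕ}

theorem natC_val (i j : Fin (n + 2)) : natC (n + 1) i j = affineC n i j := by
  rw [natC_apply, affineC_apply]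
  simp only [Fin.ext_iff]

theorem map_val_toC_bracket {l g : ℤ} (hl : -(n : ℤ) ≤ l) (hg : g ≤ n) (h : 0 ≤ l ∨ 0 ≤ g) :
    (toC (bracket n l g)).map Fin.val = path l g := by
  rw [toC, bracket, bracketIndices_eq_path h, List.map_map, List.map_map]
  refine (List.map_congr_left fun a ha => ?_).trans (List.map_id _)
  obtain ⟨j, h1, h2, rfl⟩ := mem_path.1 ha
  simp only [Function.comp_apply, Fin.val_castSucc, Fin.val_ofNat, id]
  exact Nat.mod_eq_of_lt (by omega)

theorem map_val_block {i : ℤ} (hi : -(n : ℤ) ≤ i) (hi' : i ≤ n + 1) :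
    (block n i).map Fin.val = path i ((n + 1 : ℕ) : ℤ) := by
  rw [block, List.map_append, map_val_toC_bracket hi le_rfl (by omega),
    path_concat (l := i) (m := ((n + 1 : ℕ) : ℤ)) (by push_cast; omega), Nat.cast_succ,
    add_sub_cancel_right]
  rfl

theorem toC_append (u v : List (Fin (n + 1))) : toC (u ++ v) = toC u ++ toC v :=
  List.map_append

theorem toC_reverse (u : List (Fin (n + 1))) : toC u.reverse = (toC u).reverse :=
  List.map_reverse

theorem map_val_toC_bracketWord {b : List (ℤ × ℤ)}
    (hb : ∀ x ∈ b, -(n : ℤ) ≤ x.1 ∧ x.2 ≤ n ∧ 0 ≤ x.2) :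
    (toC (bracketWord n b)).map Fin.val = pathWord b := by
  induction b with
  | nil => rfl
  | cons x b ih =>
    have h1 := hb x (by simp)
    rw [pathWord_cons, ← ih fun y hy => hb y (by simp [hy]), bracketWord, List.flatMap_cons,
      toC_append, List.map_append, map_val_toC_bracket h1.1 h1.2.1 (.inr h1.2.2)]
    rfl

theorem count_last_toC (u : List (Fin (n + 1))) : (toC u).count (Fin.last (n + 1)) = 0 := by
  rw [List.count_eq_zero, toC, List.mem_map]
  rintro ⟨a, -, ha⟩
  exact Fin.castSucc_ne_last a ha

theorem count_last_block (i : ℤ) : (block n i).count (Fin.last (n + 1)) = 1 := by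
  rw [block, List.count_append, count_last_toC]
  simp

theorem count_last_flatMap_block (is : List ℤ) :
    (is.flatMap (block n)).count (Fin.last (n + 1)) = is.length := by
  induction is with
  | nil => rfl
  | cons i is ih =>
    rw [List.flatMap_cons, List.count_append, ih, count_last_block, List.length_cons, add_comm]

theorem flatten_replicate_block (k : ℕ) (i : ℤ) :
    (List.replicate k (block n i)).flatten = (List.replicate k i).flatMap (block n) := by
  rw [List.flatMap_def, List.map_replicate]

theorem count_last_flatten_replicate (k : ℕ) (i : ℤ) :
    (List.replicate k (block n i)).flatten.count (Fin.last (n + 1)) = k := by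
  rw [flatten_replicate_block, count_last_flatMap_block, List.length_replicate]

theorem map_val_flatMap_block {is : List ℤ} (h : ∀ i ∈ is, -(n : ℤ) ≤ i ∧ i ≤ n + 1) :
    (is.flatMap (block n)).map Fin.val =
      pathWord (is.map fun i => (i, ((n + 1 : ℕ) : ℤ))) := by
  induction is with
  | nil => rfl
  | cons i is ih =>
    have h1 := h i (by simp)
    rw [List.flatMap_cons, List.map_append, map_val_block h1.1 h1.2,
      ih fun j hj => h j (by simp [hj])]
    rfl

theorem affineC_spec (hn : 1 ≤ n) {ω : List (Fin (n + 2))}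
    (h : Avoid (natC (n + 1)) (ω.map Fin.val)) :
    (csC n).IsReduced ω ∧ IsFullyCommutative (csC n) ((csC n).wordProd ω) ∧
      affineLength n ((csC n).wordProd ω) = ω.count (Fin.last (n + 1)) := by
  have h1 : Avoid (affineC n) ω := (avoid_map_iff Fin.val_injective natC_val).1 h
  have h2 := (CoxeterSystem.isReduced_and_comm_of_avoid (csC_isSmallFaithful hn) h1).1
  have h3 := CoxeterSystem.isFullyCommutative_of_avoid (csC_isSmallFaithful hn) h1
  exact ⟨h2, h3, affineLength_eq_count h3 h2 rfl⟩

theorem typeB_spec (hn : 1 ≤ n) {ω : List (Fin (n + 1))}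
    (h : Avoid (natC (n + 1)) ((toC ω).map Fin.val)) :
    (csB n).IsReduced ω ∧ IsFullyCommutative (csB n) ((csB n).wordProd ω) := by
  obtain ⟨h1, h2, -⟩ := affineC_spec hn h
  exact ⟨isReduced_of_toC hn h1, isFullyCommutative_of_toC hn h1 h2⟩

theorem isChain_normalStep_of_pairwise {c : List (ℤ × ℤ)} (h : (c.map Prod.fst).Pairwise (· > ·))
    (hpos : ∀ x ∈ c, 0 < x.1) : c.IsChain NormalStep := by
  rw [List.pairwise_map] at h
  refine (h.imp_of_mem (S := NormalStep) fun hx hy h => ?_).isChain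
  have := hpos _ hx
  have := hpos _ hy
  exact ⟨by omega, by omega⟩

theorem isChain_normalStep_of_forall_zero {c : List (ℤ × ℤ)} (h : ∀ x ∈ c, x.1 = 0) :
    c.IsChain NormalStep := by
  refine List.Pairwise.isChain (List.pairwise_of_forall_mem_list fun x hx y hy => ?_)
  exact ⟨(h x hx).ge, .inl (h y hy)⟩

/-- The condition on the left ends in Stembridge's form. -/
def LeftCondition (b : List (ℤ × ℤ)) : Prop :=
  (∃ a c, b = a ++ c ∧ (a.map Prod.fst).Pairwise (· > ·) ∧ (∀ x ∈ a, 0 < x.1) ∧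
    ∀ x ∈ c, x.1 = 0) ∨
  (∃ a x, b = a ++ [x] ∧ (a.map Prod.fst).Pairwise (· > ·) ∧ (∀ y ∈ a, -x.1 < y.1) ∧ x.1 < 0)

theorem LeftCondition.isChain {b : List (ℤ × ℤ)} (h : LeftCondition b) : b.IsChain NormalStep := by
  obtain ⟨a, c, rfl, h1, h2, h3⟩ | ⟨a, x, rfl, h1, h2, h3⟩ := h
  · refine List.isChain_append.2 ⟨isChain_normalStep_of_pairwise h1 h2,
      isChain_normalStep_of_forall_zero h3, fun x hx y hy => ⟨?_, .inl ?_⟩⟩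
    · exact (h2 x (List.mem_of_mem_getLast? hx)).le
    · exact h3 y (List.mem_of_mem_head? hy)
  · refine List.isChain_append.2 ⟨isChain_normalStep_of_pairwise h1 fun y hy => ?_, .singleton _,
      fun y hy z hz => ?_⟩
    · have := h2 y hy; omega
    · have := h2 y (List.mem_of_mem_getLast? hy)
      simp only [List.head?_cons, Option.mem_some_iff] at hz
      subst hz
      exact ⟨by omega, by omega⟩

/-- The sign of the first left end decides: a negative one ends the list, a zero forces zeros from
there on, and a positive one bounds the absolute values of all the later left ends. -/
theorem leftCondition_of_isChain {b : List (ℤ × ℤ)} (h : b.IsChain NormalStep) :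
    LeftCondition b := by
  induction b with
  | nil => exact .inl ⟨[], [], rfl, by simp, by simp, by simp⟩
  | cons x b ih =>
    obtain ⟨hhead, htail⟩ := List.isChain_cons.1 h
    obtain hx | hx | hx := lt_trichotomy x.1 0
    · rcases b with _ | ⟨y, b⟩
      · exact .inr ⟨[], x, rfl, by simp, by simp, hx⟩
      · have := (hhead y (by simp)).1
        omega
    · exact .inl ⟨[], x :: b, rfl, by simp, by simp, forall_eq_zero_of_isChain h hx⟩
    · have hlt : ∀ y ∈ b, (y.1.natAbs : ℤ) < x.1 := by
        rcases b with _ | ⟨y, b⟩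
        · simp
        · have h1 := (hhead y (by simp)).2
          exact forall_abs_lt_of_isChain hx htail (by omega)
      obtain ⟨a, c, rfl, h1, h2, h3⟩ | ⟨a, y, rfl, h1, h2, h3⟩ := ih htail
      · refine .inl ⟨x :: a, c, rfl, List.pairwise_cons.2 ⟨?_, h1⟩,
          List.forall_mem_cons.2 ⟨hx, h2⟩, h3⟩
        intro z hz
        obtain ⟨y, hy, rfl⟩ := List.mem_map.1 hz
        have := hlt y (by simp [hy])
        simp only [gt_iff_lt]
        omega
      · refine .inr ⟨x :: a, y, rfl, List.pairwise_cons.2 ⟨?_, h1⟩,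
          List.forall_mem_cons.2 ⟨?_, h2⟩, h3⟩
        · intro z hz
          obtain ⟨w, hw, rfl⟩ := List.mem_map.1 hz
          have := hlt w (by simp [hw])
          simp only [gt_iff_lt]
          omega
        · have := hlt y (by simp)
          omega

theorem IsStembridge.natAbs_bounds {b : List (ℤ × ℤ)} (h : IsStembridge n b) :
    ∀ x ∈ b, 0 ≤ x.2 ∧ x.2 ≤ n ∧ (x.1.natAbs : ℤ) ≤ x.2 := by
  intro x hx
  have h1 := h.bounds x hx
  rwa [Int.abs_eq_natAbs] at h1

theorem IsStembridge.isShape {b : List (ℤ × ℤ)} (h : IsStembridge n b) : IsShape (n + 1) b := by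
  refine ⟨fun x hx => ?_, ?_⟩
  · have := h.natAbs_bounds x hx
    push_cast
    omega
  · have := h.right_decreasing
    rw [List.pairwise_map] at this
    exact this.imp fun h => .inl h

theorem IsStembridge.isChain {b : List (ℤ × ℤ)} (h : IsStembridge n b) : b.IsChain NormalStep :=
  LeftCondition.isChain h.left_condition

theorem IsStembridge.map_val {b : List (ℤ × ℤ)} (h : IsStembridge n b) :
    (toC (bracketWord n b)).map Fin.val = pathWord b :=
  map_val_toC_bracketWord fun x hx => by have := h.natAbs_bounds x hx; omega

theorem IsStembridge.snd_lt {b : List (ℤ × ℤ)} (h : IsStembridge n b) :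
    ∀ x ∈ b, x.2 < ((n + 1 : ℕ) : ℤ) := by
  intro x hx
  have := h.natAbs_bounds x hx
  push_cast
  omega

theorem isStembridge_of_isChain {b : List (ℤ × ℤ)} (hb : IsShape (n + 1) b)
    (hlt : ∀ x ∈ b, x.2 < ((n + 1 : ℕ) : ℤ)) (hchain : b.IsChain NormalStep) :
    IsStembridge n b where
  bounds x hx := by
    have h1 := hb.bounds x hx
    have h2 := hlt x hx
    rw [Int.abs_eq_natAbs]
    push_cast at h1 h2
    omega
  right_decreasing := pairwise_snd_of_lt hb hlt
  left_condition := leftCondition_of_isChain hchain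

theorem length_le_of_pairwise {l : List ℤ} {m : ℕ} (h : l.Pairwise (· > ·))
    (hl : ∀ x ∈ l, 1 ≤ x ∧ x ≤ m) : l.length ≤ m := by
  have h1 : l.Nodup := h.imp fun h => h.ne'
  rw [← List.toFinset_card_of_nodup h1]
  have h2 : l.toFinset ⊆ Finset.Icc (1 : ℤ) m := by
    intro x hx
    exact Finset.mem_Icc.2 (hl x (List.mem_toFinset.1 hx))
  simpa using Finset.card_le_card h2

theorem append_inj_of_forall {α : Type*} {p : α → Prop} {a b a' b' : List α} (ha : ∀ x ∈ a, p x)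
    (hb : ∀ x ∈ b, ¬ p x) (ha' : ∀ x ∈ a', p x) (hb' : ∀ x ∈ b', ¬ p x)
    (h : a ++ b = a' ++ b') : a = a' ∧ b = b' := by
  induction a generalizing a' with
  | nil =>
    rcases a' with _ | ⟨x, a'⟩
    · exact ⟨rfl, h⟩
    · rw [List.nil_append] at h
      exact absurd (ha' x (by simp)) (hb x (by simp [h]))
  | cons x a ih =>
    rcases a' with _ | ⟨y, a'⟩
    · rw [List.nil_append] at h
      exact absurd (ha x (by simp)) (hb' x (by simp [← h]))
    · simp only [List.cons_append, List.cons.injEq] at h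
      obtain ⟨h1, h2⟩ := ih (fun z hz => ha z (by simp [hz])) (fun z hz => ha' z (by simp [hz])) h.2
      exact ⟨by rw [h.1, h1], h2⟩

/-- The part with right end `N` comes first. -/
theorem IsShape.exists_append {N : ℕ} {c : List (ℤ × ℤ)} (hc : IsShape N c) :
    ∃ a b, c = a ++ b ∧ (∀ x ∈ a, x.2 = N) ∧ ∀ x ∈ b, x.2 < N := by
  induction c with
  | nil => exact ⟨[], [], rfl, by simp, by simp⟩
  | cons x c ih =>
    obtain ⟨hb, hlt, hc'⟩ := isShape_cons.1 hc
    by_cases hx : x.2 = N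
    · obtain ⟨a, b, rfl, ha, hb⟩ := ih hc'
      exact ⟨x :: a, b, rfl, List.forall_mem_cons.2 ⟨hx, ha⟩, hb⟩
    · refine ⟨[], x :: c, rfl, by simp, List.forall_mem_cons.2 ⟨by omega, fun y hy => ?_⟩⟩
      have := hlt y hy
      omega

theorem count_pathWord_of_lt {N : ℕ} {b : List (ℤ × ℤ)} (hb : IsShape N b)
    (hlt : ∀ x ∈ b, x.2 < N) : (pathWord b).count N = 0 :=
  List.count_eq_zero.2 (hb.notMem_pathWord hlt)

theorem count_pathWord_of_eq {N : ℕ} {a b : List (ℤ × ℤ)} (hab : IsShape N (a ++ b))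
    (h : ∀ x ∈ a, x.2 = N) (hlt : ∀ x ∈ b, x.2 < N) : (pathWord (a ++ b)).count N = a.length := by
  induction a with
  | nil => exact count_pathWord_of_lt hab hlt
  | cons x a ih =>
    have hx := hab.bounds x (by simp)
    have hx2 := h x (by simp)
    rw [List.cons_append, pathWord_cons, List.count_append,
      ih hab.tail (fun y hy => h y (by simp [hy])), hx2, path_concat (by omega), List.count_append,
      List.count_eq_zero.2 (notMem_path (by omega)), List.length_cons]
    simp [add_comm]

/-- The canonical list of the word `[f, n]⁻¹`. -/
def tailShape (n : ℕ) (f : ℤ) : List (ℤ × ℤ) :=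
  -- Descending letters are paths of one letter, since right ends must decrease. When `f ≤ 0`, the
  -- descent stops at 1 - f and the remaining palindrome from `|f|` through 0 back to `|f|` is a
  -- single path.
  if 0 < f then diagonal f n else diagonal (1 - f) n ++ [(f, -f)]

theorem isShape_tailShape {f : ℤ} (hf : -(n : ℤ) ≤ f) : IsShape (n + 1) (tailShape n f) := by
  have hnil : IsShape (n + 1) [] := ⟨by simp, by simp⟩
  rw [tailShape]
  split_ifs with h
  · have h1 := isShape_diagonal_append h.le hnil (by simp)
    push_cast at h1
    simpa using h1
  · have h2 : IsShape (n + 1) [(f, -f)] := by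
      refine isShape_cons.2 ⟨?_, by simp, hnil⟩
      push_cast
      omega
    have h1 := isShape_diagonal_append (z := 1 - f) (by omega) h2 (by simp)
    push_cast at h1
    simpa using h1

theorem snd_le_of_mem_tailShape {f : ℤ} (hf : -(n : ℤ) ≤ f) : ∀ x ∈ tailShape n f, x.2 ≤ n := by
  intro x hx
  rw [tailShape] at hx
  split_ifs at hx with h
  · have := mem_diagonal hx; omega
  · rcases List.mem_append.1 hx with hx | hx
    · have := mem_diagonal hx; omega
    · rw [List.mem_singleton.1 hx]; simp only; omega

theorem pathWord_tailShape {f : ℤ} (hf : -(n : ℤ) ≤ f) :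
    pathWord (tailShape n f) = (path f n).reverse := by
  rw [tailShape]
  split_ifs with h
  · exact pathWord_diagonal
  · rw [pathWord_append, pathWord_diagonal, path_reverse, path_reverse,
      path_split (l := -(n : ℤ)) (m := -f) (-(1 - f)) (by omega) (by omega)]
    congr 1
    simp only [pathWord, List.flatMap_cons, List.flatMap_nil, List.append_nil]
    congr 1
    ring

theorem length_path (l m : ℤ) : (path l m).length = (m + 1 - l).toNat := by simp [path]

/-- The canonical list of the word of a normal form. -/
def NormalForm.shape (n : ℕ) : NormalForm → List (ℤ × ℤ)
  | .first i k f => ((i, ((n + 1 : ℕ) : ℤ)) :: List.replicate k (-(n : ℤ), ((n + 1 : ℕ) : ℤ))) ++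
      tailShape n f
  | .second is k b => (is.map fun i => (i, ((n + 1 : ℕ) : ℤ))) ++
      (List.replicate k (0, ((n + 1 : ℕ) : ℤ)) ++ b)

theorem IsSecondType.eq_nil_or {is : List ℤ} {k : ℕ} {b : List (ℤ × ℤ)}
    (h : IsSecondType n is k b) : is = [] ∨ ∃ js ip, is = js ++ [ip] ∧ js.Pairwise (· > ·) ∧
      (∀ j ∈ js, (ip.natAbs : ℤ) < j) ∧ ip ≠ 0 ∧ (ip < 0 → k = 0 ∧ b = [] ∧ ip ≠ -(n : ℤ)) ∧
      (k = 0 → 0 < ip → ∀ x ∈ b.head?, (x.1.natAbs : ℤ) < ip) := by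
  rcases List.eq_nil_or_concat' is with h1 | ⟨js, ip, h1⟩
  · exact .inl h1
  obtain ⟨h2, h3⟩ := h.decreasing js ip h1
  rw [List.pairwise_append] at h2
  refine .inr ⟨js, ip, h1, h2.1, fun j hj => ?_, abs_pos.1 h3, h.of_neg js ip h1,
    fun hk hi x hx => ?_⟩
  · have := h2.2.2 j hj |ip| (by simp)
    rwa [Int.abs_eq_natAbs] at this
  · have := h.of_pos js ip h1 hk hi x hx
    rwa [Int.abs_eq_natAbs] at this

theorem IsSecondType.ne_zero {is : List ℤ} {k : ℕ} {b : List (ℤ × ℤ)}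
    (h : IsSecondType n is k b) : ∀ i ∈ is, i ≠ 0 := by
  obtain rfl | ⟨js, ip, rfl, -, h2, h3, -⟩ := h.eq_nil_or
  · simp
  · intro i hi
    rcases List.mem_append.1 hi with hi | hi
    · have := h2 i hi; omega
    · rwa [List.mem_singleton.1 hi]

/-- The numbers `i_1, …, i_{p-1}, |i_p|` are distinct elements of the interval from 1 to n + 1. -/
theorem IsSecondType.length_le {is : List ℤ} {k : ℕ} {b : List (ℤ × ℤ)}
    (h : IsSecondType n is k b) : is.length ≤ n + 1 := by
  obtain rfl | ⟨js, ip, rfl, h1, h2, h3, -⟩ := h.eq_nil_or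
  · simp
  have hip := h.left_bounds ip (by simp)
  have h4 : (js ++ [(ip.natAbs : ℤ)]).length ≤ n + 1 := by
    refine length_le_of_pairwise (List.pairwise_append.2 ⟨h1, by simp, ?_⟩) ?_
    · intro j hj z hz
      rw [List.mem_singleton.1 hz]
      exact h2 j hj
    · intro x hx
      push_cast
      rcases List.mem_append.1 hx with hx | hx
      · have h5 := h.left_bounds x (by simp [hx])
        have h6 := h2 x hx
        omega
      · rw [List.mem_singleton.1 hx]
        omega
  simpa using h4

theorem isShape_append_of_eq {N : ℕ} {a b : List (ℤ × ℤ)} (hb : IsShape N b)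
    (ha : ∀ x ∈ a, x.2 = N ∧ -(N : ℤ) < x.1 ∧ x.1 ≤ N) : IsShape N (a ++ b) := by
  induction a with
  | nil => exact hb
  | cons x a ih =>
    have h1 := ha x (by simp)
    have ih' := ih fun y hy => ha y (by simp [hy])
    refine isShape_cons.2 ⟨by omega, fun y hy => ?_, ih'⟩
    have := ih'.bounds y hy
    omega

theorem NormalForm.isShape_shape {d : NormalForm} (h : d.IsValid n) :
    IsShape (n + 1) (d.shape n) := by
  rcases d with ⟨i, k, f⟩ | ⟨is, k, b⟩
  · have h1 : IsFirstType n i f := h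
    obtain ⟨h2, h3⟩ := h1
    refine isShape_append_of_eq (isShape_tailShape h3.1) fun x hx => ?_
    rcases List.mem_cons.1 hx with rfl | hx
    · refine ⟨rfl, ?_, ?_⟩ <;> push_cast <;> omega
    · rw [List.eq_of_mem_replicate hx]
      refine ⟨rfl, ?_, ?_⟩ <;> push_cast <;> omega
  · have h1 : IsSecondType n is k b := h
    refine isShape_append_of_eq (isShape_append_of_eq h1.stembridge.isShape fun x hx => ?_)
      fun x hx => ?_
    · rw [List.eq_of_mem_replicate hx]
      refine ⟨rfl, ?_, ?_⟩ <;> push_cast <;> omega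
    · obtain ⟨i, hi, rfl⟩ := List.mem_map.1 hx
      have := h1.left_bounds i hi
      refine ⟨rfl, ?_, ?_⟩ <;> push_cast <;> omega

theorem NormalForm.map_val_word {d : NormalForm} (h : d.IsValid n) :
    (d.word n).map Fin.val = pathWord (d.shape n) := by
  rcases d with ⟨i, k, f⟩ | ⟨is, k, b⟩
  · have h1 : IsFirstType n i f := h
    obtain ⟨h2, h3⟩ := h1
    rw [NormalForm.word, NormalForm.shape, List.map_append, List.map_append, map_val_block h2.1 h2.2,
      flatten_replicate_block, map_val_flatMap_block, List.map_reverse,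
      map_val_toC_bracket h3.1 le_rfl (by omega), pathWord_append, pathWord_tailShape h3.1,
      pathWord_cons, List.map_replicate]
    intro j hj
    rw [List.eq_of_mem_replicate hj]
    omega
  · have h1 : IsSecondType n is k b := h
    rw [NormalForm.word, NormalForm.shape, List.map_append, List.map_append,
      map_val_flatMap_block h1.left_bounds, flatten_replicate_block, map_val_flatMap_block,
      h1.stembridge.map_val, pathWord_append, pathWord_append, List.map_replicate, List.append_assoc]
    intro j hj
    rw [List.eq_of_mem_replicate hj]
    omega

theorem NormalForm.isChain_shape {is : List ℤ} {k : ℕ} {b : List (ℤ × ℤ)}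
    (h : IsSecondType n is k b) :
    ((NormalForm.second is k b).shape n).IsChain NormalStep := by
  have hz : (List.replicate k ((0 : ℤ), ((n + 1 : ℕ) : ℤ)) ++ b).IsChain NormalStep := by
    rcases Nat.eq_zero_or_pos k with rfl | hk
    · exact h.stembridge.isChain
    · refine isChain_normalStep_of_forall_zero fun x hx => ?_
      rcases List.mem_append.1 hx with hx | hx
      · rw [List.eq_of_mem_replicate hx]
      · exact h.of_k_pos hk x hx
  rw [NormalForm.shape]
  obtain rfl | ⟨js, ip, rfl, h1, h2, h3, h4, h5⟩ := h.eq_nil_or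
  · exact hz
  rw [List.map_append]
  refine List.isChain_append.2 ⟨List.isChain_append.2 ⟨?_, .singleton _, ?_⟩, hz, ?_⟩
  · refine isChain_normalStep_of_pairwise ?_ ?_
    · simpa [Function.comp_def] using h1
    · intro x hx
      obtain ⟨j, hj, rfl⟩ := List.mem_map.1 hx
      have := h2 j hj
      simp only
      omega
  · intro x hx y hy
    obtain ⟨j, hj, rfl⟩ := List.mem_map.1 (List.mem_of_mem_getLast? hx)
    simp only [List.map_cons, List.map_nil, List.head?_cons, Option.mem_some_iff] at hy
    subst hy
    have := h2 j hj
    exact ⟨by simp only; omega, .inr this⟩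
  · intro x hx y hy
    simp only [List.map_cons, List.map_nil, List.getLast?_concat, Option.mem_some_iff] at hx
    subst hx
    rcases Nat.eq_zero_or_pos k with rfl | hk
    · rw [List.replicate_zero, List.nil_append] at hy
      rcases lt_or_gt_of_ne h3 with h6 | h6
      · rw [(h4 h6).2.1] at hy
        simp at hy
      · exact ⟨h6.le, .inr (h5 rfl h6 y hy)⟩
    · refine ⟨?_, .inl ?_⟩
      · by_contra h6
        have := h4 (not_le.1 h6)
        omega
      · rcases List.mem_append.1 (List.mem_of_mem_head? hy) with hy | hy
        · rw [List.eq_of_mem_replicate hy]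
        · exact h.of_k_pos hk y hy

/-- The word of a normal form has no forbidden factor. -/
theorem NormalForm.avoid_word (hn : 1 ≤ n) {d : NormalForm} (h : d.IsValid n) :
    Avoid (natC (n + 1)) ((d.word n).map Fin.val) := by
  rw [NormalForm.map_val_word h]
  rcases d with ⟨i, k, f⟩ | ⟨is, k, b⟩
  · have h1 : IsFirstType n i f := h
    obtain ⟨h2, h3⟩ := h1
    have h4 := avoid_first (N := n + 1) (by omega) (i := i) (f := f) (by push_cast; omega)
      (by push_cast; omega) (by push_cast; omega) k
    rw [NormalForm.shape, pathWord_append, pathWord_tailShape h3.1, pathWord_cons,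
      List.append_assoc]
    convert h4 using 4
    · rw [pathWord, List.flatMap_def, List.map_replicate]
      push_cast
      simp
    · push_cast
      simp
  · exact avoid_pathWord (by omega) (NormalForm.isShape_shape h) (NormalForm.isChain_shape h)

/-- The entries with right end N are separated from the rest, and in the second type the nonzero
left ends come before the zeros, so all parameters can be read off. The types are separated by the
second left end; this is why two letters t_{n+1} are required. -/
theorem NormalForm.shape_injective {d d' : NormalForm} (h : d.IsValid n) (h' : d'.IsValid n)
    (hd : 2 ≤ (d.word n).count (Fin.last (n + 1)))
    (hd' : 2 ≤ (d'.word n).count (Fin.last (n + 1))) (hn : 1 ≤ n)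
    (heq : d.shape n = d'.shape n) : d = d' := by
  have htail : ∀ f : ℤ, -(n : ℤ) ≤ f → ∀ x ∈ tailShape n f, ¬ x.2 = ((n + 1 : ℕ) : ℤ) := by
    intro f hf x hx
    have := snd_le_of_mem_tailShape hf x hx
    push_cast
    omega
  have hhead : ∀ (i : ℤ) (k : ℕ), ∀ x ∈ (i, ((n + 1 : ℕ) : ℤ)) ::
      List.replicate k (-(n : ℤ), ((n + 1 : ℕ) : ℤ)), x.2 = ((n + 1 : ℕ) : ℤ) := by
    intro i k x hx
    rcases List.mem_cons.1 hx with rfl | hx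
    · rfl
    · rw [List.eq_of_mem_replicate hx]
  have hhead' : ∀ (is : List ℤ) (k : ℕ), ∀ x ∈ (is.map fun i => (i, ((n + 1 : ℕ) : ℤ))) ++
      List.replicate k ((0 : ℤ), ((n + 1 : ℕ) : ℤ)), x.2 = ((n + 1 : ℕ) : ℤ) := by
    intro i k x hx
    rcases List.mem_append.1 hx with hx | hx
    · obtain ⟨i, -, rfl⟩ := List.mem_map.1 hx
      rfl
    · rw [List.eq_of_mem_replicate hx]
  have hmixed : ∀ (i : ℤ) (k : ℕ) (f : ℤ) (is : List ℤ) (k' : ℕ) (b : List (ℤ × ℤ)),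
      IsFirstType n i f → IsSecondType n is k' b →
      2 ≤ ((NormalForm.first i k f).word n).count (Fin.last (n + 1)) →
      (NormalForm.first i k f).shape n ≠ (NormalForm.second is k' b).shape n := by
    intro i k f is k' b h1 h2 h3 h4
    have hk : 1 ≤ k := by
      rw [NormalForm.word, List.count_append, List.count_append, count_last_block,
        count_last_flatten_replicate, ← toC_reverse, count_last_toC] at h3
      omega
    obtain ⟨k, rfl⟩ := Nat.exists_eq_add_of_le' hk
    rw [NormalForm.shape, NormalForm.shape, List.replicate_succ] at h4
    have hmem : ∀ x ∈ List.replicate k' ((0 : ℤ), ((n + 1 : ℕ) : ℤ)) ++ b,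
        x.2 = ((n + 1 : ℕ) : ℤ) → x.1 = 0 := by
      intro x hx hx2
      rcases List.mem_append.1 hx with hx | hx
      · rw [List.eq_of_mem_replicate hx]
      · have := h2.stembridge.snd_lt x hx
        omega
    -- In the first type the second left end is -n. In the second type it would be zero, or a
    -- positive `i_j` with j < p, or `i_p`, for which -n is excluded by definition.
    obtain rfl | ⟨js, ip, rfl, h5, h6, h7, h8, -⟩ := h2.eq_nil_or
    · rw [List.map_nil, List.nil_append] at h4
      have := hmem (-(n : ℤ), ((n + 1 : ℕ) : ℤ)) (by rw [← h4]; simp) rfl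
      simp only at this
      omega
    · rcases js with _ | ⟨j, _ | ⟨j', js⟩⟩
      · simp only [List.nil_append, List.map_cons, List.map_nil, List.cons_append,
          List.cons.injEq] at h4
        have := hmem (-(n : ℤ), ((n + 1 : ℕ) : ℤ)) (by rw [← h4.2]; simp) rfl
        simp only at this
        omega
      · simp only [List.nil_append, List.map_cons, List.map_nil, List.cons_append,
          List.cons.injEq, Prod.mk.injEq] at h4
        have h9 := h4.2.1.1
        exact (h8 (by omega)).2.2 h9.symm
      · simp only [List.map_cons, List.cons_append, List.cons.injEq, Prod.mk.injEq] at h4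
        have h9 := h4.2.1.1
        have := h6 j' (by simp)
        omega
  rcases d with ⟨i, k, f⟩ | ⟨is, k, b⟩ <;> rcases d' with ⟨i', k', f'⟩ | ⟨is', k', b'⟩
  · have h1 : IsFirstType n i f := h
    have h1' : IsFirstType n i' f' := h'
    obtain ⟨h2, h3⟩ := append_inj_of_forall (p := fun x : ℤ × ℤ => x.2 = ((n + 1 : ℕ) : ℤ))
      (hhead i k) (htail f h1.right_bounds.1) (hhead i' k') (htail f' h1'.right_bounds.1) heq
    obtain rfl : i = i' := by simpa using (List.cons.inj h2).1
    obtain rfl : k = k' := by simpa using congrArg List.length h2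
    have h4 := congrArg (fun c => (pathWord c).length) h3
    rw [pathWord_tailShape h1.right_bounds.1, pathWord_tailShape h1'.right_bounds.1,
      List.length_reverse, List.length_reverse, length_path, length_path] at h4
    have h5 := h1.right_bounds
    have h6 := h1'.right_bounds
    obtain rfl : f = f' := by omega
    rfl
  · exact absurd heq (hmixed _ _ _ _ _ _ h h' hd)
  · exact absurd heq.symm (hmixed _ _ _ _ _ _ h' h hd')
  · have h1 : IsSecondType n is k b := h
    have h1' : IsSecondType n is' k' b' := h'
    rw [NormalForm.shape, NormalForm.shape, ← List.append_assoc, ← List.append_assoc] at heq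
    obtain ⟨h2, rfl⟩ := append_inj_of_forall (p := fun x : ℤ × ℤ => x.2 = ((n + 1 : ℕ) : ℤ))
      (hhead' is k) (fun x hx => (h1.stembridge.snd_lt x hx).ne) (hhead' is' k')
      (fun x hx => (h1'.stembridge.snd_lt x hx).ne) heq
    have h3 := congrArg (List.map Prod.fst) h2
    simp only [List.map_append, List.map_map, List.map_replicate, Function.comp_def, List.map_id']
      at h3
    obtain ⟨rfl, h4⟩ := append_inj_of_forall (p := fun x : ℤ => x ≠ 0) h1.ne_zero
      (fun x hx => by simpa using List.eq_of_mem_replicate hx) h1'.ne_zero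
      (fun x hx => by simpa using List.eq_of_mem_replicate hx) h3
    obtain rfl : k = k' := by simpa using congrArg List.length h4
    rfl

end Forms

/-! ### Existence and uniqueness of the normal forms -/

section Existence

variable {n : ℕ}

theorem exists_eq_map_mk {N : ℤ} {a : List (ℤ × ℤ)} (h : ∀ x ∈ a, x.2 = N) :
    a = (a.map Prod.fst).map fun i => (i, N) := by
  rw [List.map_map]
  conv_lhs => rw [← List.map_id a]
  exact List.map_congr_left fun x hx => Prod.ext rfl (h x hx)

/-- The form of affine length one allows the value r = -1 for an empty bracket, while the pairs of a
canonical list need nonnegative right ends. -/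
theorem flatMap_path_zero_filter (rs : List ℤ) :
    rs.flatMap (path 0) = (rs.filter fun r => 0 ≤ r).flatMap (path 0) := by
  induction rs with
  | nil => rfl
  | cons r rs ih =>
    by_cases hr : 0 ≤ r
    · rw [List.filter_cons_of_pos (by simpa using hr), List.flatMap_cons, List.flatMap_cons, ih]
    · rw [List.filter_cons_of_neg (by simpa using hr), List.flatMap_cons, ih,
        path_eq_nil (by omega), List.nil_append]

theorem map_val_toC_flatMap_bracket {rs : List ℤ} (h : ∀ r ∈ rs, r ≤ (n : ℤ)) :
    (toC (rs.flatMap (bracket n 0))).map Fin.val = rs.flatMap (path 0) := by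
  induction rs with
  | nil => rfl
  | cons r rs ih =>
    rw [List.flatMap_cons, toC_append, List.map_append,
      map_val_toC_bracket (by omega) (h r (by simp)) (.inl le_rfl),
      ih fun s hs => h s (by simp [hs]), List.flatMap_cons]

/-- The words of affine length one have no forbidden factor. -/
theorem IsLengthOneForm.avoid (hn : 1 ≤ n) {i : ℤ} {v : List (Fin (n + 1))}
    (h : IsLengthOneForm n i v) : Avoid (natC (n + 1)) ((block n i ++ toC v).map Fin.val) := by
  have hfirst : ∀ i f : ℤ, -(n : ℤ) ≤ i → i ≤ n + 1 → -(n : ℤ) ≤ f → f ≤ n + 1 →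
      Avoid (natC (n + 1)) ((block n i ++ toC (bracket n f n).reverse).map Fin.val) := by
    intro i f hi hi' hf hf'
    have h1 := NormalForm.avoid_word hn (d := .first i 0 f) ⟨⟨hi, hi'⟩, ⟨hf, hf'⟩⟩
    simpa [NormalForm.word, toC_reverse] using h1
  cases h with
  | pos i b hi hb h =>
    rw [List.map_append, map_val_block (by omega) hi.2, hb.map_val]
    refine avoid_path_append_pathWord (by omega) hi.1 hb.isShape hb.snd_lt hb.isChain fun k hk => ?_
    have h1 := h k hk
    rw [Int.abs_eq_natAbs] at h1
    rw [Nat.cast_succ]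
    omega
  | neg i f hi hf => exact hfirst i f hi.1 (by omega) hf.1 hf.2
  | zero f hf => exact hfirst 0 f (by omega) (by omega) hf.1 hf.2
  | zero' z rs hz hrs hr =>
    rw [List.map_append, map_val_block (by omega) (by omega), toC_append, List.map_append,
      toC_reverse, List.map_reverse, map_val_toC_bracket (by omega) le_rfl (.inl hz.1),
      map_val_toC_flatMap_bracket fun r hr' => by have := hr r hr'; omega,
      flatMap_path_zero_filter]
    have h1 := avoid_path_zero (N := n + 1) (by omega) (z := z)
      (rs := rs.filter fun r => 0 ≤ r) hz.1 (by push_cast; omega) (hrs.filter _) (by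
        intro r hr'
        rw [List.mem_filter] at hr'
        exact ⟨by simpa using hr'.2, (hr r hr'.1).2⟩)
    rw [Nat.cast_succ, add_sub_cancel_right] at h1
    rwa [Nat.cast_succ]

/-- A word without forbidden factor with one letter `N` has the form of affine length one. -/
theorem exists_isLengthOneForm (hn : 1 ≤ n) {x : ℤ × ℤ} {b : List (ℤ × ℤ)}
    (hc : IsShape (n + 1) (x :: b)) (hx : x.2 = ((n + 1 : ℕ) : ℤ))
    (hb : ∀ y ∈ b, y.2 < ((n + 1 : ℕ) : ℤ)) (h : Avoid (natC (n + 1)) (pathWord (x :: b))) :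
    ∃ i v, IsLengthOneForm n i v ∧ (block n i ++ toC v).map Fin.val = pathWord (x :: b) := by
  obtain ⟨i, g⟩ := x
  simp only at hx
  subst hx
  have hi := hc.bounds _ List.mem_cons_self
  simp only [forall_const] at hi
  have hi1 : -(n : ℤ) ≤ i := by push_cast at hi; omega
  have hi2 : i ≤ n + 1 := by push_cast at hi; omega
  rw [pathWord_cons] at h ⊢
  simp only at h ⊢
  rcases lt_or_ge 0 i with hpos | hneg
  · have hS : IsStembridge n b := isStembridge_of_isChain hc.tail hb
      (isChain_normal_of_lt (by omega) hc.tail hb h.of_append_right)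
    refine ⟨i, _, .pos i b ⟨hpos, hi2⟩ hS fun j hj => ?_, ?_⟩
    · have h1 := abs_fst_eq_or_lt (N := n + 1) (Y := []) (by omega) hpos le_rfl (by simp) hc.tail hb
        h j hj
      rw [Int.abs_eq_natAbs]
      rw [Nat.cast_succ] at h1
      omega
    · rw [List.map_append, map_val_block hi1 hi2, hS.map_val]
  · obtain ⟨f, hf, hf', hw⟩ | ⟨rfl, z, rs, hz, hz', hrs, hr, hw⟩ := pathWord_eq_of_nonpos
      (N := n + 1) (Y := []) (by omega) hneg (by omega) le_rfl (by simp) hc.tail hb h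
    · rw [Nat.cast_succ] at hf hf'
      rw [Nat.cast_succ, add_sub_cancel_right] at hw
      refine ⟨i, (bracket n f n).reverse, ?_, ?_⟩
      · rcases hneg.lt_or_eq with h1 | rfl
        · exact .neg i f ⟨hi1, h1⟩ ⟨by omega, hf'⟩
        · exact .zero f ⟨by omega, hf'⟩
      · rw [List.map_append, map_val_block hi1 hi2, toC_reverse, List.map_reverse,
          map_val_toC_bracket (by omega) le_rfl (by omega), hw]
    · rw [Nat.cast_succ] at hz'
      rw [Nat.cast_succ, add_sub_cancel_right] at hw
      refine ⟨0, _, .zero' z rs ⟨hz, hz'⟩ hrs fun r hr' => ?_, ?_⟩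
      · have := hr r hr'
        omega
      · rw [List.map_append, map_val_block (by omega) (by omega), toC_append, List.map_append,
          toC_reverse, List.map_reverse, map_val_toC_bracket (by omega) le_rfl (.inl hz),
          map_val_toC_flatMap_bracket fun r hr' => by have := hr r hr'; omega, hw]

/-- The normal form of the second type of a canonical list. -/
theorem exists_second_of_isChain {a b : List (ℤ × ℤ)} (hc : IsShape (n + 1) (a ++ b))
    (ha : ∀ x ∈ a, x.2 = ((n + 1 : ℕ) : ℤ)) (hb : ∀ x ∈ b, x.2 < ((n + 1 : ℕ) : ℤ))
    (hchain : (a ++ b).IsChain NormalStep)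
    (hne : ∀ x ∈ a, x.1 ≠ -(n : ℤ)) :
    ∃ is k, IsSecondType n is k b ∧ (NormalForm.second is k b).shape n = a ++ b := by
  obtain ⟨hchaina, hchainb, hjoin⟩ := List.isChain_append.1 hchain
  have hS : IsStembridge n b := isStembridge_of_isChain hc.of_append hb hchainb
  have hbounds : ∀ x ∈ a, -(n : ℤ) ≤ x.1 ∧ x.1 ≤ n + 1 := by
    intro x hx
    have h1 := hc.bounds x (by simp [hx])
    have h2 := ha x hx
    push_cast at h1 h2
    omega
  obtain ⟨p, z, rfl, h1, h2, h3⟩ | ⟨p, x, rfl, h1, h2, h3⟩ := leftCondition_of_isChain hchaina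
  · refine ⟨p.map Prod.fst, z.length, ?_, ?_⟩
    · have hpos : ∀ js ip, p.map Prod.fst = js ++ [ip] → 0 < ip := by
        intro js ip h
        obtain ⟨x, hx, rfl⟩ := List.mem_map.1 (show ip ∈ p.map Prod.fst by rw [h]; simp)
        exact h2 x hx
      constructor
      · exact hS
      · intro i hi
        obtain ⟨x, hx, rfl⟩ := List.mem_map.1 hi
        exact hbounds x (by simp [hx])
      · intro hz
        rcases z with _ | ⟨x, z⟩
        · simp at hz
        · rw [List.append_assoc] at hchain
          have h4 := forall_eq_zero_of_isChain (List.isChain_append.1 hchain).2.1 (h3 x (by simp))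
          exact fun y hy => h4 y (by simp [hy])
      · intro js ip h
        rw [abs_of_pos (hpos js ip h), ← h]
        exact ⟨h1, hpos js ip h⟩
      · intro js ip h h4
        exact absurd (hpos js ip h) h4.not_gt
      · intro js ip h hz hip y hy
        rw [List.length_eq_zero_iff.1 hz, List.append_nil] at hjoin
        obtain ⟨p', q, rfl, rfl, h5⟩ := List.map_eq_append_iff.1 h
        obtain ⟨x, q', rfl, rfl, h6⟩ := List.map_eq_cons_iff.1 h5
        obtain rfl := List.map_eq_nil_iff.1 h6
        have h7 := (hjoin x (by simp) y hy).2
        rw [Int.abs_eq_natAbs]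
        omega
    · rw [NormalForm.shape, ← exists_eq_map_mk fun x hx => ha x (by simp [hx]), List.append_assoc]
      congr 2
      exact (List.eq_replicate_iff.2 ⟨rfl, fun x hx => Prod.ext (h3 x hx) (ha x (by simp [hx]))⟩).symm
  · have hnil : b = [] := by
      rcases b with _ | ⟨y, b⟩
      · rfl
      · have := (hjoin x (by simp) y (by simp)).1
        omega
    subst hnil
    have hlast : ∀ js ip, (p ++ [x]).map Prod.fst = js ++ [ip] → js = p.map Prod.fst ∧ ip = x.1 := by
      intro js ip h
      rw [List.map_append, List.map_singleton] at h
      obtain ⟨h4, h5⟩ := List.append_inj' h rfl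
      exact ⟨h4.symm, by simpa using h5.symm⟩
    refine ⟨(p ++ [x]).map Prod.fst, 0, ?_, ?_⟩
    · constructor
      · exact hS
      · intro i hi
        obtain ⟨y, hy, rfl⟩ := List.mem_map.1 hi
        exact hbounds y hy
      · intro h; omega
      · intro js ip h
        obtain ⟨rfl, rfl⟩ := hlast js ip h
        rw [abs_of_neg h3]
        refine ⟨List.pairwise_append.2 ⟨h1, by simp, ?_⟩, by omega⟩
        intro i hi y hy
        obtain ⟨w, hw, rfl⟩ := List.mem_map.1 hi
        rw [List.mem_singleton.1 hy]
        exact h2 w hw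
      · intro js ip h _
        obtain ⟨rfl, rfl⟩ := hlast js ip h
        exact ⟨rfl, rfl, hne x (by simp)⟩
      · intro js ip h _ hip
        obtain ⟨rfl, rfl⟩ := hlast js ip h
        omega
    · rw [NormalForm.shape, ← exists_eq_map_mk ha]
      simp

/-- A word without forbidden factor with at least two letters `N` has a normal form. -/
theorem exists_normalForm (hn : 1 ≤ n) {x y : ℤ × ℤ} {a b : List (ℤ × ℤ)}
    (hc : IsShape (n + 1) (x :: y :: a ++ b)) (ha : ∀ z ∈ x :: y :: a, z.2 = ((n + 1 : ℕ) : ℤ))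
    (hb : ∀ z ∈ b, z.2 < ((n + 1 : ℕ) : ℤ))
    (h : Avoid (natC (n + 1)) (pathWord (x :: y :: a ++ b))) :
    ∃ d : NormalForm, d.IsValid n ∧ (d.word n).map Fin.val = pathWord (x :: y :: a ++ b) := by
  obtain ⟨i, g⟩ := x
  obtain ⟨l, g'⟩ := y
  obtain rfl : g = ((n + 1 : ℕ) : ℤ) := ha (i, g) (by simp)
  obtain rfl : g' = ((n + 1 : ℕ) : ℤ) := ha (l, g') (by simp)
  have hi := hc.bounds (i, ((n + 1 : ℕ) : ℤ)) (by simp)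
  simp only [forall_const] at hi
  have hi1 : -(n : ℤ) ≤ i := by push_cast at hi; omega
  have hi2 : i ≤ n + 1 := by push_cast at hi; omega
  have hcast : -(((n + 1 : ℕ) : ℤ) - 1) = -(n : ℤ) := by push_cast; ring
  simp only [List.cons_append] at hc h ⊢
  -- The second left end decides between the two types: -n starts the zigzag, and any other value
  -- makes the whole list normal.
  by_cases hl : l = -(n : ℤ)
  · subst hl
    rw [pathWord_cons] at h
    have h1 := h.of_append_right
    rw [pathWord_cons] at h1
    obtain ⟨k, f, hf, hf', hw⟩ := pathWord_eq_zigzag (N := n + 1) (c := a ++ b) (by omega)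
      (by rw [hcast]; exact hc.tail) (by rw [hcast]; exact h1)
    have hd : (NormalForm.first i (k + 1) f).IsValid n :=
      ⟨⟨hi1, hi2⟩, ⟨by push_cast at hf; omega, by push_cast at hf'; omega⟩⟩
    refine ⟨.first i (k + 1) f, hd, ?_⟩
    rw [NormalForm.map_val_word hd, NormalForm.shape, pathWord_append, pathWord_tailShape hd.2.1,
      pathWord_cons, pathWord_cons, pathWord_cons, hw, hcast, List.replicate_succ, pathWord_cons]
    simp only [List.append_assoc]
    congr 3
    · rw [pathWord, List.flatMap_def, List.map_replicate]
    · push_cast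
      ring_nf
  · have hstep : NormalStep (i, ((n + 1 : ℕ) : ℤ)) (l, ((n + 1 : ℕ) : ℤ)) := by
      refine (normal_or_exceptional (by omega) hc h).resolve_right ?_
      rintro ⟨-, -, h2 | ⟨-, h2⟩⟩
      · omega
      · exact hl (h2.trans hcast)
    have h2 : l < ((n + 1 : ℕ) : ℤ) := by
      have := hstep.2
      simp only at this
      omega
    obtain ⟨h3, h4⟩ := isChain_normal_of_prev (by omega) (hi.2.2.2.1) hc.tail
      (by rw [pathWord_cons] at h; exact h) h2 (by rw [hcast]; simpa using hl)
    obtain ⟨is, k, hS, hshape⟩ := exists_second_of_isChain (a := (i, ((n + 1 : ℕ) : ℤ)) ::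
      (l, ((n + 1 : ℕ) : ℤ)) :: a) (b := b) hc ha hb (List.isChain_cons_cons.2 ⟨hstep, h3⟩) (by
        intro x hx hx1
        rcases List.mem_cons.1 hx with rfl | hx'
        · have := hstep.1
          simp only at hx1 this
          omega
        · refine h4 x ?_ ?_
          · rw [← List.cons_append]; exact List.mem_append_left _ hx'
          · rw [hcast]; exact Prod.ext hx1 (ha x hx))
    have hd : (NormalForm.second is k b).IsValid n := hS
    refine ⟨.second is k b, hd, ?_⟩
    rw [NormalForm.map_val_word hd, hshape]
    rfl

/-- A fully commutative element has a reduced word with a canonical list. -/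
theorem exists_shape_of_isFullyCommutative (hn : 1 ≤ n) {w : (affineC n).Group}
    (hw : IsFullyCommutative (csC n) w) : ∃ c a b, c = a ++ b ∧ IsShape (n + 1) c ∧
      (∀ x ∈ a, x.2 = ((n + 1 : ℕ) : ℤ)) ∧ (∀ x ∈ b, x.2 < ((n + 1 : ℕ) : ℤ)) ∧
      Avoid (natC (n + 1)) (pathWord c) ∧ a.length = affineLength n w ∧
      ∀ τ : List (Fin (n + 2)), τ.map Fin.val = pathWord c →
        (csC n).IsReduced τ ∧ (csC n).wordProd τ = w := by
  obtain ⟨ω, hω, rfl⟩ := (csC n).exists_isReduced w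
  have h1 : Avoid (natC (n + 1)) (ω.map Fin.val) :=
    (avoid_map_iff Fin.val_injective natC_val).2
      (CoxeterSystem.avoid_of_isFullyCommutative hω hw)
  obtain ⟨c, hc, hcomm⟩ := exists_isShape (by omega) (by
    intro x hx
    obtain ⟨y, -, rfl⟩ := List.mem_map.1 hx
    omega) h1
  obtain ⟨a, b, rfl, ha, hb⟩ := hc.exists_append
  refine ⟨_, a, b, rfl, hc, ha, hb, h1.of_comm hcomm, ?_, fun τ hτ => ?_⟩
  · rw [← count_pathWord_of_eq hc ha hb, affineLength_eq_count hw hω rfl, ← hcomm.perm.count_eq,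
      ← List.count_map_of_injective ω Fin.val Fin.val_injective]
    rfl
  · rw [← hτ] at hcomm
    have h2 := (comm_map_iff Fin.val_injective natC_val).1 hcomm
    exact ⟨hω.of_comm h2, ((csC n).wordProd_eq_of_comm h2).symm⟩

/-- Both words are reduced words of one fully commutative element, hence equivalent by commutations,
so their canonical lists agree and `shape_injective` applies. -/
theorem NormalForm.eq_of_wordProd_eq (hn : 1 ≤ n) {d d' : NormalForm} (hd : d.IsValid n)
    (hd' : d'.IsValid n) (h : (csC n).wordProd (d.word n) = (csC n).wordProd (d'.word n))
    (hL : 2 ≤ affineLength n ((csC n).wordProd (d.word n))) : d = d' := by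
  obtain ⟨h1, h2, h3⟩ := affineC_spec hn (NormalForm.avoid_word hn hd)
  obtain ⟨h1', h2', h3'⟩ := affineC_spec hn (NormalForm.avoid_word hn hd')
  have hcomm : Comm (affineC n) (d.word n) (d'.word n) := h2 _ _ h1 h1' rfl h.symm
  have hcomm' := (comm_map_iff Fin.val_injective natC_val).2 hcomm
  rw [NormalForm.map_val_word hd, NormalForm.map_val_word hd'] at hcomm'
  refine NormalForm.shape_injective hd hd' (h3 ▸ hL) (h3' ▸ h ▸ hL) hn ?_
  exact eq_of_comm_pathWord (NormalForm.isShape_shape hd) (NormalForm.isShape_shape hd') hcomm'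

end Existence

/-! ### The classification theorem -/

theorem theorem4p5 (n : ℕ) (hn : 1 ≤ n) :
    -- affine length at least two: existence and uniqueness of the normal form
    (∀ w : (affineC n).Group, IsFullyCommutative (csC n) w → 2 ≤ affineLength n w →
      ∃! d : NormalForm, d.IsValid n ∧
        (csC n).IsReduced (d.word n) ∧ (csC n).wordProd (d.word n) = w) ∧
    -- affine length one
    (∀ w : (affineC n).Group, IsFullyCommutative (csC n) w → affineLength n w = 1 →
      ∃ (i : ℤ) (v : List (Fin (n + 1))), IsLengthOneForm n i v ∧
        (csC n).IsReduced (block n i ++ toC v) ∧ (csC n).wordProd (block n i ++ toC v) = w) ∧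
    -- conversely, words of the first type
    (∀ (i f : ℤ) (k : ℕ), IsFirstType n i f →
      (csC n).IsReduced ((NormalForm.first i k f).word n) ∧
      IsFullyCommutative (csC n) ((csC n).wordProd ((NormalForm.first i k f).word n)) ∧
      affineLength n ((csC n).wordProd ((NormalForm.first i k f).word n)) = k + 1) ∧
    -- conversely, words of the second type
    (∀ (is : List ℤ) (k : ℕ) (b : List (ℤ × ℤ)), IsSecondType n is k b →
      (csC n).IsReduced ((NormalForm.second is k b).word n) ∧
      IsFullyCommutative (csC n) ((csC n).wordProd ((NormalForm.second is k b).word n)) ∧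
      affineLength n ((csC n).wordProd ((NormalForm.second is k b).word n)) = is.length + k ∧
      is.length ≤ n + 1 ∧
      (csB n).IsReduced (bracketWord n b) ∧
      IsFullyCommutative (csB n) ((csB n).wordProd (bracketWord n b))) ∧
    -- conversely, words of affine length one
    (∀ (i : ℤ) (v : List (Fin (n + 1))), IsLengthOneForm n i v →
      (csC n).IsReduced (block n i ++ toC v) ∧
      IsFullyCommutative (csC n) ((csC n).wordProd (block n i ++ toC v)) ∧
      affineLength n ((csC n).wordProd (block n i ++ toC v)) = 1) := by
  refine ⟨fun w hw hL => ?_, fun w hw hL => ?_, fun i f k h => ?_, fun is k b h => ?_,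
    fun i v h => ?_⟩
  · obtain ⟨c, a, b, rfl, hc, ha, hb, hav, hlen, hred⟩ := exists_shape_of_isFullyCommutative hn hw
    rcases a with _ | ⟨x, _ | ⟨y, a⟩⟩
    · simp only [List.length_nil] at hlen; omega
    · simp only [List.length_cons, List.length_nil] at hlen; omega
    obtain ⟨d, hd, hdw⟩ := exists_normalForm hn hc ha hb hav
    obtain ⟨h1, h2⟩ := hred _ hdw
    refine ⟨d, ⟨hd, h1, h2⟩, ?_⟩
    rintro d' ⟨hd', -, h2'⟩
    exact (NormalForm.eq_of_wordProd_eq hn hd hd' (h2.trans h2'.symm) (h2.symm ▸ hL)).symm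
  · obtain ⟨c, a, b, rfl, hc, ha, hb, hav, hlen, hred⟩ := exists_shape_of_isFullyCommutative hn hw
    rw [hL] at hlen
    obtain ⟨x, rfl⟩ := List.length_eq_one_iff.1 hlen
    obtain ⟨i, v, hiv, hv⟩ := exists_isLengthOneForm hn hc (ha x (by simp)) hb hav
    exact ⟨i, v, hiv, hred _ hv⟩
  · have hd : (NormalForm.first i k f).IsValid n := h
    obtain ⟨h1, h2, h3⟩ := affineC_spec hn (NormalForm.avoid_word hn hd)
    refine ⟨h1, h2, ?_⟩
    rw [h3, NormalForm.word, List.count_append, List.count_append, count_last_block,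
      count_last_flatten_replicate, ← toC_reverse, count_last_toC]
    omega
  · have hd : (NormalForm.second is k b).IsValid n := h
    have hav := NormalForm.avoid_word hn hd
    obtain ⟨h1, h2, h3⟩ := affineC_spec hn hav
    rw [NormalForm.word, List.map_append] at hav
    refine ⟨h1, h2, ?_, h.length_le, typeB_spec hn hav.of_append_right⟩
    rw [h3, NormalForm.word, List.count_append, List.count_append, count_last_flatMap_block,
      count_last_flatten_replicate, count_last_toC, add_zero]
  · obtain ⟨h1, h2, h3⟩ := affineC_spec hn (h.avoid hn)
    refine ⟨h1, h2, ?_⟩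
    rw [h3, List.count_append, count_last_block, count_last_toC]
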